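/- Graphs are finite and connected, with loops and multiple edges allowed; embeddings are cellular embeddings in oriented surfaces, counted combinatorially (one for each rotation system). All root vertices are $2$-valent, and the two roots of a doubly rooted graph are distinct. For a sequence $A=(a_k)_{k\ge 0}$ of nonnegative integers put $a_k=0$ for $k<0$, and let $A^+=(a_{k-1})_k$. $A$ is log-concave if $a_{k-1}a_{k+1}\le a_k^2$ for all $k$; it has no internal zeros if $i<k<j$ and $a_ia_j\neq 0$ imply $a_k\ne 0$. Write $A\sim B$ if $A$ and $B$ are log-concave and $a_{k-1}b_{k+1}\le a_kb_k$, $a_{k+1}b_{k-1}\le a_kb_k$ for all $k$; write $A\lesssim B$ if $A\sim B$ and $a_{k+1}b_k\le a_kb_{k+1}$ for all $k$. An inequality $\frac ab\le\frac cd$ with $a,b,c,d\ge0$ counts as true if $a=b=0$, or $c=d=0$, or $b=d=0$ (and $\frac x0=\infty$ for $x>0$). The genus distribution $\Gamma(G)$ is the sequence whose $i$-th term is the number of embeddings of $G$ in the orientable surface of genus $i$. For a vertex-rooted graph $(G,t)$, the $i$-th terms of $D_{(G,t)}$ and $S_{(G,t)}$ count the embeddings of genus $i$ in which two different face-boundary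 walks are incident on $t$, respectively a single face-boundary walk is twice incident on $t$. For a doubly vertex-rooted graph $(H,u,v)$, embeddings of type $DD,DS,SD,SS$ are those in which the first letter ($D$ or $S$) describes $u$ in this sense and the second letter describes $v$. They are refined as follows. $DD^0,DD',DD''$: exactly $0,1,2$ face-boundary walks are incident on both roots. $DS^0,DS'$ and $SD^0,SD'$: exactly $0,1$ face-boundary walks are incident on both roots. $SS^0$: no face-boundary walk is incident on both roots. $SS^1$, $SS^2$: one face-boundary walk visits both roots, in cyclic order $u,u,v,v$, respectively $u,v,u,v$. The same symbols denote the sequences of the numbers of such embeddings by genus, so that $DD=DD^0+DD'+DD''$, $DS=DS^0+DS'$, $SD=SD^0+SD'$, $SS=SS^0+SS^1+SS^2$. Put $$A_1=DD^{0+}+DD'^{+}+SS^2+SD,\quad A_2=SD+DD,\quad B_1=DS^{+}+DD''^{+}+SS^0+SS^1,\quad B_2=SS+DS,$$ with terms $a_{1,k},a_{2,k},b_{1,k},b_{2,k}$. **Corollary.** Let $(G,t)$ be a vertex-rooted graph such that $D_{(G,t)}$ and $S_{(G,t)}$ have no internal zeros and $D_{(G,t)}\lesssim S_{(G,t)}$.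 Let $(H_k,u_k,v_k)$, $1\le k\le n$, be doubly vertex-rooted graphs such that, for each of them, the sequences $A_1,A_2,B_1,B_2$ have no internal zeros, $A_1,A_2$ are not both identically zero, $B_1,B_2$ are not both identically zero, and $$\frac{b_{1,k}}{a_{1,k}}\le\frac{b_{2,k}}{a_{2,k}}\le\frac{b_{1,k+1}}{a_{1,k+1}}\quad\text{and}\quad \frac{a_{1,k-1}}{b_{1,k}}\le\frac{a_{2,k-1}}{b_{2,k}}\le\frac{a_{1,k}}{b_{1,k+1}}\qquad\text{for all }k.$$ Let $(X_n,v_n)=(G,t)*(H_1,u_1,v_1)*\cdots*(H_n,u_n,v_n)$ be obtained by iterated vertex-amalgamation: at the $k$-th step the root of the graph built so far is merged with $u_k$, and $v_k$ becomes the root. Then $D_{(X_n,v_n)}$ and $S_{(X_n,v_n)}$ are log-concave without internal zeros, $D_{(X_n,v_n)}\lesssim S_{(X_n,v_n)}$, and the genus distribution $\Gamma(X_n)$ is log-concave without internal zeros. -/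

import Mathlib

universe u

namespace GenusChain

/-! ## Sequences

A sequence is a function `ℕ → ℕ`; its terms of negative index are zero. -/

/-- `A` has no internal zeros. -/
def NoInternalZeros (a : ℕ → ℕ) : Prop :=
  ∀ i k j, i < k → k < j → a i ≠ 0 → a j ≠ 0 → a k ≠ 0

/-- `a_{k-1} a_{k+1} ≤ a_k ^ 2` for all `k` (trivial for `k ≤ 0`). -/
def LogConcave (a : ℕ → ℕ) : Prop :=
  ∀ k, a k * a (k + 2) ≤ a (k + 1) ^ 2

/-- Synchronicity `A ∼ B`: both sequences are log-concave, `a_{k-1} b_{k+1} ≤ a_k b_k` and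
`a_{k+1} b_{k-1} ≤ a_k b_k` for all `k`. -/
def Synchronized (a b : ℕ → ℕ) : Prop :=
  LogConcave a ∧ LogConcave b ∧
    (∀ k, a k * b (k + 2) ≤ a (k + 1) * b (k + 1)) ∧
    (∀ k, a (k + 2) * b k ≤ a (k + 1) * b (k + 1))

/-- `A ≲ B`: the sequence `B` is ratio-dominant over `A`. -/
def RatioDominated (a b : ℕ → ℕ) : Prop :=
  Synchronized a b ∧ ∀ k, a (k + 1) * b k ≤ a k * b (k + 1)

/-- The offset sequence `A⁺`, with `a⁺_k = a_{k-1}`. -/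
def offset (a : ℕ → ℕ) : ℕ → ℕ
  | 0 => 0
  | k + 1 => a k

/-- The inequality `p / q ≤ r / s` between fractions of nonnegative integers, with values in
`[0, ∞]`, where it counts as true if `p = q = 0`, or `r = s = 0`, or `q = s = 0`. -/
def RatioLE (p q r s : ℕ) : Prop :=
  (p = 0 ∧ q = 0) ∨ (r = 0 ∧ s = 0) ∨ (q = 0 ∧ s = 0) ∨
    (p : ENNReal) / (q : ENNReal) ≤ (r : ENNReal) / (s : ENNReal)

theorem ratioLE_iff (p q r s : ℕ) : RatioLE p q r s ↔ p * s ≤ r * q := by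
  unfold RatioLE
  rcases Nat.eq_zero_or_pos q with rfl | hq
  · rcases Nat.eq_zero_or_pos p with rfl | hp
    · simp
    · rcases Nat.eq_zero_or_pos s with rfl | hs
      · simp
      · have h1 : (p : ENNReal) ≠ 0 := by exact_mod_cast hp.ne'
        have h2 : (s : ENNReal) ≠ 0 := by exact_mod_cast hs.ne'
        have h3 : (r : ENNReal) / (s : ENNReal) ≠ ⊤ :=
          ENNReal.div_ne_top (ENNReal.natCast_ne_top r) h2
        simp [ENNReal.div_zero h1, hp.ne', hs.ne', h3]
  · rcases Nat.eq_zero_or_pos s with rfl | hs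
    · rcases Nat.eq_zero_or_pos r with rfl | hr
      · simp
      · have h1 : (r : ENNReal) ≠ 0 := by exact_mod_cast hr.ne'
        simp [ENNReal.div_zero h1]
    · have h1 : (q : ENNReal) ≠ 0 := by exact_mod_cast hq.ne'
      have h2 : (s : ENNReal) ≠ 0 := by exact_mod_cast hs.ne'
      have h3 : (p : ENNReal) / (q : ENNReal) ≤ (r : ENNReal) / (s : ENNReal) ↔
          p * s ≤ r * q := by
        rw [ENNReal.div_le_iff h1 (ENNReal.natCast_ne_top q), ENNReal.div_eq_inv_mul,
          mul_assoc, ← ENNReal.div_eq_inv_mul,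
          ENNReal.le_div_iff_mul_le (Or.inl h2) (Or.inl (ENNReal.natCast_ne_top s))]
        exact_mod_cast Iff.rfl
      rw [h3]
      simp [hq.ne', hs.ne']

/-! ## Graphs, rotation systems and embeddings -/

/-- A finite connected graph, loops and multiple edges allowed. Each edge consists of two
half-edges, exchanged by `inv`; the half-edge `h` is attached to the vertex `vert h`. -/
structure MultiGraph where
  V : Type u
  E : Type u
  finite_V : Finite V
  finite_E : Finite E
  vert : E → V
  inv : Equiv.Perm E
  inv_inv : ∀ h, inv (inv h) = h
  inv_ne : ∀ h, inv h ≠ h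
  connected : ∀ x y, Relation.ReflTransGen (fun a b => ∃ h, vert h = a ∧ vert (inv h) = b) x y

namespace MultiGraph

attribute [instance] MultiGraph.finite_V MultiGraph.finite_E

variable (G : MultiGraph.{u})

/-- The number of half-edges at a vertex. -/
noncomputable def valence (y : G.V) : ℕ := Nat.card {h : G.E // G.vert h = y}

/-- The number of edges (pairs of half-edges). -/
noncomputable def edgeCount : ℕ := Nat.card (Quotient (Equiv.Perm.SameCycle.setoid G.inv))

/-- A rotation system: a permutation of the half-edges that permutes the half-edges at each
vertex in a single cycle. Rotation systems correspond to the combinatorially distinct cellular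
embeddings of the graph in oriented surfaces. -/
def IsRotation (σ : Equiv.Perm G.E) : Prop :=
  ∀ h k, σ.SameCycle h k ↔ G.vert h = G.vert k

/-- Face tracing: from a half-edge cross to the other end of its edge, then take the next
half-edge in the rotation there. Each half-edge `h` in an orbit of this permutation is one
incidence of the corresponding face-boundary walk on the vertex `vert h`. -/
def faceStep (σ : Equiv.Perm G.E) : Equiv.Perm G.E := σ * G.inv

/-- The face-boundary walks of the embedding: the orbits of face tracing. -/
def Face (σ : Equiv.Perm G.E) : Type u :=
  Quotient (Equiv.Perm.SameCycle.setoid (G.faceStep σ))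

/-- The face-boundary walk through a half-edge. -/
def faceOf (σ : Equiv.Perm G.E) (h : G.E) : G.Face σ :=
  Quotient.mk (Equiv.Perm.SameCycle.setoid (G.faceStep σ)) h

/-- The face-boundary walks incident on a vertex. -/
def facesAt (σ : Equiv.Perm G.E) (y : G.V) : Set (G.Face σ) :=
  {f | ∃ h, G.vert h = y ∧ G.faceOf σ h = f}

/-- Euler's formula: the embedding lies in the orientable surface of genus `i`
(for a graph with at least one edge). -/
def HasGenus (σ : Equiv.Perm G.E) (i : ℕ) : Prop :=
  (Nat.card G.V : ℤ) - G.edgeCount + Nat.card (G.Face σ) = 2 - 2 * i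

/-- The number of embeddings in the orientable surface of genus `i` that have property `P`. -/
noncomputable def countEmb (P : Equiv.Perm G.E → Prop) (i : ℕ) : ℕ :=
  {σ : Equiv.Perm G.E | G.IsRotation σ ∧ G.HasGenus σ i ∧ P σ}.ncard

/-- The genus distribution `Γ(G)`. -/
noncomputable def genusDist : ℕ → ℕ := G.countEmb (fun _ => True)

/-- Two different face-boundary walks are incident on the (2-valent) vertex `y`. -/
def TypeD (y : G.V) (σ : Equiv.Perm G.E) : Prop := (G.facesAt σ y).ncard = 2

/-- A single face-boundary walk is (twice) incident on the (2-valent) vertex `y`. -/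
def TypeS (y : G.V) (σ : Equiv.Perm G.E) : Prop := (G.facesAt σ y).ncard = 1

/-- The number of face-boundary walks that are incident on both `x` and `y`. -/
noncomputable def commonFaces (x y : G.V) (σ : Equiv.Perm G.E) : ℕ :=
  (G.facesAt σ x ∩ G.facesAt σ y).ncard

/-- Along the face-boundary walks, `y` is met between any visit to `x` and the next visit to
`x`. For 2-valent `x ≠ y` of type `S`, this says that a single face-boundary walk visits both
vertices, in the cyclic order `x, y, x, y`. -/
def Alternating (x y : G.V) (σ : Equiv.Perm G.E) : Prop :=
  ∀ h, G.vert h = x → ∃ k, 0 < k ∧ G.vert ((G.faceStep σ ^ k) h) = y ∧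
    ∀ j, 0 < j → j < k → G.vert ((G.faceStep σ ^ j) h) ≠ x

end MultiGraph

/-! ## Vertex-rooted graphs and their partial genus distributions -/

/-- A graph with a 2-valent root vertex `t`. -/
structure RootedGraph extends MultiGraph.{u} where
  t : V
  valence_t : toMultiGraph.valence t = 2

namespace RootedGraph

variable (G : RootedGraph.{u})

/-- `D_(G,t)` -/
noncomputable def D : ℕ → ℕ := G.countEmb (G.TypeD G.t)

/-- `S_(G,t)` -/
noncomputable def S : ℕ → ℕ := G.countEmb (G.TypeS G.t)

end RootedGraph

/-- A graph with two distinct 2-valent root vertices `u` and `v`. -/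
structure DoublyRootedGraph extends MultiGraph.{u} where
  u : V
  v : V
  u_ne_v : u ≠ v
  valence_u : toMultiGraph.valence u = 2
  valence_v : toMultiGraph.valence v = 2

namespace DoublyRootedGraph

variable (H : DoublyRootedGraph.{u})

/-- `DD⁰`: no face-boundary walk is incident on both roots. -/
noncomputable def DD0 : ℕ → ℕ :=
  H.countEmb fun σ => H.TypeD H.u σ ∧ H.TypeD H.v σ ∧ H.commonFaces H.u H.v σ = 0

/-- `DD'`: exactly one face-boundary walk is incident on both roots. -/
noncomputable def DD1 : ℕ → ℕ :=
  H.countEmb fun σ => H.TypeD H.u σ ∧ H.TypeD H.v σ ∧ H.commonFaces H.u H.v σ = 1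

/-- `DD''`: two face-boundary walks are incident on both roots. -/
noncomputable def DD2 : ℕ → ℕ :=
  H.countEmb fun σ => H.TypeD H.u σ ∧ H.TypeD H.v σ ∧ H.commonFaces H.u H.v σ = 2

/-- `DS⁰` -/
noncomputable def DS0 : ℕ → ℕ :=
  H.countEmb fun σ => H.TypeD H.u σ ∧ H.TypeS H.v σ ∧ H.commonFaces H.u H.v σ = 0

/-- `DS'` -/
noncomputable def DS1 : ℕ → ℕ :=
  H.countEmb fun σ => H.TypeD H.u σ ∧ H.TypeS H.v σ ∧ H.commonFaces H.u H.v σ = 1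

/-- `SD⁰` -/
noncomputable def SD0 : ℕ → ℕ :=
  H.countEmb fun σ => H.TypeS H.u σ ∧ H.TypeD H.v σ ∧ H.commonFaces H.u H.v σ = 0

/-- `SD'` -/
noncomputable def SD1 : ℕ → ℕ :=
  H.countEmb fun σ => H.TypeS H.u σ ∧ H.TypeD H.v σ ∧ H.commonFaces H.u H.v σ = 1

/-- `SS⁰`: the face-boundary walks at the two roots are different. -/
noncomputable def SS0 : ℕ → ℕ :=
  H.countEmb fun σ => H.TypeS H.u σ ∧ H.TypeS H.v σ ∧ H.commonFaces H.u H.v σ = 0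

/-- `SS¹`: one face-boundary walk visits both roots, in the cyclic order `u, u, v, v`. -/
noncomputable def SS1 : ℕ → ℕ :=
  H.countEmb fun σ => H.TypeS H.u σ ∧ H.TypeS H.v σ ∧ H.commonFaces H.u H.v σ = 1 ∧
    ¬ H.Alternating H.u H.v σ

/-- `SS²`: one face-boundary walk visits both roots, in the cyclic order `u, v, u, v`. -/
noncomputable def SS2 : ℕ → ℕ :=
  H.countEmb fun σ => H.TypeS H.u σ ∧ H.TypeS H.v σ ∧ H.commonFaces H.u H.v σ = 1 ∧
    H.Alternating H.u H.v σ

noncomputable def DD : ℕ → ℕ := H.DD0 + H.DD1 + H.DD2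
noncomputable def DS : ℕ → ℕ := H.DS0 + H.DS1
noncomputable def SD : ℕ → ℕ := H.SD0 + H.SD1
noncomputable def SS : ℕ → ℕ := H.SS0 + H.SS1 + H.SS2

noncomputable def A₁ : ℕ → ℕ := offset H.DD0 + offset H.DD1 + H.SS2 + H.SD
noncomputable def A₂ : ℕ → ℕ := H.SD + H.DD
noncomputable def B₁ : ℕ → ℕ := offset H.DS + offset H.DD2 + H.SS0 + H.SS1
noncomputable def B₂ : ℕ → ℕ := H.SS + H.DS

/-- The lexicographic conditions, for all `i`:
`b_{1,i}/a_{1,i} ≤ b_{2,i}/a_{2,i} ≤ b_{1,i+1}/a_{1,i+1}` and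
`a_{1,i-1}/b_{1,i} ≤ a_{2,i-1}/b_{2,i} ≤ a_{1,i}/b_{1,i+1}`.
For negative `i` they hold trivially. -/
def Lexicographic : Prop :=
  ∀ i : ℕ,
    RatioLE (H.B₁ i) (H.A₁ i) (H.B₂ i) (H.A₂ i) ∧
    RatioLE (H.B₂ i) (H.A₂ i) (H.B₁ (i + 1)) (H.A₁ (i + 1)) ∧
    RatioLE (offset H.A₁ i) (H.B₁ i) (offset H.A₂ i) (H.B₂ i) ∧
    RatioLE (offset H.A₂ i) (H.B₂ i) (H.A₁ i) (H.B₁ (i + 1))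

end DoublyRootedGraph

/-! ## Vertex amalgamation -/

section Amalgamation

variable (G : RootedGraph.{u}) (H : DoublyRootedGraph.{u})

/-- The vertices of the amalgamation: those of `G`, and those of `H` other than `u`
(which is identified with the root `t` of `G`). -/
abbrev AmalgV : Type u := G.V ⊕ {w : H.V // w ≠ H.u}

open Classical in
/-- The image of a vertex of `H` in the amalgamation. -/
noncomputable def glue (w : H.V) : AmalgV G H :=
  if hw : w = H.u then Sum.inl G.t else Sum.inr ⟨w, hw⟩

/-- The end vertex of a half-edge in the amalgamation. -/
noncomputable def amalgVert : G.E ⊕ H.E → AmalgV G H :=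
  Sum.elim (fun h => Sum.inl (G.vert h)) (fun h => glue G H (H.vert h))

theorem glue_u : glue G H H.u = Sum.inl G.t := by simp [glue]

theorem glue_ne {w : H.V} (hw : w ≠ H.u) : glue G H w = Sum.inr ⟨w, hw⟩ := by
  simp [glue, hw]

/-- The graph obtained from the disjoint union of `G` and `H` by merging `t` with `u`. -/
noncomputable def amalgGraph : MultiGraph.{u} where
  V := AmalgV G H
  E := G.E ⊕ H.E
  finite_V := inferInstance
  finite_E := inferInstance
  vert := amalgVert G H
  inv := Equiv.sumCongr G.inv H.inv
  inv_inv := by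
    rintro (h | h)
    · simp [G.inv_inv]
    · simp [H.inv_inv]
  inv_ne := by
    rintro (h | h)
    · simpa using G.inv_ne h
    · simpa using H.inv_ne h
  connected := by
    have hG : ∀ x y : G.V, Relation.ReflTransGen
        (fun a b => ∃ h, amalgVert G H h = a ∧
          amalgVert G H ((Equiv.sumCongr G.inv H.inv) h) = b) (Sum.inl x) (Sum.inl y) := by
      intro x y
      refine (G.connected x y).lift (fun a => (Sum.inl a : AmalgV G H)) ?_
      rintro a b ⟨h, rfl, rfl⟩
      exact ⟨Sum.inl h, rfl, rfl⟩
    have hH : ∀ x y : H.V, Relation.ReflTransGen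
        (fun a b => ∃ h, amalgVert G H h = a ∧
          amalgVert G H ((Equiv.sumCongr G.inv H.inv) h) = b) (glue G H x) (glue G H y) := by
      intro x y
      refine (H.connected x y).lift (glue G H) ?_
      rintro a b ⟨h, rfl, rfl⟩
      exact ⟨Sum.inr h, rfl, rfl⟩
    have hu := glue_u G H
    rintro (x | ⟨x, hx⟩) (y | ⟨y, hy⟩)
    · exact hG x y
    · have h := hH H.u y
      rw [hu, glue_ne G H hy] at h
      exact (hG x G.t).trans h
    · have h := hH x H.u
      rw [hu, glue_ne G H hx] at h
      exact h.trans (hG G.t y)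
    · have h := hH x y
      rwa [glue_ne G H hx, glue_ne G H hy] at h

/-- The vertex-amalgamation `(X, v) = (G, t) * (H, u, v)`, rooted at `v`. -/
noncomputable def amalg : RootedGraph.{u} where
  toMultiGraph := amalgGraph G H
  t := Sum.inr ⟨H.v, H.u_ne_v.symm⟩
  valence_t := by
    rw [← H.valence_v]
    refine (Nat.card_congr (Equiv.ofBijective
      (fun h : {h : H.E // H.vert h = H.v} =>
        (⟨Sum.inr h.1, by
          change glue G H (H.vert h.1) = _
          rw [h.2, glue_ne]⟩ :
        {h : (amalgGraph G H).E // (amalgGraph G H).vert h =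
          Sum.inr ⟨H.v, H.u_ne_v.symm⟩})) ⟨?_, ?_⟩)).symm
    · rintro ⟨a, ha⟩ ⟨b, hb⟩ hab
      exact Subtype.ext (Sum.inr_injective (congrArg Subtype.val hab))
    · rintro ⟨h | h, hh⟩
      · change Sum.inl (G.vert h) = _ at hh
        cases hh
      · change glue G H (H.vert h) = _ at hh
        by_cases hw : H.vert h = H.u
        · rw [hw, glue_u] at hh
          cases hh
        · rw [glue_ne G H hw] at hh
          refine ⟨⟨h, ?_⟩, rfl⟩
          simpa using hh

end Amalgamation

/-- The chain `(G, t) * (H₁, u₁, v₁) * ⋯ * (Hₙ, uₙ, vₙ)`, rooted at `vₙ`. -/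
noncomputable def chain (G : RootedGraph.{u}) (Hs : List DoublyRootedGraph.{u}) :
    RootedGraph.{u} :=
  Hs.foldl amalg G

end GenusChain

/-! An embedding is a rotation with its face permutation, and multiplying a permutation by a
transposition merges two cycles or splits one. At the merged vertex the rotations (a b) and (c d)
are joined to a 4-cycle in six ways. In the four non-alternating ones, and in all six if `G` has
type S at its root, the faces seen from `H` are unchanged. In the two alternating ones with `G` of
type D, they are those of `H` after its face permutation is multiplied by `swap c d`, the "twist" at
`u`. The sequences `A₂`, `B₂` count embeddings of `H` by type at `v`, and `A₁`, `B₁` do so after the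
twist. Hence (`amalg_D`, `amalg_S`) D_X = 2 D*A₁ + 4 D*A₂ + 6 S*A₂ and S_X = 2 D*B₁ + 4 D*B₂ + 6
S*B₂.

Interleave: let g alternate between 2D_k + 3S_k and D_k, let α alternate between the terms of B₁ and
B₂, and β between those of A₁ and A₂. Then S_X(k) and D_X(k) are twice the values of g*α and g*β at
2k+1 (`extend_eq_zconv`). The claims concern signs of 2×2 minors, and the Cauchy–Binet formula
(`cauchy_binet_le`, `zconv_mul_le`) deduces them from the minors of g and of the pair (α, β). The
lexicographic conditions are the minors of (α_t, β_t) and of (β_t, α_{t+2}) at consecutive t. They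
chain to all s ≤ t (`LexPair.merge_ratio`), and the product of the two resulting inequalities gives
log-concavity of α and β with step two (`log_concave_of_ratio`).

For the induction, D ≲ S is strengthened to the long-range form `RatioMonotone` of the interleaved
sequence S_k, D_k, S_{k+1}, D_{k+1}. It passes from (D, S) to g (`weighted_ratio_shift`) and from
`G` to the amalgamation (`RatioMonotone.amalg`), and it implies every claim.

Chaining breaks down at zero vectors inside the support; these are excluded topologically. Any two
rotation systems are conjugate by a product of transpositions of half-edges at common vertices. Each
such move multiplies the face permutation by two transpositions, so a move from type D to type S
keeps the genus or raises it by one (`exists_adjacent`). This serves `G` and (`H`, `v`); the twisted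
sequences are treated by comparison (`solid_of_solid`). -/

namespace GenusChain

/-! ## Cycles of permutations -/

section Permutations

open Equiv Equiv.Perm

variable {E : Type*}

/-- The number of cycles of a permutation, fixed points included. -/
noncomputable def numCycles (f : Perm E) : ℕ := Nat.card (Quotient (SameCycle.setoid f))

/-- The cycle relation is the least equivalence relation that relates each point to its image, so
comparisons of cycles need only one step of the permutation. -/
theorem sameCycle_rel_of_step {f : Perm E} {r : E → E → Prop} (hr : Equivalence r)
    (h : ∀ z, r z (f z)) {a b : E} (hab : f.SameCycle a b) : r a b := by
  obtain ⟨i, rfl⟩ := hab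
  induction i with
  | zero => simpa using hr.refl a
  | succ i ih =>
    refine hr.trans ih ?_
    have := h ((f ^ (i : ℤ)) a)
    rwa [← Perm.mul_apply, ← zpow_one_add, add_comm] at this
  | pred i ih =>
    refine hr.trans ih (hr.symm ?_)
    have := h ((f ^ (-(i : ℤ) - 1)) a)
    rwa [← Perm.mul_apply, ← zpow_one_add, add_sub_cancel] at this

theorem sameCycle_mono_of_step {f g : Perm E} (h : ∀ z, g.SameCycle z (f z)) {a b : E}
    (hab : f.SameCycle a b) : g.SameCycle a b :=
  sameCycle_rel_of_step (SameCycle.equivalence g) h hab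

theorem numCycles_le_card [Finite E] (f : Perm E) : numCycles f ≤ Nat.card E :=
  Nat.card_le_card_of_surjective (Quotient.mk (SameCycle.setoid f)) Quotient.mk_surjective

theorem numCycles_one : numCycles (1 : Perm E) = Nat.card E := by
  refine (Nat.card_congr (Equiv.ofBijective (Quotient.mk (SameCycle.setoid (1 : Perm E)))
    ⟨fun a b hab => ?_, Quotient.mk_surjective⟩)).symm
  exact sameCycle_one.1 (Quotient.exact hab)

/-! ### Multiplication of a permutation by a transposition -/

section Transposition

variable [DecidableEq E]

theorem swap_mul_apply_pow_apply (f : Perm E) (x y z : E) (k : ℕ) :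
    (swap x y * f) ((f ^ k) z) = swap x y ((f ^ (k + 1)) z) := by
  simp [pow_succ']

/-- The transposition intervenes only when the orbit reaches `x` or `y`; until then both orbits
agree. -/
theorem swap_mul_pow_apply {f : Perm E} {x y z : E} {k : ℕ}
    (h : ∀ j, 0 < j → j ≤ k → (f ^ j) z ≠ x ∧ (f ^ j) z ≠ y) :
    ((swap x y * f) ^ k) z = (f ^ k) z := by
  induction k with
  | zero => rfl
  | succ k ih =>
    rw [pow_succ', Perm.mul_apply, ih fun j h0 hj => h j h0 (hj.trans k.le_succ),
      swap_mul_apply_pow_apply]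
    obtain ⟨h1, h2⟩ := h (k + 1) k.succ_pos le_rfl
    exact swap_apply_of_ne_of_ne h1 h2

variable [Finite E]

/-- The first return to `{x, y}` from `x`. -/
theorem exists_first_return (f : Perm E) (x y : E) :
    ∃ k, 0 < k ∧ ((f ^ k) x = x ∨ (f ^ k) x = y) ∧
      ∀ j, 0 < j → j < k → (f ^ j) x ≠ x ∧ (f ^ j) x ≠ y := by
  classical
  have hex : ∃ k, 0 < k ∧ ((f ^ k) x = x ∨ (f ^ k) x = y) :=
    ⟨orderOf f, orderOf_pos f, Or.inl (by simp [pow_orderOf_eq_one])⟩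
  refine ⟨Nat.find hex, (Nat.find_spec hex).1, (Nat.find_spec hex).2, fun j h0 hj => ?_⟩
  have := Nat.find_min hex hj
  tauto

theorem swap_mul_sameCycle_of_not {f : Perm E} {x y : E} (h : ¬ f.SameCycle x y) :
    (swap x y * f).SameCycle x y := by
  obtain ⟨k, h0, hk, hj⟩ := exists_first_return f x y
  have hk' : (f ^ k) x = x := hk.resolve_right fun e => h ⟨k, by simpa using e⟩
  obtain ⟨k, rfl⟩ := Nat.exists_eq_succ_of_ne_zero h0.ne'
  refine ⟨(k + 1 : ℕ), ?_⟩
  rw [zpow_natCast, pow_succ', Perm.mul_apply,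
    swap_mul_pow_apply fun j a b => hj j a (Nat.lt_succ_of_le b),
    swap_mul_apply_pow_apply, hk', swap_apply_left]

/-- Multiplying by a transposition that meets two cycles merges them. -/
theorem sameCycle_swap_mul_iff {f : Perm E} {x y : E} (h : ¬ f.SameCycle x y) {a b : E} :
    (swap x y * f).SameCycle a b ↔ f.SameCycle a b ∨
      ((f.SameCycle x a ∨ f.SameCycle y a) ∧ (f.SameCycle x b ∨ f.SameCycle y b)) := by
  have hxy := swap_mul_sameCycle_of_not h
  have hmono : ∀ {a b : E}, f.SameCycle a b → (swap x y * f).SameCycle a b := by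
    intro a b
    refine sameCycle_mono_of_step fun z => ?_
    have hz : (swap x y * f).SameCycle z (swap x y (f z)) := ⟨1, by simp⟩
    by_cases h1 : f z = x
    · rw [h1, swap_apply_left] at hz
      rw [h1]
      exact hz.trans hxy.symm
    by_cases h2 : f z = y
    · rw [h2, swap_apply_right] at hz
      rw [h2]
      exact hz.trans hxy
    rwa [swap_apply_of_ne_of_ne h1 h2] at hz
  constructor
  · refine sameCycle_rel_of_step (r := fun a b => f.SameCycle a b ∨
      ((f.SameCycle x a ∨ f.SameCycle y a) ∧ (f.SameCycle x b ∨ f.SameCycle y b))) ?_ ?_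
    · refine ⟨fun a => Or.inl (SameCycle.refl f a), ?_, ?_⟩
      · rintro a b (hab | ⟨ha, hb⟩)
        · exact Or.inl hab.symm
        · exact Or.inr ⟨hb, ha⟩
      · rintro a b c (hab | ⟨ha, hb⟩) (hbc | ⟨hb', hc⟩)
        · exact Or.inl (hab.trans hbc)
        · exact Or.inr ⟨hb'.imp (·.trans hab.symm) (·.trans hab.symm), hc⟩
        · exact Or.inr ⟨ha, hb.imp (·.trans hbc) (·.trans hbc)⟩
        · exact Or.inr ⟨ha, hc⟩
    · intro z
      have hz : f.SameCycle z (f z) := ⟨1, by simp⟩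
      rw [Perm.mul_apply]
      by_cases h1 : f z = x
      · rw [h1] at hz ⊢
        exact Or.inr ⟨Or.inl hz.symm, Or.inr (by rw [swap_apply_left])⟩
      by_cases h2 : f z = y
      · rw [h2] at hz ⊢
        exact Or.inr ⟨Or.inr hz.symm, Or.inl (by rw [swap_apply_right])⟩
      rw [swap_apply_of_ne_of_ne h1 h2]
      exact Or.inl hz
  · rintro (hab | ⟨ha, hb⟩)
    · exact hmono hab
    · have key : ∀ {c : E}, f.SameCycle x c ∨ f.SameCycle y c →
          (swap x y * f).SameCycle x c := by
        rintro c (hc | hc)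
        · exact hmono hc
        · exact hxy.trans (hmono hc)
      exact (key ha).symm.trans (key hb)

/-- Splitting a cycle: the part that contains `x` consists of the elements met before `y`. -/
theorem swap_mul_sameCycle_left_iff {f : Perm E} {x y z : E} (h : f.SameCycle x y) (hxy : x ≠ y) :
    (swap x y * f).SameCycle x z ↔ z = x ∨
      ∃ k, 0 < k ∧ (f ^ k) x = z ∧ ∀ j, 0 < j → j ≤ k → (f ^ j) x ≠ x ∧ (f ^ j) x ≠ y := by
  obtain ⟨k, h0, hk, hj⟩ := exists_first_return f x y
  -- A first return to `x` would close the cycle of `x` before `y` is met.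
  have hky : (f ^ k) x = y := by
    refine hk.resolve_left fun e => ?_
    obtain ⟨n, -, hn⟩ := h.exists_pow_eq''
    rw [← Nat.div_add_mod n k, add_comm, pow_add, Perm.mul_apply, pow_mul] at hn
    rw [Perm.pow_apply_eq_self_of_apply_eq_self e] at hn
    rcases Nat.eq_zero_or_pos (n % k) with h1 | h1
    · rw [h1] at hn
      exact hxy hn.2
    · exact (hj _ h1 (Nat.mod_lt _ h0)).2 hn.2
  have hpow : ∀ j, j < k → ((swap x y * f) ^ j) x = (f ^ j) x := fun j hjk =>
    swap_mul_pow_apply fun i hi hij => hj i hi (hij.trans_lt hjk)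
  -- The step that led `f` to `y` is diverted to `x`, so the cycle closes after `k` steps.
  have hret : ((swap x y * f) ^ k) x = x := by
    obtain ⟨k, rfl⟩ := Nat.exists_eq_succ_of_ne_zero h0.ne'
    rw [pow_succ', Perm.mul_apply, hpow k k.lt_succ_self, swap_mul_apply_pow_apply, hky,
      swap_apply_right]
  constructor
  · intro hz
    obtain ⟨n, -, hn⟩ := hz.exists_pow_eq''
    replace hn := hn.2
    rw [← Nat.div_add_mod n k, add_comm, pow_add, Perm.mul_apply, pow_mul,
      Perm.pow_apply_eq_self_of_apply_eq_self hret, hpow _ (Nat.mod_lt _ h0)] at hn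
    rcases Nat.eq_zero_or_pos (n % k) with h1 | h1
    · rw [h1] at hn
      exact Or.inl hn.symm
    · exact Or.inr ⟨_, h1, hn, fun j a b => hj j a (b.trans_lt (Nat.mod_lt _ h0))⟩
  · rintro (rfl | ⟨i, h1, rfl, hi⟩)
    · exact SameCycle.refl _ _
    · exact ⟨i, by rw [zpow_natCast, swap_mul_pow_apply hi]⟩

theorem not_swap_mul_sameCycle {f : Perm E} {x y : E} (h : f.SameCycle x y) (hxy : x ≠ y) :
    ¬ (swap x y * f).SameCycle x y := by
  rw [swap_mul_sameCycle_left_iff h hxy]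
  rintro (e | ⟨k, h0, hk, hj⟩)
  · exact hxy e.symm
  · exact (hj k h0 le_rfl).2 hk

/-- The same transposition undoes the splitting, so this is the merging rule for `swap x y * f`. -/
theorem sameCycle_iff_swap_mul {f : Perm E} {x y : E} (h : f.SameCycle x y) (hxy : x ≠ y)
    {a b : E} : f.SameCycle a b ↔ (swap x y * f).SameCycle a b ∨
      (((swap x y * f).SameCycle x a ∨ (swap x y * f).SameCycle y a) ∧
        ((swap x y * f).SameCycle x b ∨ (swap x y * f).SameCycle y b)) := by
  have := sameCycle_swap_mul_iff (not_swap_mul_sameCycle h hxy) (a := a) (b := b)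
  rwa [swap_mul_self_mul] at this

theorem numCycles_swap_mul_add_one {f : Perm E} {x y : E} (h : ¬ f.SameCycle x y) :
    numCycles (swap x y * f) + 1 = numCycles f := by
  classical
  let q : E → Quotient (SameCycle.setoid f) := Quotient.mk _
  have hq : ∀ a b, q a = q b ↔ f.SameCycle a b := fun a b => Quotient.eq
  -- The merged cycle is represented by the old cycle of `x`; leaving out that of `y` gives a
  -- bijection.
  let φ : {c : Quotient (SameCycle.setoid f) // c ≠ q y} →
      Quotient (SameCycle.setoid (swap x y * f)) := fun c =>
    Quotient.map id (fun a b (hab : f.SameCycle a b) =>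
      (sameCycle_swap_mul_iff h).2 (Or.inl hab)) c.1
  have hφ : Function.Bijective φ := by
    constructor
    · rintro ⟨⟨a⟩, ha⟩ ⟨⟨b⟩, hb⟩ hab
      have hab' : (swap x y * f).SameCycle a b := Quotient.exact hab
      have ha' : ¬ f.SameCycle y a := fun e => ha ((hq a y).2 e.symm)
      have hb' : ¬ f.SameCycle y b := fun e => hb ((hq b y).2 e.symm)
      rw [sameCycle_swap_mul_iff h] at hab'
      apply Subtype.ext
      refine (hq a b).2 ?_
      rcases hab' with e | ⟨e1, e2⟩
      · exact e
      · exact (e1.resolve_right ha').symm.trans (e2.resolve_right hb')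
    · rintro ⟨a⟩
      by_cases hay : f.SameCycle a y
      · refine ⟨⟨q x, fun e => h ((hq x y).1 e)⟩, ?_⟩
        refine Quotient.sound ?_
        change (swap x y * f).SameCycle x a
        rw [sameCycle_swap_mul_iff h]
        exact Or.inr ⟨Or.inl (SameCycle.refl _ _), Or.inr hay.symm⟩
      · exact ⟨⟨q a, fun e => hay ((hq a y).1 e)⟩, rfl⟩
  have hcard := Nat.card_congr (Equiv.ofBijective φ hφ)
  have hsum : Nat.card {c // c = q y} + Nat.card {c // c ≠ q y} =
      Nat.card (Quotient (SameCycle.setoid f)) := by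
    rw [← Nat.card_sum]
    exact Nat.card_congr (Equiv.sumCompl (fun c => c = q y))
  rw [Nat.card_unique] at hsum
  unfold numCycles
  rw [← hcard]
  omega

theorem numCycles_swap_mul {f : Perm E} {x y : E} (h : f.SameCycle x y) (hxy : x ≠ y) :
    numCycles (swap x y * f) = numCycles f + 1 := by
  have := numCycles_swap_mul_add_one (not_swap_mul_sameCycle h hxy)
  rw [swap_mul_self_mul] at this
  exact this.symm

end Transposition

/-- The genus of a pair of permutations: `ρ` is a permutation whose cycles contain the cycles of
both permutations. -/
theorem exists_genus [Finite E] (α β : Perm E) : ∃ (ρ : Perm E) (g : ℕ),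
    (∀ a b, α.SameCycle a b → ρ.SameCycle a b) ∧ (∀ a b, β.SameCycle a b → ρ.SameCycle a b) ∧
    numCycles (β * α) + numCycles α + numCycles β + 2 * g = Nat.card E + 2 * numCycles ρ := by
  classical
  -- Transpositions are split off from `β`, each adding a cycle, until `β = 1`.
  induction hn : Nat.card E - numCycles β generalizing β with
  | zero =>
    by_cases hβ : β = 1
    · subst hβ
      refine ⟨α, 0, fun _ _ => id, fun a b hab => ?_, ?_⟩
      · rw [sameCycle_one.1 hab]
      · rw [one_mul, numCycles_one]; ring
    · exfalso
      obtain ⟨x, hx⟩ : ∃ x, β x ≠ x := by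
        by_contra! hc
        exact hβ (Perm.ext hc)
      have := numCycles_swap_mul (f := β) (x := x) (y := β x) ⟨1, by simp⟩ hx.symm
      have h2 := numCycles_le_card (swap x (β x) * β)
      omega
  | succ n ih =>
    obtain ⟨x, hx⟩ : ∃ x, β x ≠ x := by
      by_contra! hc
      have hβ : β = 1 := Perm.ext hc
      rw [hβ, numCycles_one] at hn
      omega
    have hs : β.SameCycle x (β x) := ⟨1, by simp⟩
    set y := β x with hy
    set β' := swap x y * β with hβ'
    have hββ' : β = swap x y * β' := by rw [hβ', swap_mul_self_mul]
    have hz : numCycles β' = numCycles β + 1 := numCycles_swap_mul hs hx.symm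
    obtain ⟨ρ, g, h1, h2, h3⟩ := ih β' (by omega)
    have hsub : ∀ a b, (β' * α).SameCycle a b → ρ.SameCycle a b := fun a b hab =>
      sameCycle_mono_of_step (fun z => (h1 _ _ (⟨1, by simp⟩ : α.SameCycle z (α z))).trans
        (h2 _ _ ⟨1, by simp⟩)) hab
    have hβs : ∀ {ρ' : Perm E}, (∀ a b, ρ.SameCycle a b → ρ'.SameCycle a b) →
        ρ'.SameCycle x y → ∀ a b, β.SameCycle a b → ρ'.SameCycle a b := by
      intro ρ' hρ hxy a b hab
      rw [sameCycle_iff_swap_mul hs hx.symm] at hab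
      have key : ∀ c, β'.SameCycle x c ∨ β'.SameCycle y c → ρ'.SameCycle x c := by
        rintro c (hc | hc)
        · exact hρ _ _ (h2 _ _ hc)
        · exact hxy.trans (hρ _ _ (h2 _ _ hc))
      rcases hab with hab | ⟨ha, hb⟩
      · exact hρ _ _ (h2 _ _ hab)
      · exact (key a ha).symm.trans (key b hb)
    -- The transposition is put back. If `ρ` joins `x` and `y` already, the product gains a cycle
    -- (same genus) or loses one (genus plus one). Otherwise the product and `ρ` both lose a cycle,
    -- and the genus is unchanged.
    by_cases hρ : ρ.SameCycle x y
    · by_cases hf : (β' * α).SameCycle x y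
      · refine ⟨ρ, g, h1, hβs (fun _ _ => id) hρ, ?_⟩
        have := numCycles_swap_mul hf hx.symm
        rw [← mul_assoc, ← hββ'] at this
        omega
      · refine ⟨ρ, g + 1, h1, hβs (fun _ _ => id) hρ, ?_⟩
        have := numCycles_swap_mul_add_one hf
        rw [← mul_assoc, ← hββ'] at this
        omega
    · have hm : ∀ a b, ρ.SameCycle a b → (swap x y * ρ).SameCycle a b := fun a b hab =>
        (sameCycle_swap_mul_iff hρ).2 (Or.inl hab)
      refine ⟨swap x y * ρ, g, fun a b hab => hm _ _ (h1 _ _ hab),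
        hβs hm (swap_mul_sameCycle_of_not hρ), ?_⟩
      have e1 := numCycles_swap_mul_add_one hρ
      have e2 := numCycles_swap_mul_add_one fun e => hρ (hsub _ _ e)
      rw [← mul_assoc, ← hββ'] at e2
      omega

end Permutations

/-! ## Rotation systems: genus and elementary moves -/

section Conjugation

open Equiv Equiv.Perm

variable {E V : Type*} [Finite E]

/-- Both permutations run through the class of `a` in a single cycle, so both sides say that `m` and
`n` agree modulo the size of the class. -/
theorem zpow_apply_eq_iff_of_sameCycle_iff {σ σ' : Perm E} {c : E → V}
    (hσ : ∀ h k, σ.SameCycle h k ↔ c h = c k) (hσ' : ∀ h k, σ'.SameCycle h k ↔ c h = c k)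
    (a : E) (m n : ℤ) : (σ ^ m) a = (σ ^ n) a ↔ (σ' ^ m) a = (σ' ^ n) a := by
  classical
  have := Fintype.ofFinite E
  have key : ∀ {f : Perm E}, (∀ h k, f.SameCycle h k ↔ c h = c k) →
      f.IsCycleOn (Finset.univ.filter fun b => c b = c a : Finset E) := by
    intro f hf
    refine ⟨⟨?_, f.injective.injOn, ?_⟩, ?_⟩
    · intro b hb
      have h1 : c b = c (f b) := (hf b (f b)).1 ⟨1, by simp⟩
      simpa [← h1] using hb
    · intro b hb
      have h1 : c (f⁻¹ b) = c b := (hf (f⁻¹ b) b).1 ⟨1, by simp⟩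
      refine ⟨f⁻¹ b, ?_, by simp⟩
      simp only [Finset.coe_filter, Finset.mem_univ, true_and, Set.mem_ofPred_eq] at hb ⊢
      rw [h1, hb]
    · intro x hx y hy
      rw [hf]
      simp only [Finset.coe_filter, Finset.mem_univ, true_and, Set.mem_ofPred_eq] at hx hy
      rw [hx, hy]
  have ha : a ∈ (Finset.univ.filter fun b => c b = c a : Finset E) := by simp
  rw [(key hσ).zpow_apply_eq_zpow_apply ha, (key hσ').zpow_apply_eq_zpow_apply ha]

/-- Permutations whose cycles are the same classes are conjugate by a permutation that preserves
the classes. -/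
theorem exists_conj_of_sameCycle_iff {σ σ' : Perm E} {c : E → V}
    (hσ : ∀ h k, σ.SameCycle h k ↔ c h = c k) (hσ' : ∀ h k, σ'.SameCycle h k ↔ c h = c k) :
    ∃ φ : Perm E, (∀ h, c (φ h) = c h) ∧ φ * σ * φ⁻¹ = σ' := by
  let r : E → E := fun h => (Quotient.mk (SameCycle.setoid σ) h).out
  have hr : ∀ h, σ.SameCycle (r h) h := fun h => Quotient.mk_out (s := SameCycle.setoid σ) h
  have hrc : ∀ {h k}, c h = c k → r h = r k := fun {h k} e =>
    congrArg Quotient.out (Quotient.sound (s := SameCycle.setoid σ) ((hσ h k).2 e))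
  choose k hk using hr
  have hrh : ∀ h, c (r h) = c h := fun h => (hσ _ _).1 ⟨k h, hk h⟩
  -- In each class a base point `r` is fixed, and `σ ^ k` applied to it is sent to `σ' ^ k` applied
  -- to it. The choice of `k` does not matter, because both cycles have the same length.
  let φ : E → E := fun h => (σ' ^ k h) (r h)
  have hφc : ∀ h, c (φ h) = c h := fun h => by
    rw [← hrh h]
    exact ((hσ' _ _).1 ⟨k h, rfl⟩).symm
  have hinj : Function.Injective φ := by
    intro h h' e
    have e1 : r h = r h' := hrc (by rw [← hφc h, e, hφc h'])
    have e2 : (σ' ^ k h) (r h) = (σ' ^ k h') (r h) := by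
      conv_rhs => rw [e1]
      exact e
    rw [← zpow_apply_eq_iff_of_sameCycle_iff hσ hσ'] at e2
    rw [← hk h, e2, e1, hk h']
  let Φ : Perm E := Equiv.ofBijective φ (Finite.injective_iff_bijective.1 hinj)
  refine ⟨Φ, hφc, ?_⟩
  rw [mul_inv_eq_iff_eq_mul]
  ext h
  change φ (σ h) = σ' (φ h)
  have e1 : r (σ h) = r h := hrc ((hσ _ _).1 ⟨1, by simp⟩).symm
  have e2 : (σ ^ k (σ h)) (r h) = (σ ^ (1 + k h)) (r h) := by
    rw [zpow_one_add, Perm.mul_apply, hk h]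
    conv_lhs => rw [← e1]
    exact hk (σ h)
  rw [zpow_apply_eq_iff_of_sameCycle_iff hσ hσ', zpow_one_add, Perm.mul_apply] at e2
  change (σ' ^ k (σ h)) (r (σ h)) = _
  rw [e1, e2]

/-- A permutation preserving the classes is a product of transpositions inside them: splitting off
`swap x (φ x)` shrinks the support. -/
theorem conj_induction [DecidableEq E] {c : E → V} {P : Perm E → Prop}
    (hP : ∀ σ, P σ → ∀ x y, c x = c y → P (swap x y * σ * swap x y))
    {φ σ : Perm E} (hφ : ∀ h, c (φ h) = c h) (hσ : P σ) : P (φ * σ * φ⁻¹) := by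
  have := Fintype.ofFinite E
  induction hn : φ.support.card using Nat.strong_induction_on generalizing φ with
  | _ n ih =>
    by_cases h1 : φ = 1
    · subst h1
      simpa using hσ
    · obtain ⟨x, hx⟩ : ∃ x, φ x ≠ x := by
        by_contra! hc
        exact h1 (Perm.ext hc)
      have hc : ∀ h, c ((swap x (φ x) * φ) h) = c h := by
        intro h
        rw [Perm.mul_apply, swap_apply_def]
        split_ifs with e1 e2
        · rw [hφ, ← hφ h, e1]
        · rw [← hφ h, e2, hφ]
        · exact hφ h
      have h3 := hP _ (ih _ (hn ▸ card_support_swap_mul hx) hc rfl) x (φ x) (hφ x).symm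
      convert h3 using 1
      rw [mul_inv_rev, swap_inv]
      simp only [mul_assoc, swap_mul_self, mul_one, swap_mul_self_mul]

end Conjugation

/-! ### Euler's formula, types at a 2-valent vertex, and the change of genus under an elementary
move -/

namespace MultiGraph

open Equiv Equiv.Perm

variable (G : MultiGraph.{u})

theorem exists_vert_eq [Nonempty G.E] (y : G.V) : ∃ h, G.vert h = y := by
  obtain ⟨h0⟩ := ‹Nonempty G.E›
  rcases Relation.ReflTransGen.cases_head (G.connected y (G.vert h0)) with e | ⟨b, ⟨h, hh, -⟩, -⟩
  · exact ⟨h0, e.symm⟩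
  · exact ⟨h, hh⟩

theorem card_halfEdges : Nat.card G.E = 2 * G.edgeCount := by
  classical
  have hs : ∀ a b, G.inv.SameCycle a b ↔ b = a ∨ b = G.inv a := by
    intro a b
    constructor
    · refine sameCycle_rel_of_step (r := fun a b => b = a ∨ b = G.inv a) ⟨fun a => Or.inl rfl,
        ?_, ?_⟩ fun z => Or.inr rfl
      · rintro a b (rfl | rfl)
        · exact Or.inl rfl
        · exact Or.inr (G.inv_inv a).symm
      · rintro a b c (rfl | rfl) (rfl | rfl)
        · exact Or.inl rfl
        · exact Or.inr rfl
        · exact Or.inr rfl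
        · exact Or.inl (G.inv_inv a)
    · rintro (rfl | rfl)
      · exact SameCycle.refl _ _
      · exact ⟨1, by simp⟩
  let q : G.E → Quotient (SameCycle.setoid G.inv) := Quotient.mk _
  have := Fintype.ofFinite (Quotient (SameCycle.setoid G.inv))
  rw [← Nat.card_congr (Equiv.sigmaFiberEquiv q), Nat.card_sigma]
  have h2 : ∀ c, Nat.card {h // q h = c} = 2 := by
    rintro ⟨a⟩
    rw [Nat.card_eq_two_iff]
    have hq : ∀ b, q b = q a ↔ b = a ∨ b = G.inv a := fun b => by
      rw [← hs, sameCycle_comm]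
      exact Quotient.eq
    refine ⟨⟨a, rfl⟩, ⟨G.inv a, (hq _).2 (Or.inr rfl)⟩, fun e => G.inv_ne a
      (congrArg Subtype.val e).symm, ?_⟩
    refine Set.eq_univ_of_forall ?_
    rintro ⟨b, hb⟩
    rcases (hq b).1 hb with rfl | rfl
    · exact Or.inl rfl
    · exact Or.inr rfl
  rw [Finset.sum_congr rfl fun c _ => h2 c, Finset.sum_const, Finset.card_univ, smul_eq_mul,
    mul_comm, edgeCount, Nat.card_eq_fintype_card]

variable {G}

theorem IsRotation.numCycles_eq [Nonempty G.E] {σ : Perm G.E} (hσ : G.IsRotation σ) :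
    numCycles σ = Nat.card G.V := by
  refine Nat.card_congr (Equiv.ofBijective
    (Quotient.lift G.vert fun a b hab => (hσ a b).1 hab) ⟨?_, ?_⟩)
  · rintro ⟨a⟩ ⟨b⟩ hab
    exact Quotient.sound ((hσ a b).2 hab)
  · intro y
    obtain ⟨h, rfl⟩ := G.exists_vert_eq y
    exact ⟨Quotient.mk _ h, rfl⟩

/-- Every embedding has a genus. -/
theorem IsRotation.exists_hasGenus [Nonempty G.E] {σ : Perm G.E} (hσ : G.IsRotation σ) :
    ∃ i, G.HasGenus σ i := by
  obtain ⟨ρ, g, h1, h2, h3⟩ := exists_genus G.inv σ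
  -- The cycles of `ρ` contain those of `inv` and of `σ`, that is, edges and vertices, so
  -- connectedness of the graph leaves only one.
  have hρ : numCycles ρ = 1 := by
    obtain ⟨h0⟩ := ‹Nonempty G.E›
    have hall : ∀ x y, Relation.ReflTransGen
        (fun a b => ∃ h, G.vert h = a ∧ G.vert (G.inv h) = b) x y →
        ∀ h k, G.vert h = x → G.vert k = y → ρ.SameCycle h k := by
      intro x y hxy h k hh hk
      induction hxy generalizing k with
      | refl => exact h2 _ _ ((hσ h k).2 (hh.trans hk.symm))
      | tail _ hb ih =>
        obtain ⟨e, he1, he2⟩ := hb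
        exact ((ih e he1).trans (h1 _ _ ⟨1, by simp⟩)).trans
          (h2 _ _ ((hσ (G.inv e) k).2 (he2.trans hk.symm)))
    refine Nat.card_eq_one_iff_unique.2 ⟨⟨?_⟩, ⟨Quotient.mk _ h0⟩⟩
    rintro ⟨a⟩ ⟨b⟩
    exact Quotient.sound (hall _ _ (G.connected (G.vert a) (G.vert b)) a b rfl rfl)
  have h4 := G.card_halfEdges
  rw [hσ.numCycles_eq, hρ, h4] at h3
  refine ⟨g, ?_⟩
  have h5 : Nat.card (G.Face σ) = numCycles (σ * G.inv) := rfl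
  have h6 : G.edgeCount = numCycles G.inv := rfl
  unfold HasGenus
  rw [h5, h6]
  rw [h6] at h3
  omega

theorem HasGenus.eq {σ : Perm G.E} {i j : ℕ} (hi : G.HasGenus σ i) (hj : G.HasGenus σ j) :
    i = j := by
  unfold HasGenus at hi hj
  omega

theorem countEmb_ne_zero_iff {P : Perm G.E → Prop} {i : ℕ} :
    G.countEmb P i ≠ 0 ↔ ∃ σ, G.IsRotation σ ∧ G.HasGenus σ i ∧ P σ := by
  unfold countEmb
  rw [← Nat.pos_iff_ne_zero, Set.ncard_pos]
  exact Iff.rfl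

variable (G) in
/-- `p` and `q` are the half-edges at the 2-valent vertex `y`. -/
def IsHalfPair (y : G.V) (p q : G.E) : Prop := p ≠ q ∧ ∀ h, G.vert h = y ↔ h = p ∨ h = q

theorem exists_isHalfPair {y : G.V} (hy : G.valence y = 2) : ∃ p q, G.IsHalfPair y p q := by
  obtain ⟨⟨p, hp⟩, ⟨q, hq⟩, hne, huniv⟩ := Nat.card_eq_two_iff.1 hy
  refine ⟨p, q, fun e => hne (Subtype.ext e), fun h => ⟨fun hh => ?_, ?_⟩⟩
  · have : (⟨h, hh⟩ : {h // G.vert h = y}) ∈ ({⟨p, hp⟩, ⟨q, hq⟩} : Set {h // G.vert h = y}) :=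
      huniv ▸ Set.mem_univ _
    rcases this with e | e
    · exact Or.inl (congrArg Subtype.val e)
    · exact Or.inr (congrArg Subtype.val e)
  · rintro (rfl | rfl)
    · exact hp
    · exact hq

theorem faceOf_eq_iff {σ : Perm G.E} {a b : G.E} :
    G.faceOf σ a = G.faceOf σ b ↔ (G.faceStep σ).SameCycle a b := Quotient.eq

namespace IsHalfPair

variable {y : G.V} {p q : G.E} {σ : Perm G.E}

theorem vert_left (hy : G.IsHalfPair y p q) : G.vert p = y := (hy.2 p).2 (Or.inl rfl)

theorem vert_right (hy : G.IsHalfPair y p q) : G.vert q = y := (hy.2 q).2 (Or.inr rfl)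

theorem symm (hy : G.IsHalfPair y p q) : G.IsHalfPair y q p := ⟨hy.1.symm, fun h => (hy.2 h).trans or_comm⟩

theorem facesAt_eq (hy : G.IsHalfPair y p q) (σ : Perm G.E) : G.facesAt σ y = {G.faceOf σ p, G.faceOf σ q} := by
  ext f
  constructor
  · rintro ⟨h, hh, rfl⟩
    rcases (hy.2 h).1 hh with rfl | rfl
    · exact Or.inl rfl
    · exact Or.inr rfl
  · rintro (rfl | rfl)
    · exact ⟨p, hy.vert_left, rfl⟩
    · exact ⟨q, hy.vert_right, rfl⟩

theorem typeD_iff (hy : G.IsHalfPair y p q) : G.TypeD y σ ↔ ¬ (G.faceStep σ).SameCycle p q := by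
  rw [TypeD, hy.facesAt_eq, ← faceOf_eq_iff]
  by_cases h : G.faceOf σ p = G.faceOf σ q
  · simp [h]
  · simp [h]

theorem typeS_iff (hy : G.IsHalfPair y p q) : G.TypeS y σ ↔ (G.faceStep σ).SameCycle p q := by
  rw [TypeS, hy.facesAt_eq, ← faceOf_eq_iff]
  by_cases h : G.faceOf σ p = G.faceOf σ q
  · simp [h]
  · simp [h]

theorem typeS_iff_not_typeD (hy : G.IsHalfPair y p q) : G.TypeS y σ ↔ ¬ G.TypeD y σ := by
  rw [hy.typeD_iff, hy.typeS_iff, not_not]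

end IsHalfPair

theorem IsRotation.conj_swap [DecidableEq G.E] {σ : Perm G.E} (hσ : G.IsRotation σ) {x y : G.E}
    (hxy : G.vert x = G.vert y) : G.IsRotation (swap x y * σ * swap x y) := by
  have hv : ∀ h, G.vert (swap x y h) = G.vert h := fun h => by
    rw [swap_apply_def]
    split_ifs with e1 e2
    · rw [e1, hxy]
    · rw [e2, hxy]
    · rfl
  intro h k
  have := hσ (swap x y h) (swap x y k)
  rw [hv, hv] at this
  have h2 := sameCycle_conj (f := σ) (g := swap x y) (x := h) (y := k)
  rw [swap_inv] at h2
  exact h2.trans this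

theorem numCycles_swap_mul_bounds {E : Type*} [Finite E] [DecidableEq E] (f : Perm E) (x y : E) :
    numCycles (swap x y * f) ≤ numCycles f + 1 ∧ numCycles f ≤ numCycles (swap x y * f) + 1 := by
  by_cases hxy : x = y
  · subst hxy
    rw [swap_self, ← Perm.one_def, one_mul]
    omega
  by_cases h : f.SameCycle x y
  · have := numCycles_swap_mul h hxy
    omega
  · have := numCycles_swap_mul_add_one h
    omega

/-- A splitting joins no two points, so the transposition that makes `p` and `q` equivalent must
have merged two cycles. -/
theorem numCycles_add_one_of_merge {E : Type*} [Finite E] [DecidableEq E] {f : Perm E}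
    {x y p q : E} (h1 : ¬ f.SameCycle p q) (h2 : (swap x y * f).SameCycle p q) :
    numCycles (swap x y * f) + 1 = numCycles f := by
  refine numCycles_swap_mul_add_one fun h => h1 ?_
  by_cases hxy : x = y
  · subst hxy
    rwa [swap_self, ← Perm.one_def, one_mul] at h2
  · exact (sameCycle_iff_swap_mul h hxy).2 (Or.inl h2)

/-- The face permutation is multiplied by two transpositions. One of them has to merge the faces of
`p` and `q`, and the other changes the number of faces by at most one. By parity the number of faces
stays the same or drops by two. -/
theorem HasGenus.of_conj_swap [DecidableEq G.E] {σ : Perm G.E} {p q x y : G.E} {i j : ℕ}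
    (hi : G.HasGenus σ i) (hj : G.HasGenus (swap x y * σ * swap x y) j)
    (h1 : ¬ (G.faceStep σ).SameCycle p q)
    (h2 : (G.faceStep (swap x y * σ * swap x y)).SameCycle p q) : j = i ∨ j = i + 1 := by
  have e : G.faceStep (swap x y * σ * swap x y) =
      swap x y * (swap (σ x) (σ y) * G.faceStep σ) := by
    unfold faceStep
    rw [mul_assoc (swap x y), Equiv.mul_swap_eq_swap_mul]
    simp only [mul_assoc]
  have hb1 := numCycles_swap_mul_bounds (G.faceStep σ) (σ x) (σ y)
  have hb2 := numCycles_swap_mul_bounds (swap (σ x) (σ y) * G.faceStep σ) x y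
  have hi' : (Nat.card G.V : ℤ) - G.edgeCount + numCycles (G.faceStep σ) = 2 - 2 * i := hi
  have hj' : (Nat.card G.V : ℤ) - G.edgeCount +
      numCycles (G.faceStep (swap x y * σ * swap x y)) = 2 - 2 * j := hj
  rw [e] at h2 hj'
  by_cases hm : (swap (σ x) (σ y) * G.faceStep σ).SameCycle p q
  · have := numCycles_add_one_of_merge h1 hm
    omega
  · have := numCycles_add_one_of_merge hm h2
    omega

end MultiGraph

/-- The partial genus distributions of a rooted graph are not far apart. -/
theorem RootedGraph.exists_adjacent (G : RootedGraph.{u}) (hD : G.D ≠ 0) (hS : G.S ≠ 0) :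
    ∃ k, G.D k ≠ 0 ∧ (G.S k ≠ 0 ∨ G.S (k + 1) ≠ 0) := by
  classical
  obtain ⟨p, q, hy⟩ := MultiGraph.exists_isHalfPair G.valence_t
  have : Nonempty G.E := ⟨p⟩
  obtain ⟨i, hi⟩ := Function.ne_iff.1 hD
  obtain ⟨j, hj⟩ := Function.ne_iff.1 hS
  obtain ⟨σ, hσ, -, hσD⟩ := MultiGraph.countEmb_ne_zero_iff.1 hi
  obtain ⟨ρ, hρ, -, hρS⟩ := MultiGraph.countEmb_ne_zero_iff.1 hj
  by_contra! hc
  obtain ⟨φ, hφ, rfl⟩ := exists_conj_of_sameCycle_iff hσ hρ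
  -- If no such `k` existed, type D would survive every elementary move and so reach `ρ`, which has
  -- type S.
  refine hy.typeS_iff_not_typeD.1 hρS (conj_induction (c := G.vert)
    (P := fun τ => G.IsRotation τ ∧ G.TypeD G.t τ) ?_ hφ ⟨hσ, hσD⟩).2
  rintro τ ⟨hτ, hτD⟩ x y hxy
  have hτ' := hτ.conj_swap hxy
  refine ⟨hτ', ?_⟩
  by_contra hn
  rw [← hy.typeS_iff_not_typeD] at hn
  obtain ⟨a, ha⟩ := hτ.exists_hasGenus
  obtain ⟨b, hb⟩ := hτ'.exists_hasGenus
  have h1 : G.D a ≠ 0 := MultiGraph.countEmb_ne_zero_iff.2 ⟨τ, hτ, ha, hτD⟩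
  have h2 : G.S b ≠ 0 := MultiGraph.countEmb_ne_zero_iff.2 ⟨_, hτ', hb, hn⟩
  obtain ⟨h3, h4⟩ := hc a h1
  rcases ha.of_conj_swap hb (hy.typeD_iff.1 hτD) (hy.typeS_iff.1 hn) with rfl | rfl
  · exact h2 h3
  · exact h2 h4

/-! ## Splicing two permutations -/

section Splice

open Equiv Equiv.Perm

variable {E F : Type*}

theorem sumCongr_zpow_inl (α : Perm E) (β : Perm F) (n : ℤ) (i : E) :
    ((Perm.sumCongr α β : Perm (E ⊕ F)) ^ n) (Sum.inl i) = Sum.inl ((α ^ n) i) := by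
  have : (Perm.sumCongr α β : Perm (E ⊕ F)) ^ n = Perm.sumCongr (α ^ n) (β ^ n) :=
    ((map_zpow (Perm.sumCongrHom E F) (α, β) n)).symm
  rw [this]; rfl

theorem sumCongr_zpow_inr (α : Perm E) (β : Perm F) (n : ℤ) (i : F) :
    ((Perm.sumCongr α β : Perm (E ⊕ F)) ^ n) (Sum.inr i) = Sum.inr ((β ^ n) i) := by
  have : (Perm.sumCongr α β : Perm (E ⊕ F)) ^ n = Perm.sumCongr (α ^ n) (β ^ n) :=
    ((map_zpow (Perm.sumCongrHom E F) (α, β) n)).symm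
  rw [this]; rfl

@[simp] theorem sameCycle_sumCongr_inl_inl {α : Perm E} {β : Perm F} {i j : E} :
    Perm.SameCycle (Perm.sumCongr α β) (Sum.inl i) (Sum.inl j) ↔ α.SameCycle i j := by
  simp [SameCycle, sumCongr_zpow_inl]

@[simp] theorem sameCycle_sumCongr_inr_inr {α : Perm E} {β : Perm F} {i j : F} :
    Perm.SameCycle (Perm.sumCongr α β) (Sum.inr i) (Sum.inr j) ↔ β.SameCycle i j := by
  simp [SameCycle, sumCongr_zpow_inr]

@[simp] theorem not_sameCycle_sumCongr_inl_inr {α : Perm E} {β : Perm F} {i : E} {j : F} :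
    ¬ Perm.SameCycle (Perm.sumCongr α β) (Sum.inl i) (Sum.inr j) := by
  simp [SameCycle, sumCongr_zpow_inl]

@[simp] theorem not_sameCycle_sumCongr_inr_inl {α : Perm E} {β : Perm F} {i : F} {j : E} :
    ¬ Perm.SameCycle (Perm.sumCongr α β) (Sum.inr i) (Sum.inl j) := by
  simp [SameCycle, sumCongr_zpow_inr]

theorem numCycles_sumCongr [Finite E] [Finite F] (α : Perm E) (β : Perm F) :
    numCycles (Perm.sumCongr α β) = numCycles α + numCycles β := by
  unfold numCycles
  rw [← Nat.card_sum]
  refine (Nat.card_congr (Equiv.ofBijective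
    (Sum.elim
      (Quotient.map Sum.inl fun i j (h : α.SameCycle i j) => sameCycle_sumCongr_inl_inl.2 h)
      (Quotient.map Sum.inr fun i j (h : β.SameCycle i j) => sameCycle_sumCongr_inr_inr.2 h))
    ⟨?_, ?_⟩)).symm
  · rintro (i | i) (j | j) hij <;> induction i using Quotient.inductionOn with | _ i <;>
      induction j using Quotient.inductionOn with | _ j
    · exact congrArg Sum.inl (Quotient.sound (sameCycle_sumCongr_inl_inl.1 (Quotient.exact hij)))
    · exact absurd (Quotient.exact hij) not_sameCycle_sumCongr_inl_inr
    · exact absurd (Quotient.exact hij) not_sameCycle_sumCongr_inr_inl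
    · exact congrArg Sum.inr (Quotient.sound (sameCycle_sumCongr_inr_inr.1 (Quotient.exact hij)))
  · rintro ⟨i | i⟩
    · exact ⟨Sum.inl (Quotient.mk _ i), rfl⟩
    · exact ⟨Sum.inr (Quotient.mk _ i), rfl⟩

variable [DecidableEq E] [DecidableEq F]

theorem swap_inl_mul_sumCongr (α : Perm E) (β : Perm F) (a b : E) :
    swap (Sum.inl a) (Sum.inl b) * Perm.sumCongr α β = Perm.sumCongr (swap a b * α) β := by
  rw [← Perm.sumCongr_swap_one, Perm.sumCongr_mul, one_mul]

theorem swap_inr_mul_sumCongr (α : Perm E) (β : Perm F) (c d : F) :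
    swap (Sum.inr c) (Sum.inr d) * Perm.sumCongr α β = Perm.sumCongr α (swap c d * β) := by
  rw [← Perm.sumCongr_one_swap, Perm.sumCongr_mul, one_mul]

/-- The six ways of joining the rotations `(a b)` and `(c d)` to one cycle. -/
def splice (a b : E) (c d : F) : (Bool × Bool) ⊕ Bool → Perm (E ⊕ F)
  | Sum.inl s => swap (Sum.inl (cond s.1 a b)) (Sum.inr (cond s.2 c d))
  | Sum.inr s => swap (Sum.inl a) (Sum.inr (cond s c d)) *
      (swap (Sum.inl b) (Sum.inr (cond s d c)) * swap (Sum.inl a) (Sum.inl b))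

/-- The alternating orders treat both pairs alike, so the inner transposition can be taken on either
side. For faces, the side of `a`, `b` is used if these share a cycle and that of `c`, `d` otherwise;
then the two joining transpositions always meet different cycles of the first summand. -/
theorem splice_inr_eq {a b : E} {c d : F} (hab : a ≠ b) (hcd : c ≠ d) (s : Bool) :
    splice a b c d (Sum.inr s) = swap (Sum.inl b) (Sum.inr (cond s c d)) *
      (swap (Sum.inl a) (Sum.inr (cond s d c)) * swap (Sum.inr c) (Sum.inr d)) := by
  ext z
  cases s <;> rcases z with z | z <;>
  simp only [splice, cond_true, cond_false, Perm.mul_apply, swap_apply_def] <;>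
  grind

variable [Finite E] [Finite F] {α : Perm E} {β : Perm F} {x x' : E} {y y' : F}

theorem splice_one_inl_inl {i j : E} :
    (swap (Sum.inl x) (Sum.inr y) * Perm.sumCongr α β).SameCycle (Sum.inl i) (Sum.inl j) ↔
      α.SameCycle i j := by
  rw [sameCycle_swap_mul_iff not_sameCycle_sumCongr_inl_inr]
  simp only [sameCycle_sumCongr_inl_inl, not_sameCycle_sumCongr_inr_inl, or_false,
    or_iff_left_iff_imp]
  exact fun h => h.1.symm.trans h.2

theorem splice_one_inr_inr {i j : F} :
    (swap (Sum.inl x) (Sum.inr y) * Perm.sumCongr α β).SameCycle (Sum.inr i) (Sum.inr j) ↔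
      β.SameCycle i j := by
  rw [sameCycle_swap_mul_iff not_sameCycle_sumCongr_inl_inr]
  simp only [sameCycle_sumCongr_inr_inr, not_sameCycle_sumCongr_inl_inr, false_or,
    or_iff_left_iff_imp]
  exact fun h => h.1.symm.trans h.2

theorem splice_one_inl_inr {i : E} {j : F} :
    (swap (Sum.inl x) (Sum.inr y) * Perm.sumCongr α β).SameCycle (Sum.inl i) (Sum.inr j) ↔
      α.SameCycle x i ∧ β.SameCycle y j := by
  rw [sameCycle_swap_mul_iff not_sameCycle_sumCongr_inl_inr]
  simp

theorem numCycles_splice_one (α : Perm E) (β : Perm F) (x : E) (y : F) :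
    numCycles (swap (Sum.inl x) (Sum.inr y) * Perm.sumCongr α β) + 1 = numCycles α + numCycles β := by
  rw [numCycles_swap_mul_add_one not_sameCycle_sumCongr_inl_inr, numCycles_sumCongr]

theorem splice_two_aux (hx : ¬ α.SameCycle x x') :
    ¬ (swap (Sum.inl x') (Sum.inr y') * Perm.sumCongr α β).SameCycle (Sum.inl x) (Sum.inr y) := by
  rw [splice_one_inl_inr]
  exact fun h => hx h.1.symm

theorem numCycles_splice_two (hx : ¬ α.SameCycle x x') :
    numCycles (swap (Sum.inl x) (Sum.inr y) * (swap (Sum.inl x') (Sum.inr y') * Perm.sumCongr α β)) + 2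
      = numCycles α + numCycles β := by
  have h1 := numCycles_swap_mul_add_one (splice_two_aux (y := y) (y' := y') (β := β) hx)
  have h2 := numCycles_splice_one α β x' y'
  omega

/-- The cycles of `x` and `x'` are different and each is attached to `β` only once, so neither
connects two cycles of `β`. -/
theorem splice_two_inr_inr (hx : ¬ α.SameCycle x x') {i j : F} :
    (swap (Sum.inl x) (Sum.inr y) * (swap (Sum.inl x') (Sum.inr y') * Perm.sumCongr α β)).SameCycle
      (Sum.inr i) (Sum.inr j) ↔ β.SameCycle i j := by
  rw [sameCycle_swap_mul_iff (splice_two_aux hx)]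
  simp only [splice_one_inr_inr, splice_one_inl_inr]
  constructor
  · rintro (h | ⟨h | h, h' | h'⟩)
    · exact h
    · exact absurd h.1.symm hx
    · exact absurd h.1.symm hx
    · exact absurd h'.1.symm hx
    · exact h.symm.trans h'
  · exact Or.inl

theorem splice_two_inl_inl (hx : ¬ α.SameCycle x x') (hy : β.SameCycle y y') {i j : E} :
    (swap (Sum.inl x) (Sum.inr y) * (swap (Sum.inl x') (Sum.inr y') * Perm.sumCongr α β)).SameCycle
      (Sum.inl i) (Sum.inl j) ↔ α.SameCycle i j ∨
        ((α.SameCycle x i ∨ α.SameCycle x' i) ∧ (α.SameCycle x j ∨ α.SameCycle x' j)) := by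
  rw [sameCycle_swap_mul_iff (splice_two_aux hx)]
  simp only [splice_one_inl_inl, sameCycle_comm (x := Sum.inr y), splice_one_inl_inr, hy.symm,
    and_true]

theorem splice_two_inl_inr (hx : ¬ α.SameCycle x x') (hy : β.SameCycle y y') {i : E} {j : F} :
    (swap (Sum.inl x) (Sum.inr y) * (swap (Sum.inl x') (Sum.inr y') * Perm.sumCongr α β)).SameCycle
      (Sum.inl i) (Sum.inr j) ↔
        (α.SameCycle x i ∨ α.SameCycle x' i) ∧ β.SameCycle y j := by
  rw [sameCycle_swap_mul_iff (splice_two_aux hx)]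
  simp only [splice_one_inl_inl, sameCycle_comm (x := Sum.inr y) (y := Sum.inl i),
    splice_one_inl_inr, splice_one_inr_inr, hy.symm, and_true]
  constructor
  · rintro (⟨h1, h2⟩ | ⟨h1, h2⟩)
    · exact ⟨Or.inr h1, hy.trans h2⟩
    · exact ⟨h1, h2.resolve_left fun h => hx h.1.symm⟩
  · rintro ⟨h1, h2⟩
    exact Or.inr ⟨h1, Or.inr h2⟩

/-- The cycles of the six joint permutations. -/
theorem sameCycle_splice {σ : Perm E} {ρ : Perm F} {a b : E} {c d : F} (hab : a ≠ b)
    (hσ : σ.SameCycle a b) (hρ : ρ.SameCycle c d) (s : (Bool × Bool) ⊕ Bool) :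
    (∀ i j, (splice a b c d s * Perm.sumCongr σ ρ).SameCycle (Sum.inl i) (Sum.inl j) ↔
      σ.SameCycle i j) ∧
    (∀ i j, (splice a b c d s * Perm.sumCongr σ ρ).SameCycle (Sum.inr i) (Sum.inr j) ↔
      ρ.SameCycle i j) ∧
    (∀ i j, (splice a b c d s * Perm.sumCongr σ ρ).SameCycle (Sum.inl i) (Sum.inr j) ↔
      σ.SameCycle a i ∧ ρ.SameCycle c j) := by
  rcases s with ⟨s, t⟩ | t
  · refine ⟨fun i j => splice_one_inl_inl, fun i j => splice_one_inr_inr, fun i j => ?_⟩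
    have hs : ∀ i, σ.SameCycle (cond s a b) i ↔ σ.SameCycle a i := fun i => by
      cases s
      · exact ⟨hσ.trans, hσ.symm.trans⟩
      · exact Iff.rfl
    have ht : ∀ i, ρ.SameCycle (cond t c d) i ↔ ρ.SameCycle c i := fun i => by
      cases t
      · exact ⟨hρ.trans, hρ.symm.trans⟩
      · exact Iff.rfl
    rw [← hs, ← ht]
    exact splice_one_inl_inr
  · have hx := not_swap_mul_sameCycle hσ hab
    have hy : ρ.SameCycle (cond t c d) (cond t d c) := by
      cases t
      · exact hρ.symm
      · exact hρ
    have ht : ∀ i, ρ.SameCycle (cond t c d) i ↔ ρ.SameCycle c i := fun i => by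
      cases t
      · exact ⟨hρ.trans, hρ.symm.trans⟩
      · exact Iff.rfl
    simp only [splice, mul_assoc, swap_inl_mul_sumCongr]
    refine ⟨fun i j => ?_, fun i j => splice_two_inr_inr hx, fun i j => ?_⟩
    · rw [splice_two_inl_inl hx hy, ← sameCycle_iff_swap_mul hσ hab]
    · rw [splice_two_inl_inr hx hy, ht, sameCycle_iff_swap_mul hσ hab (a := a)]
      have := SameCycle.refl (swap a b * σ) a
      tauto

/-- The cycles of the three kinds of joint permutations: the effect on the second permutation. -/
theorem splice_inl_faces (α : Perm E) (β : Perm F) (a b : E) (c d : F) (s : Bool × Bool) :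
    numCycles (splice a b c d (Sum.inl s) * Perm.sumCongr α β) + 1 = numCycles α + numCycles β ∧
    ∀ i j, (splice a b c d (Sum.inl s) * Perm.sumCongr α β).SameCycle (Sum.inr i) (Sum.inr j) ↔
      β.SameCycle i j :=
  ⟨numCycles_splice_one _ _ _ _, fun _ _ => splice_one_inr_inr⟩

theorem splice_inr_faces_of_sameCycle {a b : E} (c d : F) (hab : a ≠ b) (hα : α.SameCycle a b)
    (s : Bool) :
    numCycles (splice a b c d (Sum.inr s) * Perm.sumCongr α β) + 1 = numCycles α + numCycles β ∧
    ∀ i j, (splice a b c d (Sum.inr s) * Perm.sumCongr α β).SameCycle (Sum.inr i) (Sum.inr j) ↔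
      β.SameCycle i j := by
  have hx := not_swap_mul_sameCycle hα hab
  simp only [splice, mul_assoc, swap_inl_mul_sumCongr]
  refine ⟨?_, fun i j => splice_two_inr_inr hx⟩
  have h1 := numCycles_splice_two (y := cond s c d) (y' := cond s d c) (β := β) hx
  have h2 := numCycles_swap_mul hα hab
  omega

theorem splice_inr_faces_of_not_sameCycle {a b : E} {c d : F} (hcd : c ≠ d)
    (hα : ¬ α.SameCycle a b) (s : Bool) :
    numCycles (splice a b c d (Sum.inr s) * Perm.sumCongr α β) + 2 =
      numCycles α + numCycles (swap c d * β) ∧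
    ∀ i j, (splice a b c d (Sum.inr s) * Perm.sumCongr α β).SameCycle (Sum.inr i) (Sum.inr j) ↔
      (swap c d * β).SameCycle i j := by
  have hab : a ≠ b := by
    rintro rfl
    exact hα (SameCycle.refl _ _)
  rw [splice_inr_eq hab hcd]
  simp only [mul_assoc, swap_inr_mul_sumCongr]
  have hx : ¬ α.SameCycle b a := fun h => hα h.symm
  exact ⟨numCycles_splice_two hx, fun i j => splice_two_inr_inr hx⟩

end Splice

/-! ## Partial genus distributions as sums over rotation systems -/

open Classical in
/-- The number of `r` with property `P` and `g r = i`. -/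
noncomputable def tally {R : Type*} [Fintype R] (P : R → Prop) (g : R → ℕ) (i : ℕ) : ℕ :=
  ∑ r, if P r ∧ g r = i then 1 else 0

theorem offset_tally {R : Type*} [Fintype R] (P : R → Prop) (g : R → ℕ) :
    offset (tally P g) = tally P fun r => g r + 1 := by
  classical
  funext i
  cases i with
  | zero => simp [offset, tally]
  | succ i =>
    refine Finset.sum_congr rfl fun r _ => ?_
    exact if_congr (and_congr_right' Nat.add_right_cancel_iff.symm) rfl rfl

theorem card_inter_pair_le {α : Type*} (a b p q : α) : ({a, b} ∩ {p, q} : Set α).ncard ≤ 2 :=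
  (Set.ncard_le_ncard Set.inter_subset_left (Set.toFinite _)).trans ((Set.ncard_insert_le a {b}).trans
    (by rw [Set.ncard_singleton]))

theorem card_inter_pair_eq_two_iff {α : Type*} {a b p q : α} (hab : a ≠ b) (hpq : p ≠ q) :
    ({a, b} ∩ {p, q} : Set α).ncard = 2 ↔ (a = p ∧ b = q) ∨ (a = q ∧ b = p) := by
  constructor
  · intro h
    have h1 : ({a, b} ∩ {p, q} : Set α) = {a, b} :=
      Set.eq_of_subset_of_ncard_le Set.inter_subset_left (by rw [h, Set.ncard_pair hab])
        (Set.toFinite _)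
    have h2 : ({a, b} : Set α) ⊆ {p, q} := Set.inter_eq_left.1 h1
    have ha : a = p ∨ a = q := h2 (Or.inl rfl)
    have hb : b = p ∨ b = q := h2 (Or.inr rfl)
    rcases ha with rfl | rfl <;> rcases hb with rfl | rfl
    · exact absurd rfl hab
    · exact Or.inl ⟨rfl, rfl⟩
    · exact Or.inr ⟨rfl, rfl⟩
    · exact absurd rfl hab
  · rintro (⟨rfl, rfl⟩ | ⟨rfl, rfl⟩)
    · rw [Set.inter_self, Set.ncard_pair hab]
    · rw [Set.pair_comm b a, Set.inter_self, Set.ncard_pair hab]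

theorem card_inter_pair_eq_zero_iff {α : Type*} {a b p q : α} :
    ({a, b} ∩ {p, q} : Set α).ncard = 0 ↔ a ≠ p ∧ a ≠ q ∧ b ≠ p ∧ b ≠ q := by
  rw [Set.ncard_eq_zero (Set.toFinite _), ← Set.disjoint_iff_inter_eq_empty]
  simp only [Set.disjoint_insert_left, Set.disjoint_singleton_left, Set.mem_insert_iff,
    Set.mem_singleton_iff, not_or, and_assoc, ne_eq]

theorem card_inter_singleton_le {α : Type*} (a : α) (s : Set α) : ({a} ∩ s : Set α).ncard ≤ 1 :=
  (Set.ncard_le_ncard Set.inter_subset_left (Set.toFinite _)).trans (Set.ncard_singleton a).le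

namespace MultiGraph

open Equiv Equiv.Perm

variable (G : MultiGraph.{u})

/-- The rotation systems of a graph. -/
abbrev Rotation : Type u := {σ : Perm G.E // G.IsRotation σ}

noncomputable instance : Fintype G.Rotation := Fintype.ofFinite _

variable {G}

open Classical in
/-- The genus of an embedding. -/
noncomputable def genus (σ : Perm G.E) : ℕ :=
  if h : ∃ i, G.HasGenus σ i then h.choose else 0

theorem IsRotation.hasGenus_iff [Nonempty G.E] {σ : Perm G.E} (hσ : G.IsRotation σ) {i : ℕ} :
    G.HasGenus σ i ↔ genus σ = i := by
  have h := hσ.exists_hasGenus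
  have h1 : G.HasGenus σ (genus σ) := by
    rw [genus, dif_pos h]
    exact h.choose_spec
  exact ⟨fun h2 => h1.eq h2, fun e => e ▸ h1⟩

theorem countEmb_eq_tally [Nonempty G.E] (P : Perm G.E → Prop) :
    G.countEmb P = tally (fun σ : G.Rotation => P σ.1) fun σ => genus σ.1 := by
  classical
  funext i
  rw [countEmb, tally, ← Finset.card_filter, ← Set.ncard_coe_finset]
  refine (Set.ncard_image_of_injective _ Subtype.val_injective).symm.trans ?_ |>.symm
  congr 1
  ext σ
  simp only [Finset.coe_filter, Finset.mem_univ, true_and, Set.mem_image, Set.mem_ofPred_eq]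
  constructor
  · rintro ⟨⟨σ, hσ⟩, ⟨h1, h2⟩, rfl⟩
    exact ⟨hσ, hσ.hasGenus_iff.2 h2, h1⟩
  · rintro ⟨hσ, h2, h1⟩
    exact ⟨⟨σ, hσ⟩, ⟨h1, hσ.hasGenus_iff.1 h2⟩, rfl⟩

end MultiGraph

namespace DoublyRootedGraph

open Equiv Equiv.Perm MultiGraph

variable {H : DoublyRootedGraph.{u}} [DecidableEq H.E] {c d p q : H.E} {σ : Perm H.E}

/-- `swap c d` cuts the face at its two visits to `u` into two arcs, and alternation means that each
arc contains a visit to `v`. -/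
theorem alternating_iff (hu : H.IsHalfPair H.u c d) (hv : H.IsHalfPair H.v p q)
    (hcd : (H.faceStep σ).SameCycle c d) : H.Alternating H.u H.v σ ↔
      ((swap c d * H.faceStep σ).SameCycle c p ∨ (swap c d * H.faceStep σ).SameCycle c q) ∧
      ((swap c d * H.faceStep σ).SameCycle d p ∨ (swap c d * H.faceStep σ).SameCycle d q) := by
  have hne : ∀ {z}, H.vert z = H.v → H.vert z ≠ H.u := fun e e' => H.u_ne_v (e'.symm.trans e)
  have key : ∀ {c d}, H.IsHalfPair H.u c d → (H.faceStep σ).SameCycle c d →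
      ((∃ k, 0 < k ∧ H.vert ((H.faceStep σ ^ k) c) = H.v ∧
        ∀ j, 0 < j → j < k → H.vert ((H.faceStep σ ^ j) c) ≠ H.u) ↔
      ((swap c d * H.faceStep σ).SameCycle c p ∨ (swap c d * H.faceStep σ).SameCycle c q)) := by
    intro c d hu hcd
    constructor
    · rintro ⟨k, h0, hk, hj⟩
      have hz : (swap c d * H.faceStep σ).SameCycle c ((H.faceStep σ ^ k) c) := by
        rw [swap_mul_sameCycle_left_iff hcd hu.1]
        refine Or.inr ⟨k, h0, rfl, fun j h1 h2 => ?_⟩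
        have : H.vert ((H.faceStep σ ^ j) c) ≠ H.u := by
          rcases h2.lt_or_eq with h2 | rfl
          · exact hj j h1 h2
          · exact hne hk
        rw [ne_eq, hu.2, not_or] at this
        exact this
      rcases (hv.2 _).1 hk with e | e
      · rw [e] at hz
        exact Or.inl hz
      · rw [e] at hz
        exact Or.inr hz
    · intro h
      obtain ⟨z, hz, hcz⟩ : ∃ z, H.vert z = H.v ∧ (swap c d * H.faceStep σ).SameCycle c z := by
        rcases h with h | h
        · exact ⟨p, hv.vert_left, h⟩
        · exact ⟨q, hv.vert_right, h⟩
      rw [swap_mul_sameCycle_left_iff hcd hu.1] at hcz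
      rcases hcz with rfl | ⟨k, h0, rfl, hj⟩
      · exact absurd hu.vert_left (hne hz)
      · refine ⟨k, h0, hz, fun j h1 h2 => ?_⟩
        rw [ne_eq, hu.2, not_or]
        exact hj j h1 h2.le
  have h1 := key hu hcd
  have h2 := key hu.symm hcd.symm
  rw [swap_comm] at h2
  rw [← h1, ← h2]
  constructor
  · exact fun h => ⟨h c hu.vert_left, h d hu.vert_right⟩
  · rintro ⟨hc, hd⟩ h hh
    rcases (hu.2 h).1 hh with rfl | rfl
    · exact hc
    · exact hd

/-- The type at `v` after a transposition of the corners at `u`. -/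
theorem twist_typeD_iff (hu : H.IsHalfPair H.u c d) (hv : H.IsHalfPair H.v p q) :
    (H.TypeD H.u σ → H.TypeD H.v σ → H.commonFaces H.u H.v σ ≤ 2 ∧
      (¬ (swap c d * H.faceStep σ).SameCycle p q ↔ H.commonFaces H.u H.v σ ≠ 2)) ∧
    (H.TypeD H.u σ → ¬ H.TypeD H.v σ → H.commonFaces H.u H.v σ ≤ 1 ∧
      (swap c d * H.faceStep σ).SameCycle p q) ∧
    (¬ H.TypeD H.u σ → H.TypeD H.v σ → H.commonFaces H.u H.v σ ≤ 1 ∧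
      ¬ (swap c d * H.faceStep σ).SameCycle p q) ∧
    (¬ H.TypeD H.u σ → ¬ H.TypeD H.v σ → H.commonFaces H.u H.v σ ≤ 1 ∧
      (¬ (swap c d * H.faceStep σ).SameCycle p q ↔
        H.commonFaces H.u H.v σ = 1 ∧ H.Alternating H.u H.v σ)) := by
  rw [hu.typeD_iff, hv.typeD_iff, commonFaces, hu.facesAt_eq, hv.facesAt_eq]
  simp only [not_not]
  refine ⟨fun h1 h2 => ⟨card_inter_pair_le _ _ _ _, ?_⟩, fun h1 h2 => ⟨?_, ?_⟩,
    fun h1 h2 => ⟨?_, ?_⟩, fun h1 h2 => ?_⟩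
  · rw [ne_eq, card_inter_pair_eq_two_iff (faceOf_eq_iff.not.2 h1) (faceOf_eq_iff.not.2 h2),
      sameCycle_swap_mul_iff h1, not_iff_not]
    simp only [faceOf_eq_iff]
    constructor
    · rintro (h | ⟨h | h, h' | h'⟩)
      · exact absurd h h2
      · exact absurd (h.symm.trans h') h2
      · exact Or.inl ⟨h, h'⟩
      · exact Or.inr ⟨h', h⟩
      · exact absurd (h.symm.trans h') h2
    · rintro (⟨h, h'⟩ | ⟨h, h'⟩)
      · exact Or.inr ⟨Or.inl h, Or.inr h'⟩
      · exact Or.inr ⟨Or.inr h', Or.inl h⟩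
  · rw [faceOf_eq_iff.2 h2, Set.pair_eq_singleton, Set.inter_comm]
    exact card_inter_singleton_le _ _
  · exact (sameCycle_swap_mul_iff h1).2 (Or.inl h2)
  · rw [faceOf_eq_iff.2 h1, Set.pair_eq_singleton]
    exact card_inter_singleton_le _ _
  · exact fun h => h2 ((sameCycle_iff_swap_mul h1 hu.1).2 (Or.inl h))
  · have hk : ({H.faceOf σ c, H.faceOf σ d} ∩ {H.faceOf σ p, H.faceOf σ q} : Set _).ncard ≤ 1 := by
      rw [faceOf_eq_iff.2 h1, Set.pair_eq_singleton]
      exact card_inter_singleton_le _ _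
    refine ⟨hk, ?_⟩
    have hk1 : ({H.faceOf σ c, H.faceOf σ d} ∩ {H.faceOf σ p, H.faceOf σ q} : Set _).ncard = 1 ↔
        (H.faceStep σ).SameCycle c p := by
      have h0 := card_inter_pair_eq_zero_iff (a := H.faceOf σ c) (b := H.faceOf σ d)
        (p := H.faceOf σ p) (q := H.faceOf σ q)
      rw [← faceOf_eq_iff] at h1 h2 ⊢
      rw [← h1, ← h2] at h0
      constructor
      · intro h
        by_contra hn
        have := h0.2 ⟨hn, hn, hn, hn⟩
        rw [← h1, ← h2, this] at h
        omega
      · intro h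
        have : ({H.faceOf σ c, H.faceOf σ c} ∩ {H.faceOf σ p, H.faceOf σ p} : Set _).ncard ≠ 0 :=
          fun e => (h0.1 e).1 h
        rw [h1, h2] at this
        rw [← h1, ← h2] at this hk ⊢
        omega
    rw [hk1, alternating_iff hu hv h1]
    have hs := fun a b => sameCycle_iff_swap_mul h1 hu.1 (a := a) (b := b)
    have hn := not_swap_mul_sameCycle h1 hu.1
    constructor
    · intro h
      have h3 := ((hs p q).1 h2).resolve_left h
      rw [hs c p]
      have h4 := SameCycle.refl (swap c d * H.faceStep σ) c
      rcases h3 with ⟨hp | hp, hq | hq⟩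
      · exact absurd (hp.symm.trans hq) h
      · exact ⟨Or.inl hp, Or.inl hp, Or.inr hq⟩
      · exact ⟨Or.inr ⟨Or.inl h4, Or.inr hp⟩, Or.inr hq, Or.inl hp⟩
      · exact absurd (hp.symm.trans hq) h
    · rintro ⟨-, hc | hc, hd | hd⟩ h
      · exact hn (hc.trans hd.symm)
      · exact hn ((hc.trans h).trans hd.symm)
      · exact hn ((hc.trans h.symm).trans hd.symm)
      · exact hn (hc.trans hd.symm)

open Classical in
/-- The genus after a transposition of the corners at `u`. -/
noncomputable def twistGenus (H : DoublyRootedGraph.{u}) (σ : Perm H.E) : ℕ :=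
  if H.TypeD H.u σ then genus σ + 1 else genus σ

theorem A₂_eq (hu : H.IsHalfPair H.u c d) (hv : H.IsHalfPair H.v p q) :
    H.A₂ = tally (fun σ : H.Rotation => H.TypeD H.v σ.1) fun σ => genus σ.1 := by
  classical
  have : Nonempty H.E := ⟨c⟩
  funext i
  simp only [A₂, SD, DD, SD0, SD1, DD0, DD1, DD2, Pi.add_apply, countEmb_eq_tally]
  simp only [tally, ← Finset.sum_add_distrib]
  refine Finset.sum_congr rfl fun σ _ => ?_
  obtain ⟨h1, h2, h3, h4⟩ := twist_typeD_iff (σ := σ.1) hu hv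
  simp only [hu.typeS_iff_not_typeD]
  by_cases hi : genus σ.1 = i <;> by_cases hU : H.TypeD H.u σ.1 <;>
    by_cases hV : H.TypeD H.v σ.1 <;> simp only [hi, hU, hV, not_true, not_false_iff, true_and,
      and_true, false_and, and_false, if_true, if_false, add_zero]
  · obtain ⟨h5, -⟩ := h1 hU hV
    generalize H.commonFaces H.u H.v σ.1 = k at h5
    interval_cases k <;> rfl
  · obtain ⟨h5, -⟩ := h3 hU hV
    generalize H.commonFaces H.u H.v σ.1 = k at h5
    interval_cases k <;> rfl

theorem B₂_eq (hu : H.IsHalfPair H.u c d) (hv : H.IsHalfPair H.v p q) :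
    H.B₂ = tally (fun σ : H.Rotation => ¬ H.TypeD H.v σ.1) fun σ => genus σ.1 := by
  classical
  have : Nonempty H.E := ⟨c⟩
  funext i
  simp only [B₂, SS, DS, SS0, SS1, SS2, DS0, DS1, Pi.add_apply, countEmb_eq_tally]
  simp only [tally, ← Finset.sum_add_distrib]
  refine Finset.sum_congr rfl fun σ _ => ?_
  obtain ⟨h1, h2, h3, h4⟩ := twist_typeD_iff (σ := σ.1) hu hv
  simp only [hu.typeS_iff_not_typeD, hv.typeS_iff_not_typeD]
  by_cases hi : genus σ.1 = i <;> by_cases hU : H.TypeD H.u σ.1 <;>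
    by_cases hV : H.TypeD H.v σ.1 <;> simp only [hi, hU, hV, not_true, not_false_iff, true_and,
      and_true, false_and, and_false, if_true, if_false, add_zero]
  · obtain ⟨h5, -⟩ := h2 hU hV
    generalize H.commonFaces H.u H.v σ.1 = k at h5
    interval_cases k <;> rfl
  · obtain ⟨h5, -⟩ := h4 hU hV
    generalize H.commonFaces H.u H.v σ.1 = k at h5
    by_cases hA : H.Alternating H.u H.v σ.1 <;> interval_cases k <;> simp [hA]

/-- This is the origin of the formula for `A₁`: after the twist, exactly DD⁰, DD', SD and SS² have
`v` on two faces, and the offset falls on those of type D at `u`, where the twist merges two faces.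
-/
theorem A₁_eq (hu : H.IsHalfPair H.u c d) (hv : H.IsHalfPair H.v p q) :
    H.A₁ = tally (fun σ : H.Rotation => ¬ (swap c d * H.faceStep σ.1).SameCycle p q)
      fun σ => H.twistGenus σ.1 := by
  classical
  have : Nonempty H.E := ⟨c⟩
  funext i
  simp only [A₁, SD, DD0, DD1, SS2, SD0, SD1, Pi.add_apply, countEmb_eq_tally, offset_tally]
  simp only [tally, ← Finset.sum_add_distrib]
  refine Finset.sum_congr rfl fun σ _ => ?_
  obtain ⟨h1, h2, h3, h4⟩ := twist_typeD_iff (σ := σ.1) hu hv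
  simp only [hu.typeS_iff_not_typeD, hv.typeS_iff_not_typeD, twistGenus]
  by_cases hU : H.TypeD H.u σ.1 <;> by_cases hV : H.TypeD H.v σ.1
  · obtain ⟨h5, h6⟩ := h1 hU hV
    simp only [h6, hU, hV, if_true]
    generalize H.commonFaces H.u H.v σ.1 = k at h5
    interval_cases k <;> simp
  · obtain ⟨h5, h6⟩ := h2 hU hV
    simp [h6, hU, hV]
  · obtain ⟨h5, h6⟩ := h3 hU hV
    simp only [h6, hU, hV, if_false]
    generalize H.commonFaces H.u H.v σ.1 = k at h5
    interval_cases k <;> simp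
  · obtain ⟨h5, h6⟩ := h4 hU hV
    simp [h6, hU, hV]

theorem B₁_eq (hu : H.IsHalfPair H.u c d) (hv : H.IsHalfPair H.v p q) :
    H.B₁ = tally (fun σ : H.Rotation => (swap c d * H.faceStep σ.1).SameCycle p q)
      fun σ => H.twistGenus σ.1 := by
  classical
  have : Nonempty H.E := ⟨c⟩
  funext i
  have hDS : offset H.DS i = offset H.DS0 i + offset H.DS1 i := by cases i <;> rfl
  simp only [B₁, Pi.add_apply, hDS]
  simp only [DS0, DS1, SS0, SS1, DD2, countEmb_eq_tally, offset_tally]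
  simp only [tally, ← Finset.sum_add_distrib]
  refine Finset.sum_congr rfl fun σ _ => ?_
  obtain ⟨h1, h2, h3, h4⟩ := twist_typeD_iff (σ := σ.1) hu hv
  simp only [hu.typeS_iff_not_typeD, hv.typeS_iff_not_typeD, twistGenus]
  by_cases hU : H.TypeD H.u σ.1 <;> by_cases hV : H.TypeD H.v σ.1
  · obtain ⟨h5, h6⟩ := h1 hU hV
    rw [not_iff_comm, not_not] at h6
    simp only [← h6, hU, hV, if_true]
    generalize H.commonFaces H.u H.v σ.1 = k at h5
    interval_cases k <;> simp
  · obtain ⟨h5, h6⟩ := h2 hU hV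
    simp only [h6, hU, hV, if_true]
    generalize H.commonFaces H.u H.v σ.1 = k at h5
    interval_cases k <;> simp
  · obtain ⟨h5, h6⟩ := h3 hU hV
    simp [h6, hU, hV]
  · obtain ⟨h5, h6⟩ := h4 hU hV
    rw [not_iff_comm] at h6
    simp only [← h6, hU, hV, if_false]
    generalize H.commonFaces H.u H.v σ.1 = k at h5
    by_cases hA : H.Alternating H.u H.v σ.1 <;> interval_cases k <;> simp [hA]

/-- The rooted graph `(H, v)`. -/
def rootV (H : DoublyRootedGraph.{u}) : RootedGraph.{u} where
  toMultiGraph := H.toMultiGraph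
  t := H.v
  valence_t := H.valence_v

theorem rootV_D (H : DoublyRootedGraph.{u}) : H.rootV.D = H.A₂ := by
  classical
  obtain ⟨c, d, hu⟩ := exists_isHalfPair H.valence_u
  obtain ⟨p, q, hv⟩ := exists_isHalfPair H.valence_v
  have : Nonempty H.E := ⟨c⟩
  rw [A₂_eq hu hv]
  exact countEmb_eq_tally (G := H.toMultiGraph) _

theorem rootV_S (H : DoublyRootedGraph.{u}) : H.rootV.S = H.B₂ := by
  classical
  obtain ⟨c, d, hu⟩ := exists_isHalfPair H.valence_u
  obtain ⟨p, q, hv⟩ := exists_isHalfPair H.valence_v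
  have : Nonempty H.E := ⟨c⟩
  rw [B₂_eq hu hv]
  simp only [← hv.typeS_iff_not_typeD]
  exact countEmb_eq_tally (G := H.toMultiGraph) _

end DoublyRootedGraph

/-! ## Embeddings of an amalgamation -/

open Equiv Equiv.Perm MultiGraph

theorem MultiGraph.IsRotation.vert_apply {G : MultiGraph.{u}} {σ : Perm G.E}
    (hσ : G.IsRotation σ) (h : G.E) : G.vert (σ h) = G.vert h :=
  ((hσ h (σ h)).1 ⟨1, by simp⟩).symm

theorem MultiGraph.IsHalfPair.apply_left {G : MultiGraph.{u}} {y : G.V} {p q : G.E}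
    (hy : G.IsHalfPair y p q) {σ : Perm G.E} (hσ : G.IsRotation σ) : σ p = q := by
  refine ((hy.2 (σ p)).1 ((hσ.vert_apply p).trans hy.vert_left)).resolve_left fun h => hy.1 ?_
  have h1 : σ.SameCycle p q := (hσ p q).2 (hy.vert_left.trans hy.vert_right.symm)
  obtain ⟨n, hn⟩ := h1
  rw [zpow_apply_eq_self_of_apply_eq_self h] at hn
  exact hn

theorem MultiGraph.IsHalfPair.sameCycle {G : MultiGraph.{u}} {y : G.V} {p q : G.E}
    (hy : G.IsHalfPair y p q) {σ : Perm G.E} (hσ : G.IsRotation σ) : σ.SameCycle p q :=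
  (hσ p q).2 (hy.vert_left.trans hy.vert_right.symm)

variable {G : RootedGraph.{u}} {H : DoublyRootedGraph.{u}}

theorem glue_eq_inl_iff {w : H.V} {x : G.V} : glue G H w = Sum.inl x ↔ G.t = x ∧ H.u = w := by
  by_cases hw : w = H.u
  · subst hw
    rw [glue_u]
    simp
  · rw [glue_ne G H hw]
    simp [Ne.symm hw]

theorem glue_injective : Function.Injective (glue G H) := by
  intro w w' h
  by_cases hw : w = H.u
  · subst hw
    rw [glue_u] at h
    exact (glue_eq_inl_iff.1 h.symm).2
  · by_cases hw' : w' = H.u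
    · subst hw'
      rw [glue_u] at h
      exact (glue_eq_inl_iff.1 h).2.symm
    · rw [glue_ne G H hw, glue_ne G H hw'] at h
      simpa using h

theorem amalgGraph_isRotation_iff {f : Perm (G.E ⊕ H.E)} :
    (amalgGraph G H).IsRotation f ↔
      (∀ i j, f.SameCycle (Sum.inl i) (Sum.inl j) ↔ G.vert i = G.vert j) ∧
      (∀ i j, f.SameCycle (Sum.inr i) (Sum.inr j) ↔ H.vert i = H.vert j) ∧
      (∀ i j, f.SameCycle (Sum.inl i) (Sum.inr j) ↔ G.t = G.vert i ∧ H.u = H.vert j) := by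
  constructor
  · intro hf
    refine ⟨fun i j => (hf _ _).trans Sum.inl_injective.eq_iff,
      fun i j => (hf _ _).trans glue_injective.eq_iff, fun i j => (hf _ _).trans ?_⟩
    rw [eq_comm]
    exact glue_eq_inl_iff
  · rintro ⟨h1, h2, h3⟩ (i | i) (j | j)
    · exact (h1 i j).trans Sum.inl_injective.eq_iff.symm
    · refine (h3 i j).trans ?_
      exact glue_eq_inl_iff.symm.trans eq_comm
    · refine sameCycle_comm.trans ((h3 j i).trans ?_)
      exact glue_eq_inl_iff.symm
    · exact (h2 i j).trans glue_injective.eq_iff.symm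

theorem card_amalgV : Nat.card (amalgGraph G H).V + 1 = Nat.card G.V + Nat.card H.V := by
  classical
  have h1 : Nat.card {w // w = H.u} + Nat.card {w // w ≠ H.u} = Nat.card H.V := by
    rw [← Nat.card_sum]
    exact Nat.card_congr (Equiv.sumCompl (fun w => w = H.u))
  rw [Nat.card_unique] at h1
  have h2 : Nat.card (amalgGraph G H).V = Nat.card G.V + Nat.card {w // w ≠ H.u} := Nat.card_sum
  omega

theorem edgeCount_amalgGraph : (amalgGraph G H).edgeCount = G.edgeCount + H.edgeCount :=
  numCycles_sumCongr G.inv H.inv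

theorem isHalfPair_amalg {p q : H.E} (hv : H.IsHalfPair H.v p q) :
    (amalgGraph G H).IsHalfPair (amalg G H).t (Sum.inr p) (Sum.inr q) := by
  refine ⟨fun h => hv.1 (Sum.inr_injective h), ?_⟩
  have ht : (amalg G H).t = glue G H H.v := (glue_ne G H H.u_ne_v.symm).symm
  rintro (h | h)
  · rw [ht]
    constructor
    · intro e
      exact absurd (glue_eq_inl_iff.1 e.symm).2 H.u_ne_v
    · rintro (e | e) <;> cases e
  · rw [ht]
    refine (glue_injective.eq_iff (a := H.vert h) (b := H.v)).trans ((hv.2 h).trans ?_)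
    exact or_congr Sum.inr_injective.eq_iff.symm Sum.inr_injective.eq_iff.symm

variable [DecidableEq G.E] [DecidableEq H.E] {a b : G.E} {c d : H.E}

theorem isRotation_splice (hG : G.IsHalfPair G.t a b) (hu : H.IsHalfPair H.u c d)
    {σ : Perm G.E} {ρ : Perm H.E} (hσ : G.IsRotation σ) (hρ : H.IsRotation ρ)
    (s : (Bool × Bool) ⊕ Bool) :
    (amalgGraph G H).IsRotation (splice a b c d s * Perm.sumCongr σ ρ) := by
  obtain ⟨h1, h2, h3⟩ := sameCycle_splice hG.1 (hG.sameCycle hσ) (hu.sameCycle hρ) s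
  refine amalgGraph_isRotation_iff.2 ⟨fun i j => (h1 i j).trans (hσ i j),
    fun i j => (h2 i j).trans (hρ i j), fun i j => (h3 i j).trans ?_⟩
  rw [hσ, hρ, hG.vert_left, hu.vert_left]

theorem splice_eq_of_apply_eq (hab : a ≠ b) (hcd : c ≠ d) {s s' : (Bool × Bool) ⊕ Bool}
    (ha : splice a b c d s (Sum.inl a) = splice a b c d s' (Sum.inl a))
    (hb : splice a b c d s (Sum.inl b) = splice a b c d s' (Sum.inl b)) : s = s' := by
  rcases s with ⟨_ | _, _ | _⟩ | _ | _ <;> rcases s' with ⟨_ | _, _ | _⟩ | _ | _ <;>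
    first
    | rfl
    | (exfalso
       simp [splice, Perm.mul_apply, swap_apply_def, hab, hab.symm, hcd, hcd.symm] at ha hb)

theorem splice_injective (hG : G.IsHalfPair G.t a b) (hu : H.IsHalfPair H.u c d)
    {σ σ' : Perm G.E} {ρ ρ' : Perm H.E} (hσ : G.IsRotation σ) (hσ' : G.IsRotation σ')
    {s s' : (Bool × Bool) ⊕ Bool}
    (h : splice a b c d s * Perm.sumCongr σ ρ = splice a b c d s' * Perm.sumCongr σ' ρ') :
    s = s' ∧ σ = σ' ∧ ρ = ρ' := by
  -- Every rotation of `G` exchanges `a` and `b`, so evaluation at these points isolates the splice.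
  have ha := Equiv.congr_fun h (Sum.inl b)
  have hb := Equiv.congr_fun h (Sum.inl a)
  simp only [Perm.mul_apply, Perm.sumCongr_apply, Sum.map_inl, hG.apply_left hσ,
    hG.apply_left hσ', hG.symm.apply_left hσ, hG.symm.apply_left hσ'] at ha hb
  obtain rfl := splice_eq_of_apply_eq hG.1 hu.1 ha hb
  have h2 := Perm.sumCongrHom_injective (a₁ := (σ, ρ)) (a₂ := (σ', ρ')) (mul_left_cancel h)
  exact ⟨rfl, congrArg Prod.fst h2, congrArg Prod.snd h2⟩

/-- The four half-edges at the merged vertex form one 4-cycle of `f`. There are 3! = 6 cyclic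
orders, and each is matched with one of the six splices. -/
theorem exists_splice_apply_eq {f : Perm (G.E ⊕ H.E)} (hG : G.IsHalfPair G.t a b)
    (hu : H.IsHalfPair H.u c d) (hf : (amalgGraph G H).IsRotation f) :
    ∃ s, splice a b c d s (Sum.inl b) = f (Sum.inl a) ∧
      splice a b c d s (Sum.inl a) = f (Sum.inl b) ∧
      splice a b c d s (Sum.inr d) = f (Sum.inr c) ∧
      splice a b c d s (Sum.inr c) = f (Sum.inr d) := by
  let M : Finset (G.E ⊕ H.E) := {Sum.inl a, Sum.inl b, Sum.inr c, Sum.inr d}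
  have hM : ∀ h, h ∈ M ↔ (amalgGraph G H).vert h = Sum.inl G.t := by
    rintro (h | h)
    · simp only [M, Finset.mem_insert, Finset.mem_singleton, Sum.inl.injEq, reduceCtorEq, or_false]
      exact (hG.2 h).symm.trans Sum.inl_injective.eq_iff.symm
    · simp only [M, Finset.mem_insert, Finset.mem_singleton, Sum.inr.injEq, reduceCtorEq, false_or]
      exact (hu.2 h).symm.trans ⟨fun e => glue_eq_inl_iff.2 ⟨rfl, e.symm⟩,
        fun e => (glue_eq_inl_iff.1 e).2.symm⟩
  have hcard : M.card = 4 := by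
    have := hG.1
    have := hu.1
    simp [M, *]
  have hmem : ∀ h ∈ M, f h ∈ M := fun h hh => by
    rw [hM] at hh ⊢
    rw [← hh]
    exact hf.vert_apply h
  have hcyc : f.IsCycleOn M := by
    refine ⟨⟨fun h hh => hmem h hh, f.injective.injOn, fun h hh => ?_⟩, fun x hx y hy => ?_⟩
    · refine ⟨f⁻¹ h, ?_, by simp⟩
      have : amalgVert G H (f (f⁻¹ h)) = amalgVert G H (f⁻¹ h) := hf.vert_apply (f⁻¹ h)
      rw [show f (f⁻¹ h) = h by simp] at this
      exact (hM _).2 (this.symm.trans ((hM h).1 hh))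
    · exact (hf x y).2 (((hM x).1 hx).trans ((hM y).1 hy).symm)
  have hA : Sum.inl a ∈ M := by simp [M]
  have hpow : ∀ n, (f ^ n) (Sum.inl a) = Sum.inl a ↔ 4 ∣ n := fun n => by
    rw [hcyc.pow_apply_eq hA, hcard]
  have e1 : f (Sum.inl a) ≠ Sum.inl a := fun h => by
    have := (hpow 1).1 h
    omega
  have e2 : f (f (Sum.inl a)) ≠ Sum.inl a := fun h => by
    have := (hpow 2).1 h
    omega
  have e3 : f (f (f (Sum.inl a))) ≠ Sum.inl a := fun h => by
    have := (hpow 3).1 h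
    omega
  have e4 : f (f (f (f (Sum.inl a)))) = Sum.inl a := (hpow 4).2 (dvd_refl 4)
  have e5 : f (f (Sum.inl a)) ≠ f (Sum.inl a) := fun h => e1 (f.injective h)
  have e6 : f (f (f (Sum.inl a))) ≠ f (f (Sum.inl a)) := fun h => e5 (f.injective h)
  have e7 : f (f (f (Sum.inl a))) ≠ f (Sum.inl a) := fun h => e2 (f.injective h)
  have hx := hmem _ hA
  have hy := hmem _ hx
  have hz := hmem _ hy
  have hab := hG.1
  have hcd := hu.1
  simp only [M, Finset.mem_insert, Finset.mem_singleton] at hx hy hz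
  replace hx := hx.resolve_left e1
  replace hy := hy.resolve_left e2
  replace hz := hz.resolve_left e3
  rcases hx with hx | hx | hx <;> rw [hx] at hy hz e4 e5 e6 e7 <;>
    rcases hy with hy | hy | hy <;>
    first
    | exact absurd hy e5
    | (rw [hy] at hz e4 e6 e7
       rcases hz with hz | hz | hz <;>
       first
       | exact absurd hz e6
       | exact absurd hz e7
       | (rw [hz] at e4
          rw [hx, hy, hz, e4]
          first
          | (refine ⟨Sum.inl (true, true), ?_⟩; solve | simp [splice, swap_apply_def, hab, hab.symm, hcd, hcd.symm])
          | (refine ⟨Sum.inl (true, false), ?_⟩; solve | simp [splice, swap_apply_def, hab, hab.symm, hcd, hcd.symm])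
          | (refine ⟨Sum.inl (false, true), ?_⟩; solve | simp [splice, swap_apply_def, hab, hab.symm, hcd, hcd.symm])
          | (refine ⟨Sum.inl (false, false), ?_⟩; solve | simp [splice, swap_apply_def, hab, hab.symm, hcd, hcd.symm])
          | (refine ⟨Sum.inr true, ?_⟩; solve | simp [splice, swap_apply_def, hab, hab.symm, hcd, hcd.symm])
          | (refine ⟨Sum.inr false, ?_⟩; solve | simp [splice, swap_apply_def, hab, hab.symm, hcd, hcd.symm])))

theorem splice_apply_of_ne {h : G.E} (ha : h ≠ a) (hb : h ≠ b) (s : (Bool × Bool) ⊕ Bool) :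
    splice a b c d s (Sum.inl h) = Sum.inl h := by
  rcases s with ⟨_ | _, _ | _⟩ | _ | _ <;> simp [splice, swap_apply_def, ha, hb]

/-- Every rotation system of the amalgamation is a splice. -/
theorem exists_splice_eq {f : Perm (G.E ⊕ H.E)} (hG : G.IsHalfPair G.t a b)
    (hu : H.IsHalfPair H.u c d) (hf : (amalgGraph G H).IsRotation f) :
    ∃ s σ ρ, G.IsRotation σ ∧ H.IsRotation ρ ∧
      splice a b c d s * Perm.sumCongr σ ρ = f := by
  obtain ⟨s, h1, h2, h3, h4⟩ := exists_splice_apply_eq hG hu hf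
  have h1' := (Perm.inv_eq_iff_eq (f := splice a b c d s)).2 h1.symm
  have h2' := (Perm.inv_eq_iff_eq (f := splice a b c d s)).2 h2.symm
  have h3' := (Perm.inv_eq_iff_eq (f := splice a b c d s)).2 h3.symm
  -- Only at the merged vertex can `f` lead from `G` to `H`, and there the inverse splice undoes it.
  have hmaps : Set.MapsTo ((splice a b c d s)⁻¹ * f) (Set.range Sum.inl) (Set.range Sum.inl) := by
    rintro _ ⟨h, rfl⟩
    by_cases ha : h = a
    · rw [ha, Perm.mul_apply, h1']
      exact ⟨b, rfl⟩
    by_cases hb : h = b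
    · rw [hb, Perm.mul_apply, h2']
      exact ⟨a, rfl⟩
    have ht : G.vert h ≠ G.t := fun e => by
      rcases (hG.2 h).1 e with e | e
      · exact ha e
      · exact hb e
    have hv : amalgVert G H (f (Sum.inl h)) = Sum.inl (G.vert h) := hf.vert_apply (Sum.inl h)
    rw [Perm.mul_apply]
    rcases hfh : f (Sum.inl h) with k | k
    · rw [hfh] at hv
      have hk : G.vert k ≠ G.t := by
        rwa [Sum.inl_injective hv]
      rw [ne_eq, hG.2, not_or] at hk
      refine ⟨k, ?_⟩
      rw [eq_comm, Perm.inv_eq_iff_eq, splice_apply_of_ne hk.1 hk.2]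
    · rw [hfh] at hv
      exact absurd (glue_eq_inl_iff.1 hv).1.symm ht
  obtain ⟨⟨σ, ρ⟩, hσρ⟩ := Perm.mem_sumCongrHom_range_of_perm_mapsTo_inl hmaps
  have hσρ' : Perm.sumCongr σ ρ = (splice a b c d s)⁻¹ * f := hσρ
  have hfe : splice a b c d s * Perm.sumCongr σ ρ = f := by rw [hσρ', mul_inv_cancel_left]
  have hab : σ a = b := by
    have := Equiv.congr_fun hσρ' (Sum.inl a)
    rw [Perm.mul_apply, h1'] at this
    exact Sum.inl_injective this
  have hcd : ρ c = d := by
    have := Equiv.congr_fun hσρ' (Sum.inr c)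
    rw [Perm.mul_apply, h3'] at this
    exact Sum.inr_injective this
  obtain ⟨g1, g2, g3⟩ := sameCycle_splice (σ := σ) (ρ := ρ) hG.1 ⟨1, by simpa using hab⟩
    ⟨1, by simpa using hcd⟩ s
  rw [hfe] at g1 g2 g3
  obtain ⟨k1, k2, -⟩ := amalgGraph_isRotation_iff.1 hf
  exact ⟨s, σ, ρ, fun i j => (g1 i j).symm.trans (k1 i j),
    fun i j => (g2 i j).symm.trans (k2 i j), hfe⟩

/-- The rotation systems of the amalgamation. -/
theorem splice_bijective (hG : G.IsHalfPair G.t a b) (hu : H.IsHalfPair H.u c d) :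
    Function.Bijective (fun x : ((Bool × Bool) ⊕ Bool) × G.Rotation × H.Rotation =>
      (⟨splice a b c d x.1 * Perm.sumCongr x.2.1.1 x.2.2.1,
        isRotation_splice hG hu x.2.1.2 x.2.2.2 x.1⟩ : (amalgGraph G H).Rotation)) := by
  constructor
  · rintro ⟨s, ⟨σ, hσ⟩, ⟨ρ, hρ⟩⟩ ⟨s', ⟨σ', hσ'⟩, ⟨ρ', hρ'⟩⟩ h
    obtain ⟨rfl, rfl, rfl⟩ := splice_injective hG hu hσ hσ' (congrArg Subtype.val h)
    rfl
  · rintro ⟨f, hf⟩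
    obtain ⟨s, σ, ρ, hσ, hρ, h⟩ := exists_splice_eq hG hu hf
    exact ⟨⟨s, ⟨σ, hσ⟩, ⟨ρ, hρ⟩⟩, Subtype.ext h⟩

theorem amalgGraph_faceStep_splice (s : (Bool × Bool) ⊕ Bool) (σ : Perm G.E) (ρ : Perm H.E) :
    (amalgGraph G H).faceStep (splice a b c d s * Perm.sumCongr σ ρ) =
      splice a b c d s * Perm.sumCongr (G.faceStep σ) (H.faceStep ρ) := by
  have : Perm.sumCongr (G.faceStep σ) (H.faceStep ρ) =
      Perm.sumCongr σ ρ * Perm.sumCongr G.inv H.inv := by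
    rw [Perm.sumCongr_mul]
    rfl
  rw [this, ← mul_assoc]
  rfl

/-- The genus and the type of a splice. -/
theorem splice_faces (hG : G.IsHalfPair G.t a b) (hu : H.IsHalfPair H.u c d)
    {σ : Perm G.E} {ρ : Perm H.E} (hσ : G.IsRotation σ) (hρ : H.IsRotation ρ)
    (s : (Bool × Bool) ⊕ Bool) :
    (s.isRight = true ∧ G.TypeD G.t σ →
      genus (G := amalgGraph G H) (splice a b c d s * Perm.sumCongr σ ρ) =
        genus σ + H.twistGenus ρ ∧
      ∀ i j, ((amalgGraph G H).faceStep (splice a b c d s * Perm.sumCongr σ ρ)).SameCycle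
        (Sum.inr i) (Sum.inr j) ↔ (swap c d * H.faceStep ρ).SameCycle i j) ∧
    (¬ (s.isRight = true ∧ G.TypeD G.t σ) →
      genus (G := amalgGraph G H) (splice a b c d s * Perm.sumCongr σ ρ) =
        genus σ + genus ρ ∧
      ∀ i j, ((amalgGraph G H).faceStep (splice a b c d s * Perm.sumCongr σ ρ)).SameCycle
        (Sum.inr i) (Sum.inr j) ↔ (H.faceStep ρ).SameCycle i j) := by
  have : Nonempty G.E := ⟨a⟩
  have : Nonempty H.E := ⟨c⟩
  have : Nonempty (amalgGraph G H).E := ⟨Sum.inl a⟩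
  have hr := isRotation_splice hG hu hσ hρ s
  have g1 : (Nat.card G.V : ℤ) - G.edgeCount + numCycles (G.faceStep σ) = 2 - 2 * genus σ :=
    hσ.hasGenus_iff.2 rfl
  have g2 : (Nat.card H.V : ℤ) - H.edgeCount + numCycles (H.faceStep ρ) = 2 - 2 * genus ρ :=
    hρ.hasGenus_iff.2 rfl
  have hV := card_amalgV (G := G) (H := H)
  have hE := edgeCount_amalgGraph (G := G) (H := H)
  have hgen : ∀ k : ℕ, (Nat.card (amalgGraph G H).V : ℤ) - (amalgGraph G H).edgeCount +
      numCycles ((amalgGraph G H).faceStep (splice a b c d s * Perm.sumCongr σ ρ)) = 2 - 2 * k →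
      genus (G := amalgGraph G H) (splice a b c d s * Perm.sumCongr σ ρ) = k :=
    fun k hk => hr.hasGenus_iff.1 hk
  have hfs : numCycles ((amalgGraph G H).faceStep (splice a b c d s * Perm.sumCongr σ ρ)) =
      numCycles (E := G.E ⊕ H.E)
        (splice a b c d s * Perm.sumCongr (G.faceStep σ) (H.faceStep ρ)) :=
    congrArg numCycles (amalgGraph_faceStep_splice s σ ρ)
  rw [hfs] at hgen
  rw [amalgGraph_faceStep_splice]
  constructor
  · rintro ⟨hs, hD⟩
    rcases s with s | s
    · cases hs
    obtain ⟨f1, f2⟩ := splice_inr_faces_of_not_sameCycle (β := H.faceStep ρ) hu.1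
      (hG.typeD_iff.1 hD) s
    refine ⟨hgen _ ?_, f2⟩
    -- Genera add when the total number of faces drops by one. Here it drops by three for type D at
    -- `u`, which costs one genus, and by one for type S.
    unfold DoublyRootedGraph.twistGenus
    split_ifs with hUD
    · have := numCycles_swap_mul_add_one (hu.typeD_iff.1 hUD)
      push_cast
      omega
    · have := numCycles_swap_mul (hu.typeS_iff.1 (hu.typeS_iff_not_typeD.2 hUD)) hu.1
      push_cast
      omega
  · intro hs
    have : numCycles (splice a b c d s * Perm.sumCongr (G.faceStep σ) (H.faceStep ρ)) + 1 =
        numCycles (G.faceStep σ) + numCycles (H.faceStep ρ) ∧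
      ∀ i j, (splice a b c d s * Perm.sumCongr (G.faceStep σ) (H.faceStep ρ)).SameCycle
        (Sum.inr i) (Sum.inr j) ↔ (H.faceStep ρ).SameCycle i j := by
      rcases s with s | s
      · exact splice_inl_faces _ _ _ _ _ _ s
      · refine splice_inr_faces_of_sameCycle c d hG.1 ?_ s
        exact hG.typeS_iff.1 (hG.typeS_iff_not_typeD.2 fun h => hs ⟨rfl, h⟩)
    obtain ⟨f1, f2⟩ := this
    refine ⟨hgen _ ?_, f2⟩
    push_cast
    omega

/-! ## The recursion for partial genus distributions -/

/-- The convolution of two sequences. -/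
def conv (a b : ℕ → ℕ) (i : ℕ) : ℕ := ∑ x ∈ Finset.HasAntidiagonal.antidiagonal i, a x.1 * b x.2

open Classical in
theorem conv_tally {R R' : Type*} [Fintype R] [Fintype R'] (P : R → Prop) (g : R → ℕ)
    (P' : R' → Prop) (g' : R' → ℕ) (i : ℕ) :
    conv (tally P g) (tally P' g') i =
      ∑ r, ∑ r', if (P r ∧ P' r') ∧ g r + g' r' = i then 1 else 0 := by
  unfold conv tally
  simp only [Finset.sum_mul_sum]
  rw [Finset.sum_comm]
  refine Finset.sum_congr rfl fun r _ => ?_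
  rw [Finset.sum_comm]
  refine Finset.sum_congr rfl fun r' _ => ?_
  by_cases h : (P r ∧ P' r') ∧ g r + g' r' = i
  · rw [if_pos h, Finset.sum_eq_single (g r, g' r')]
    · rw [if_pos ⟨h.1.1, rfl⟩, if_pos ⟨h.1.2, rfl⟩, mul_one]
    · rintro ⟨j, k⟩ - hne
      by_cases hj : g r = j
      · by_cases hk : g' r' = k
        · exact absurd (by rw [hj, hk]) hne
        · rw [if_neg (fun e : P' r' ∧ g' r' = k => hk e.2), mul_zero]
      · rw [if_neg (fun e : P r ∧ g r = j => hj e.2), zero_mul]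
    · intro hn
      exact absurd (Finset.HasAntidiagonal.mem_antidiagonal.2 h.2) hn
  · rw [if_neg h]
    refine Finset.sum_eq_zero ?_
    rintro ⟨j, k⟩ hjk
    rw [Finset.HasAntidiagonal.mem_antidiagonal] at hjk
    by_cases hj : P r ∧ g r = j
    · rw [if_neg (fun e : P' r' ∧ g' r' = k => h ⟨⟨hj.1, e.1⟩, by rw [hj.2, e.2, hjk]⟩), mul_zero]
    · rw [if_neg hj, zero_mul]

open Equiv Equiv.Perm MultiGraph

namespace RootedGraph

variable (G : RootedGraph.{u})

theorem D_eq [Nonempty G.E] :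
    G.D = tally (fun σ : G.Rotation => G.TypeD G.t σ.1) fun σ => genus σ.1 :=
  countEmb_eq_tally _

theorem S_eq [Nonempty G.E] :
    G.S = tally (fun σ : G.Rotation => ¬ G.TypeD G.t σ.1) fun σ => genus σ.1 := by
  obtain ⟨p, q, hy⟩ := exists_isHalfPair G.valence_t
  simp only [← hy.typeS_iff_not_typeD]
  exact countEmb_eq_tally _

theorem genusDist_eq : G.genusDist = G.D + G.S := by
  classical
  obtain ⟨p, q, hy⟩ := exists_isHalfPair G.valence_t
  have : Nonempty G.E := ⟨p⟩
  rw [G.D_eq, G.S_eq, genusDist, countEmb_eq_tally]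
  funext i
  rw [Pi.add_apply, tally, tally, tally, ← Finset.sum_add_distrib]
  refine Finset.sum_congr rfl fun σ _ => ?_
  by_cases h : G.TypeD G.t σ.1 <;> simp [h]

end RootedGraph

variable {G : RootedGraph.{u}} {H : DoublyRootedGraph.{u}} [DecidableEq G.E] [DecidableEq H.E]
  {a b : G.E} {c d p q : H.E}

/-- For fixed rotations of `G` and `H`, the six splices are summed: two are twisted and four
untwisted if `G` has type D, and all six are untwisted for type S. Taking `N` to be `Not` or `id`
selects type D or S at `v`. -/
theorem countEmb_amalgGraph (hG : G.IsHalfPair G.t a b) (hu : H.IsHalfPair H.u c d)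
    (N : Prop → Prop) (i : ℕ) :
    (amalgGraph G H).countEmb
        (fun f => N (((amalgGraph G H).faceStep f).SameCycle (Sum.inr p) (Sum.inr q))) i =
      2 * conv G.D (tally (fun ρ : H.Rotation => N ((swap c d * H.faceStep ρ.1).SameCycle p q))
        fun ρ => H.twistGenus ρ.1) i +
      4 * conv G.D (tally (fun ρ : H.Rotation => N ((H.faceStep ρ.1).SameCycle p q))
        fun ρ => genus ρ.1) i +
      6 * conv G.S (tally (fun ρ : H.Rotation => N ((H.faceStep ρ.1).SameCycle p q))
        fun ρ => genus ρ.1) i := by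
  classical
  have : Nonempty G.E := ⟨a⟩
  have : Nonempty (amalgGraph G H).E := ⟨Sum.inl a⟩
  rw [countEmb_eq_tally, G.D_eq, G.S_eq, conv_tally, conv_tally, conv_tally, tally,
    ← (Equiv.ofBijective _ (splice_bijective hG hu)).sum_comp, Fintype.sum_prod_type,
    Finset.sum_comm, Fintype.sum_prod_type]
  simp only [Finset.mul_sum, ← Finset.sum_add_distrib]
  refine Finset.sum_congr rfl fun σ _ => Finset.sum_congr rfl fun ρ _ => ?_
  have hs := fun s => splice_faces hG hu σ.2 ρ.2 s
  simp only [Fintype.sum_sum_type, Fintype.sum_prod_type, Fintype.sum_bool,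
    Equiv.ofBijective_apply]
  have hl := fun s => (hs (Sum.inl s)).2 (by simp)
  simp only [fun s => (hl s).1, fun s => (hl s).2]
  by_cases hD : G.TypeD G.t σ.1
  · have hr := fun s => (hs (Sum.inr s)).1 ⟨rfl, hD⟩
    simp only [fun s => (hr s).1, fun s => (hr s).2, hD, true_and, not_true, false_and, if_false]
    ring
  · have hr := fun s => (hs (Sum.inr s)).2 (fun h => hD h.2)
    simp only [fun s => (hr s).1, fun s => (hr s).2, hD, true_and, not_false_iff, false_and,
      if_false]
    ring

theorem amalg_D (G : RootedGraph.{u}) (H : DoublyRootedGraph.{u}) (i : ℕ) :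
    (amalg G H).D i = 2 * conv G.D H.A₁ i + 4 * conv G.D H.A₂ i + 6 * conv G.S H.A₂ i := by
  classical
  obtain ⟨a, b, hG⟩ := exists_isHalfPair G.valence_t
  obtain ⟨c, d, hu⟩ := exists_isHalfPair H.valence_u
  obtain ⟨p, q, hv⟩ := exists_isHalfPair H.valence_v
  have h := countEmb_amalgGraph (p := p) (q := q) hG hu Not i
  simp only [← hv.typeD_iff] at h
  rw [H.A₁_eq hu hv, H.A₂_eq hu hv, ← h]
  have hX := isHalfPair_amalg (G := G) hv
  simp only [← hX.typeD_iff]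
  rfl

theorem amalg_S (G : RootedGraph.{u}) (H : DoublyRootedGraph.{u}) (i : ℕ) :
    (amalg G H).S i = 2 * conv G.D H.B₁ i + 4 * conv G.D H.B₂ i + 6 * conv G.S H.B₂ i := by
  classical
  obtain ⟨a, b, hG⟩ := exists_isHalfPair G.valence_t
  obtain ⟨c, d, hu⟩ := exists_isHalfPair H.valence_u
  obtain ⟨p, q, hv⟩ := exists_isHalfPair H.valence_v
  have h := countEmb_amalgGraph (p := p) (q := q) hG hu id i
  simp only [id, ← hv.typeS_iff] at h
  rw [H.B₁_eq hu hv, H.B₂_eq hu hv]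
  simp only [← hv.typeS_iff_not_typeD]
  rw [← h]
  have hX := isHalfPair_amalg (G := G) hv
  simp only [← hX.typeS_iff]
  rfl

/-! ## Ratio monotonicity of sequences indexed by the integers -/

section Chains

/-- Transitivity of ratio inequalities along a sequence of vectors in the quadrant in which zero
vectors occur only at the ends. -/
theorem ratio_chain {u w : ℤ → ℤ} (hu : ∀ t, 0 ≤ u t) (hw : ∀ t, 0 ≤ w t)
    (hadj : ∀ t, u t * w (t + 1) ≤ u (t + 1) * w t)
    (hz : ∀ t, u t = 0 → w t = 0 →
      (∀ s ≤ t, u s = 0 ∧ w s = 0) ∨ (∀ s ≥ t, u s = 0 ∧ w s = 0))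
    {s t : ℤ} (hst : s ≤ t) : u s * w t ≤ u t * w s := by
  induction t, hst using Int.leInduction with
  | base => rfl
  | succ t hst ih =>
    have h1 := hadj t
    rcases (hw t).eq_or_lt with h0 | h0
    · rcases (hu t).eq_or_lt with h2 | h2
      · rcases hz t h2.symm h0.symm with h | h
        · rw [(h s hst).1, (h s hst).2]; simp
        · rw [(h (t + 1) (by omega)).1, (h (t + 1) (by omega)).2]; simp
      · rw [← h0, mul_zero] at h1
        have h3 : w (t + 1) = 0 := by
          have := hw (t + 1)
          nlinarith
        rw [h3, mul_zero]
        exact mul_nonneg (hu _) (hw _)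
    · refine le_of_mul_le_mul_right ?_ h0
      calc u s * w (t + 1) * w t = u s * w t * w (t + 1) := by ring
        _ ≤ u t * w s * w (t + 1) := mul_le_mul_of_nonneg_right ih (hw _)
        _ = u t * w (t + 1) * w s := by ring
        _ ≤ u (t + 1) * w t * w s := mul_le_mul_of_nonneg_right h1 (hw _)
        _ = u (t + 1) * w s * w t := by ring

/-- Two consecutive zeros of `c` occur only at the ends of the support. -/
def Solid (c : ℤ → ℤ) : Prop :=
  ∀ m, c m = 0 → c (m + 1) = 0 → (∀ n ≤ m + 1, c n = 0) ∨ (∀ n ≥ m, c n = 0)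

/-- The even and the odd terms of `c` have no internal zeros. -/
def ParityConnected (c : ℤ → ℤ) : Prop :=
  ∀ p q r, p < q → q < r → p % 2 = q % 2 → q % 2 = r % 2 → c p ≠ 0 → c r ≠ 0 → c q ≠ 0

/-- Two consecutive zeros include one index of each parity, so the nonzero terms of each parity lie
on one side of the gap. An adjacent nonzero pair puts both parities on the same side. -/
theorem solid_of_adjacent {c : ℤ → ℤ} (hN : ParityConnected c)
    (hlink : (∃ x, x % 2 = 0 ∧ c x ≠ 0) → (∃ y, y % 2 = 1 ∧ c y ≠ 0) →
      ∃ n, c n ≠ 0 ∧ c (n + 1) ≠ 0) : Solid c := by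
  intro m h0 h1
  by_contra! hcon
  obtain ⟨⟨x, hx, hcx⟩, ⟨y, hy, hcy⟩⟩ := hcon
  have hx' : x < m := by
    rcases lt_or_ge x m with h | h
    · exact h
    · rcases h.eq_or_lt with h | h
      · exact absurd (h ▸ h0) hcx
      · obtain rfl : x = m + 1 := by omega
        exact absurd h1 hcx
  have hy' : m + 1 < y := by
    rcases lt_or_ge (m + 1) y with h | h
    · exact h
    · rcases h.eq_or_lt with h | h
      · exact absurd (h ▸ h1) hcy
      · obtain rfl : y = m := by omega
        exact absurd h0 hcy
  have key : ∀ p r, p < m → m + 1 < r → p % 2 = r % 2 → c p ≠ 0 → c r ≠ 0 → False := by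
    intro p r hp hr hpr h2 h3
    by_cases hm : m % 2 = p % 2
    · exact hN p m r hp (by omega) hm.symm (by omega) h2 h3 h0
    · exact hN p (m + 1) r (by omega) hr (by omega) (by omega) h2 h3 h1
  by_cases hxy : x % 2 = y % 2
  · exact key x y hx' hy' hxy hcx hcy
  obtain ⟨n, hn, hn'⟩ : ∃ n, c n ≠ 0 ∧ c (n + 1) ≠ 0 := by
    rcases Int.emod_two_eq_zero_or_one x with h | h
    · exact hlink ⟨x, h, hcx⟩ ⟨y, by omega, hcy⟩
    · exact hlink ⟨y, by omega, hcy⟩ ⟨x, h, hcx⟩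
  have n1 : n ≠ m := fun e => hn (e ▸ h0)
  have n2 : n ≠ m + 1 := fun e => hn (e ▸ h1)
  have n3 : n + 1 ≠ m := fun e => hn' (e ▸ h0)
  rcases lt_or_ge n m with h | h
  · by_cases hp : n % 2 = y % 2
    · exact key n y h hy' hp hn hcy
    · exact key (n + 1) y (by omega) hy' (by omega) hn' hcy
  · by_cases hp : n % 2 = x % 2
    · exact key x n hx' (by omega) hp.symm hcx hn
    · exact key x (n + 1) hx' (by omega) (by omega) hcx hn'

/-! ### The lexicographic conditions for interleaved sequences and their long-range form -/

/-- The conditions on two interleaved sequences `…, bₖ, aₖ, bₖ₊₁, aₖ₊₁, …` in terms of which the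
lexicographic conditions are used. -/
structure LexPair (c₁ c₂ : ℤ → ℤ) : Prop where
  nonneg₁ : ∀ n, 0 ≤ c₁ n
  nonneg₂ : ∀ n, 0 ≤ c₂ n
  lex₁ : ∀ m, c₁ m * c₂ (m + 1) ≤ c₂ m * c₁ (m + 1)
  lex₂ : ∀ m, c₂ m * c₁ (m + 3) ≤ c₁ (m + 2) * c₂ (m + 1)
  near₁ : ∀ n, c₁ n = 0 → c₁ (n + 1) = 0 → c₁ (n + 2) = 0 → c₂ n = 0
  near₂ : ∀ n, c₂ (n - 2) = 0 → c₂ (n - 1) = 0 → c₂ n = 0 → c₁ n = 0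
  solid₁ : Solid c₁
  solid₂ : Solid c₂

/-- Let `x < y` bound a gap of `c₁` of at least two zeros. By `n2`, `c₂` has nonzero terms near `x`
and near `y`. If `y = x + 3`, the two ratio conditions give `c₂ x = c₂ (x + 1) = 0`; if `y ≥ x + 5`,
`n1` gives zeros of `c₂` at `x + 1` and `x + 2`; both contradict solidity of `c₂`. The case `y = x +
4` contradicts parity connectedness. -/
theorem solid_of_solid {c₁ c₂ : ℤ → ℤ}
    (h1 : ∀ m, c₁ m * c₂ (m + 1) ≤ c₂ m * c₁ (m + 1))
    (h2 : ∀ m, c₂ m * c₁ (m + 3) ≤ c₁ (m + 2) * c₂ (m + 1))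
    (hp1 : ∀ n, 0 ≤ c₁ n) (hp2 : ∀ n, 0 ≤ c₂ n)
    (n1 : ∀ n, c₁ n = 0 → c₁ (n + 1) = 0 → c₁ (n + 2) = 0 → c₂ n = 0)
    (n2 : ∀ n, c₂ (n - 2) = 0 → c₂ (n - 1) = 0 → c₂ n = 0 → c₁ n = 0)
    (hN : ParityConnected c₁) (hs : Solid c₂) : Solid c₁ := by
  intro m hm0 hm1
  by_contra! hcon
  obtain ⟨⟨x₀, hx₀, hcx₀⟩, ⟨y₀, hy₀, hcy₀⟩⟩ := hcon
  obtain ⟨x, ⟨hx, hcx⟩, hxmax⟩ := Int.exists_greatest_of_bdd (P := fun x => x ≤ m + 1 ∧ c₁ x ≠ 0)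
    ⟨m + 1, fun z hz => hz.1⟩ ⟨x₀, hx₀, hcx₀⟩
  obtain ⟨y, ⟨hy, hcy⟩, hymin⟩ := Int.exists_least_of_bdd (P := fun y => m ≤ y ∧ c₁ y ≠ 0)
    ⟨m, fun z hz => hz.1⟩ ⟨y₀, hy₀, hcy₀⟩
  have hxm : x ≠ m := fun e => hcx (e ▸ hm0)
  have hxm' : x ≠ m + 1 := fun e => hcx (e ▸ hm1)
  have hym : y ≠ m := fun e => hcy (e ▸ hm0)
  have hym' : y ≠ m + 1 := fun e => hcy (e ▸ hm1)
  have hzero : ∀ z, x < z → z < y → c₁ z = 0 := by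
    intro z hxz hzy
    by_contra hz
    rcases le_or_gt z (m + 1) with h | h
    · have := hxmax z ⟨h, hz⟩
      omega
    · have := hymin z ⟨by omega, hz⟩
      omega
  have hzero2 : ∀ z, x < z → z + 2 < y → c₂ z = 0 := fun z hxz hzy =>
    n1 z (hzero z hxz (by omega)) (hzero _ (by omega) (by omega)) (hzero _ (by omega) (by omega))
  obtain ⟨w, hw1, hw2, hcw⟩ : ∃ w, x - 2 ≤ w ∧ w ≤ x ∧ c₂ w ≠ 0 := by
    by_contra! hc
    exact hcx (n2 x (hc _ (by omega) (by omega)) (hc _ (by omega) (by omega))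
      (hc _ (by omega) (by omega)))
  obtain ⟨v, hv1, hv2, hcv⟩ : ∃ v, y - 2 ≤ v ∧ v ≤ y ∧ c₂ v ≠ 0 := by
    by_contra! hc
    exact hcy (n2 y (hc _ (by omega) (by omega)) (hc _ (by omega) (by omega))
      (hc _ (by omega) (by omega)))
  rcases lt_trichotomy y (x + 4) with h | h | h
  · obtain rfl : y = x + 3 := by omega
    have e1 : c₂ x = 0 := by
      have h3 := h2 x
      rw [hzero (x + 2) (by omega) (by omega), zero_mul] at h3
      have h4 : 0 < c₁ (x + 3) := lt_of_le_of_ne (hp1 _) (Ne.symm hcy)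
      have := hp2 x
      nlinarith
    have e2 : c₂ (x + 1) = 0 := by
      have h3 := h1 x
      rw [e1, zero_mul] at h3
      have h4 : 0 < c₁ x := lt_of_le_of_ne (hp1 _) (Ne.symm hcx)
      have := hp2 (x + 1)
      nlinarith
    rcases hs x e1 e2 with h5 | h5
    · exact hcw (h5 w (by omega))
    · exact hcv (h5 v (by omega))
  · subst h
    exact hN x (x + 2) (x + 4) (by omega) (by omega) (by omega) (by omega) hcx hcy
      (hzero _ (by omega) (by omega))
  · rcases hs (x + 1) (hzero2 _ (by omega) (by omega)) (hzero2 _ (by omega) (by omega)) with h5 | h5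
    · exact hcw (h5 w (by omega))
    · exact hcv (h5 v (by omega))

theorem Solid.shift {c : ℤ → ℤ} (h : Solid c) : Solid fun n => c (n + 1) := by
  intro m h0 h1
  refine (h (m + 1) h0 h1).imp (fun h n hn => h _ (by omega)) (fun h n hn => h _ (by omega))

theorem LexPair.shift {c₁ c₂ : ℤ → ℤ} (h : LexPair c₁ c₂) :
    LexPair (fun n => c₁ (n + 1)) fun n => c₂ (n + 1) where
  nonneg₁ n := h.nonneg₁ _
  nonneg₂ n := h.nonneg₂ _
  lex₁ m := h.lex₁ _
  lex₂ m := by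
    have := h.lex₂ (m + 1)
    rwa [add_right_comm m 1 3, add_right_comm m 1 2] at this
  near₁ n h1 h2 h3 := h.near₁ (n + 1) h1 h2 (by rwa [add_right_comm])
  near₂ n h1 h2 h3 := h.near₂ (n + 1) (by rwa [show n + 1 - 2 = n - 2 + 1 by ring])
    (by rwa [show n + 1 - 1 = n - 1 + 1 by ring]) h3
  solid₁ := h.solid₁.shift
  solid₂ := h.solid₂.shift

/-- The terms `c₁ t` and `c₂ t` with `t` even, merged to one sequence. -/
def merge (c₁ c₂ : ℤ → ℤ) (t : ℤ) : ℤ := if t % 2 = 0 then c₁ t else c₂ (t - 1)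

theorem merge_two_mul (c₁ c₂ : ℤ → ℤ) (k : ℤ) : merge c₁ c₂ (2 * k) = c₁ (2 * k) := by
  simp [merge]

theorem merge_two_mul_add_one (c₁ c₂ : ℤ → ℤ) (k : ℤ) :
    merge c₁ c₂ (2 * k + 1) = c₂ (2 * k) := by
  simp [merge]

/-- With α the merged sequence and β that of the shifted pair, a second shift returns α moved by
two. So the inequalities for (α, β) and for (β, α(· + 2)) are instances of one statement. -/
theorem merge_shift_two (c₁ c₂ : ℤ → ℤ) (t : ℤ) :
    merge (fun n => c₁ (n + 1 + 1)) (fun n => c₂ (n + 1 + 1)) t = merge c₁ c₂ (t + 2) := by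
  simp only [merge]
  rw [show (t + 2) % 2 = t % 2 by omega, show t + 1 + 1 = t + 2 by ring,
    show t - 1 + 1 + 1 = t + 2 - 1 by ring]

theorem LexPair.merge_nonneg {c₁ c₂ : ℤ → ℤ} (h : LexPair c₁ c₂) (t : ℤ) :
    0 ≤ merge c₁ c₂ t := by
  unfold merge
  split_ifs
  · exact h.nonneg₁ _
  · exact h.nonneg₂ _

/-- Consecutive indices are covered alternately by `lex₁` and `lex₂`. A zero vector is a pair of
consecutive zeros of one sequence; solidity carries these to one end, and `near₁`, `near₂` carry
them over to the other sequence. -/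
theorem LexPair.merge_ratio {c₁ c₂ : ℤ → ℤ} (h : LexPair c₁ c₂) {s t : ℤ} (hst : s ≤ t) :
    merge c₁ c₂ s * merge (fun n => c₁ (n + 1)) (fun n => c₂ (n + 1)) t ≤
      merge c₁ c₂ t * merge (fun n => c₁ (n + 1)) (fun n => c₂ (n + 1)) s := by
  refine ratio_chain h.merge_nonneg h.shift.merge_nonneg (fun t => ?_) (fun t h0 h1 => ?_) hst
  · obtain ⟨k, rfl | rfl⟩ := Int.even_or_odd' t
    · simp only [merge_two_mul, merge_two_mul_add_one]
      exact h.lex₁ _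
    · rw [show 2 * k + 1 + 1 = 2 * (k + 1) by ring]
      simp only [merge_two_mul, merge_two_mul_add_one]
      have := h.lex₂ (2 * k)
      rwa [show 2 * (k + 1) = 2 * k + 2 by ring, show 2 * k + 2 + 1 = 2 * k + 3 by ring]
  · have hz1 : ∀ z, (∀ n, z ≤ n → n ≤ z + 2 → c₁ n = 0) → c₂ z = 0 := fun z hz =>
      h.near₁ z (hz _ (by omega) (by omega)) (hz _ (by omega) (by omega))
        (hz _ (by omega) (by omega))
    have hz2 : ∀ z, (∀ n, z - 2 ≤ n → n ≤ z → c₂ n = 0) → c₁ z = 0 := fun z hz =>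
      h.near₂ z (hz _ (by omega) (by omega)) (hz _ (by omega) (by omega))
        (hz _ (by omega) (by omega))
    have hmerge : ∀ s, (∀ k, s = 2 * k → c₁ (2 * k) = 0 ∧ c₁ (2 * k + 1) = 0) →
        (∀ k, s = 2 * k + 1 → c₂ (2 * k) = 0 ∧ c₂ (2 * k + 1) = 0) → merge c₁ c₂ s = 0 ∧
          merge (fun n => c₁ (n + 1)) (fun n => c₂ (n + 1)) s = 0 := by
      intro s h1 h2
      obtain ⟨k, rfl | rfl⟩ := Int.even_or_odd' s
      · simp only [merge_two_mul]
        exact h1 k rfl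
      · simp only [merge_two_mul_add_one]
        exact h2 k rfl
    obtain ⟨k, rfl | rfl⟩ := Int.even_or_odd' t
    · simp only [merge_two_mul] at h0 h1
      rcases h.solid₁ _ h0 h1 with hs | hs
      · refine Or.inl fun s hs' => hmerge s (fun l e => ⟨hs _ (by omega), hs _ (by omega)⟩)
          fun l e => ⟨hz1 _ fun n _ _ => hs _ (by omega), hz1 _ fun n _ _ => hs _ (by omega)⟩
      · refine Or.inr fun s hs' => hmerge s (fun l e => ⟨hs _ (by omega), hs _ (by omega)⟩)
          fun l e => ⟨hz1 _ fun n _ _ => hs _ (by omega), hz1 _ fun n _ _ => hs _ (by omega)⟩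
    · simp only [merge_two_mul_add_one] at h0 h1
      rcases h.solid₂ _ h0 h1 with hs | hs
      · refine Or.inl fun s hs' => hmerge s
          (fun l e => ⟨hz2 _ fun n _ _ => hs _ (by omega), hz2 _ fun n _ _ => hs _ (by omega)⟩)
          fun l e => ⟨hs _ (by omega), hs _ (by omega)⟩
      · refine Or.inr fun s hs' => hmerge s
          (fun l e => ⟨hz2 _ fun n _ _ => hs _ (by omega), hz2 _ fun n _ _ => hs _ (by omega)⟩)
          fun l e => ⟨hs _ (by omega), hs _ (by omega)⟩

/-- Log-concavity from ratio monotonicity. -/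
theorem log_concave_of_ratio {α β : ℤ → ℤ} (hα : ∀ t, 0 ≤ α t) (hβ : ∀ t, 0 ≤ β t)
    (h1 : ∀ s t, s ≤ t → α s * β t ≤ α t * β s)
    (h2 : ∀ s t, s ≤ t → β s * α (t + 2) ≤ β t * α (s + 2)) (hne : ∃ z, β z ≠ 0)
    {s t : ℤ} (hst : s ≤ t) : α s * α (t + 2) ≤ α t * α (s + 2) := by
  have g1 := h1 s t hst
  have g2 := h2 s t hst
  rcases (mul_nonneg (hα s) (hα (t + 2))).eq_or_lt with h0 | h0
  · rw [← h0]
    exact mul_nonneg (hα _) (hα _)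
  have hs : 0 < α s := lt_of_le_of_ne (hα _) fun e => by simp [← e] at h0
  have ht : 0 < α (t + 2) := lt_of_le_of_ne (hα _) fun e => by simp [← e] at h0
  by_cases hpos : 0 < β s ∧ 0 < β t
  · refine le_of_mul_le_mul_right ?_ (mul_pos hpos.1 hpos.2)
    calc α s * α (t + 2) * (β s * β t) = α s * β t * (β s * α (t + 2)) := by ring
      _ ≤ α t * β s * (β t * α (s + 2)) :=
        mul_le_mul g1 g2 (mul_nonneg (hβ _) (hα _)) (mul_nonneg (hα _) (hβ _))
      _ = α t * α (s + 2) * (β s * β t) := by ring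
  -- With `α s` and `α (t + 2)` positive, `β` vanishes at `s` and `t`; then `h1` kills it from `s`
  -- on and `h2` up to `s`.
  · exfalso
    have hzero : β s = 0 ∧ β t = 0 := by
      rcases (hβ s).eq_or_lt with e | e
      · refine ⟨e.symm, ?_⟩
        rw [← e, mul_zero] at g1
        have := hβ t
        nlinarith
      · have et : β t = 0 := by
          by_contra hn
          exact hpos ⟨e, lt_of_le_of_ne (hβ _) (Ne.symm hn)⟩
        rw [et, zero_mul] at g2
        nlinarith
    obtain ⟨z, hz⟩ := hne
    have hz0 : 0 < β z := lt_of_le_of_ne (hβ _) (Ne.symm hz)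
    rcases le_total s z with h | h
    · have := h1 s z h
      rw [hzero.1, mul_zero] at this
      nlinarith
    · have := h2 z t (h.trans hst)
      rw [hzero.2, zero_mul] at this
      nlinarith

/-- The Cauchy–Binet inequality for two ratio-monotone pairs. -/
theorem cauchy_binet_le {I : Finset ℤ} {u u' w w' : ℤ → ℤ}
    (hu : ∀ s t, s ≤ t → u s * u' t ≤ u' s * u t)
    (hw : ∀ s t, s ≤ t → w' s * w t ≤ w s * w' t) :
    (∑ s ∈ I, u s * w s) * (∑ s ∈ I, u' s * w' s) ≤
      (∑ s ∈ I, u s * w' s) * (∑ s ∈ I, u' s * w s) := by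
  -- Both minors change sign when `s` and `t` are exchanged, so their product is nonpositive in
  -- either order.
  have key : ∀ s t, (u s * u' t - u' s * u t) * (w s * w' t - w' s * w t) ≤ 0 := by
    intro s t
    rcases le_total s t with h | h
    · exact mul_nonpos_of_nonpos_of_nonneg (sub_nonpos.2 (hu s t h)) (sub_nonneg.2 (hw s t h))
    · refine mul_nonpos_of_nonneg_of_nonpos ?_ ?_
      · have := hu t s h
        linarith
      · have := hw t s h
        linarith
  have hsum : ∑ s ∈ I, ∑ t ∈ I, (u s * u' t - u' s * u t) * (w s * w' t - w' s * w t) ≤ 0 :=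
    Finset.sum_nonpos fun s _ => Finset.sum_nonpos fun t _ => key s t
  have hexp : ∑ s ∈ I, ∑ t ∈ I, (u s * u' t - u' s * u t) * (w s * w' t - w' s * w t) =
      2 * ((∑ s ∈ I, u s * w s) * (∑ s ∈ I, u' s * w' s) -
        (∑ s ∈ I, u s * w' s) * (∑ s ∈ I, u' s * w s)) := by
    have e : ∀ s t, (u s * u' t - u' s * u t) * (w s * w' t - w' s * w t) =
        u s * w s * (u' t * w' t) - u s * w' s * (u' t * w t) - u' s * w s * (u t * w' t) +
          u' s * w' s * (u t * w t) := fun s t => by ring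
    simp only [e, Finset.sum_add_distrib, Finset.sum_sub_distrib, ← Finset.mul_sum,
      ← Finset.sum_mul]
    ring
  linarith

/-- The strong form of `D ≲ S` for the interleaved sequence `…, Sₖ, Dₖ, Sₖ₊₁, Dₖ₊₁, …`. -/
structure RatioMonotone (f : ℤ → ℤ) : Prop where
  step_one : ∀ (m : ℤ) (r : ℕ), f m * f (m + 2 * r + 1) ≤ f (m + 1) * f (m + 2 * r)
  step_two : ∀ (m : ℤ) (r : ℕ), f m * f (m + 2 * r + 2) ≤ f (m + 2) * f (m + 2 * r)

namespace RatioMonotone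

variable {f : ℤ → ℤ}

/-- At odd distance, `step_one` moves both indices inward by one. Beyond the middle the two factors
have exchanged roles. -/
theorem inward_odd (hf : RatioMonotone f) {p : ℤ} {k j : ℕ} (hj : j ≤ 2 * k + 1) :
    f p * f (p + 2 * k + 1) ≤ f (p + j) * f (p + 2 * k + 1 - j) := by
  have key : ∀ j : ℕ, j ≤ k → f p * f (p + 2 * k + 1) ≤ f (p + j) * f (p + 2 * k + 1 - j) := by
    intro j
    induction j with
    | zero => intro _; simp
    | succ j ih =>
      intro h
      refine (ih (by omega)).trans ?_
      have := hf.step_one (p + j) (k - j)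
      push_cast [Nat.cast_sub (show j ≤ k by omega)] at this ⊢
      convert this using 3 <;> first | ring | rfl
  rcases le_or_gt j k with h | h
  · exact key j h
  · have := key (2 * k + 1 - j) (by omega)
    have e : ((2 * k + 1 - j : ℕ) : ℤ) = 2 * k + 1 - j := by omega
    rw [e] at this
    rw [mul_comm (f (p + j)), show p + (j : ℤ) = p + 2 * k + 1 - (2 * k + 1 - j) by ring,
      show p + 2 * (k : ℤ) + 1 - j = p + (2 * k + 1 - j) by ring]
    exact this

theorem inward_even (hf : RatioMonotone f) {p : ℤ} {k j : ℕ} (hj : j ≤ k) :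
    f p * f (p + 2 * k) ≤ f (p + 2 * j) * f (p + 2 * k - 2 * j) := by
  have key : ∀ j : ℕ, 2 * j ≤ k + 1 →
      f p * f (p + 2 * k) ≤ f (p + 2 * j) * f (p + 2 * k - 2 * j) := by
    intro j
    induction j with
    | zero => intro _; simp
    | succ j ih =>
      intro h
      refine (ih (by omega)).trans ?_
      rcases Nat.lt_or_ge (2 * j + 1) k with h1 | h1
      · have := hf.step_two (p + 2 * j) (k - 2 * j - 1)
        have e : ((k - 2 * j - 1 : ℕ) : ℤ) = k - 2 * j - 1 := by omega
        rw [e] at this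
        push_cast
        convert this using 3 <;> first | ring | rfl
      -- The indices are only two apart, and a move by two exchanges them.
      · have e : (k : ℤ) = 2 * j + 1 := by omega
        rw [e, mul_comm]
        push_cast
        refine le_of_eq ?_
        congr 2 <;> ring
  rcases Nat.le_total (2 * j) (k + 1) with h | h
  · exact key j h
  · have := key (k - j) (by omega)
    have e : ((k - j : ℕ) : ℤ) = k - j := by omega
    rw [e] at this
    rw [mul_comm (f (p + 2 * j)), show p + 2 * (j : ℤ) = p + 2 * k - 2 * (k - j) by ring,
      show p + 2 * (k : ℤ) - 2 * j = p + 2 * (k - j) by ring]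
    exact this

theorem ratio_shift (hf : RatioMonotone f) {s t : ℤ} (hst : s ≤ t) (r : ℕ) :
    f s * f (t + 2 * r) ≤ f (s + 2 * r) * f t := by
  obtain ⟨d, rfl⟩ := Int.le.dest hst
  obtain ⟨k, rfl | rfl⟩ := Nat.even_or_odd' d
  · have := hf.inward_even (p := s) (k := k + r) (j := r) (by omega)
    push_cast at this ⊢
    convert this using 3 <;> ring
  · have := hf.inward_odd (p := s) (k := k + r) (j := 2 * r) (by omega)
    push_cast at this ⊢
    convert this using 3 <;> ring

end RatioMonotone

/-- The interleaved sequence of `2 D + 3 S` and `D`. -/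
def weighted (f : ℤ → ℤ) (s : ℤ) : ℤ := if s % 2 = 0 then 2 * f (s + 1) + 3 * f s else f s

/-- Expansion leaves `ratio_shift` for `s` or `s + 1` against `t` or `t + 1`. The pair `s + 1`, `t`
needs `s < t`, and `s = t` is commutativity. -/
theorem RatioMonotone.weighted_ratio_shift {f : ℤ → ℤ} (hf : RatioMonotone f) {s t : ℤ}
    (hst : s ≤ t) (r : ℕ) :
    weighted f s * weighted f (t + 2 * r) ≤ weighted f (s + 2 * r) * weighted f t := by
  rcases hst.eq_or_lt with rfl | hlt
  · rw [mul_comm]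
  have h1 := hf.ratio_shift hst r
  have h2 := hf.ratio_shift (s := s) (t := t + 1) (by omega) r
  have h3 := hf.ratio_shift (s := s + 1) (t := t) (by omega) r
  have h4 := hf.ratio_shift (s := s + 1) (t := t + 1) (by omega) r
  unfold weighted
  rw [show (t + 2 * r) % 2 = t % 2 by omega, show (s + 2 * r) % 2 = s % 2 by omega,
    add_right_comm t _ 1, add_right_comm s _ 1]
  split_ifs <;> nlinarith

end Chains

/-! ## Interleaved sequences and their convolutions -/

/-- The extension of a sequence by zero. -/
def extend (a : ℕ → ℕ) (z : ℤ) : ℤ := if 0 ≤ z then (a z.toNat : ℤ) else 0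

/-- The sequence `…, bₖ, aₖ, bₖ₊₁, aₖ₊₁, …`. -/
def interleave (b a : ℕ → ℕ) (z : ℤ) : ℤ := if z % 2 = 0 then extend b (z / 2) else extend a (z / 2)

@[simp] theorem extend_natCast (a : ℕ → ℕ) (n : ℕ) : extend a n = a n := by simp [extend]

theorem extend_of_neg (a : ℕ → ℕ) {z : ℤ} (hz : z < 0) : extend a z = 0 := by
  simp [extend, hz]

theorem extend_nonneg (a : ℕ → ℕ) (z : ℤ) : 0 ≤ extend a z := by
  unfold extend
  split_ifs <;> positivity

theorem extend_ne_zero {a : ℕ → ℕ} {z : ℤ} (h : extend a z ≠ 0) :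
    ∃ n : ℕ, z = n ∧ a n ≠ 0 := by
  rcases lt_or_ge z 0 with hz | hz
  · exact absurd (extend_of_neg a hz) h
  · lift z to ℕ using hz
    exact ⟨z, rfl, by simpa using h⟩

theorem interleave_two_mul (b a : ℕ → ℕ) (k : ℤ) : interleave b a (2 * k) = extend b k := by
  simp [interleave]

theorem interleave_two_mul_add_one (b a : ℕ → ℕ) (k : ℤ) :
    interleave b a (2 * k + 1) = extend a k := by
  have : (2 * k + 1) / 2 = k := by omega
  simp [interleave, this]

theorem interleave_of_neg (b a : ℕ → ℕ) {z : ℤ} (hz : z < 0) : interleave b a z = 0 := by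
  unfold interleave
  split_ifs <;> exact extend_of_neg _ (by omega)

theorem interleave_nonneg (b a : ℕ → ℕ) (z : ℤ) : 0 ≤ interleave b a z := by
  unfold interleave
  split_ifs <;> exact extend_nonneg _ _

theorem NoInternalZeros.extend {a : ℕ → ℕ} (ha : NoInternalZeros a) {p q r : ℤ} (hpq : p < q)
    (hqr : q < r) (hp : extend a p ≠ 0) (hr : GenusChain.extend a r ≠ 0) :
    GenusChain.extend a q ≠ 0 := by
  obtain ⟨i, rfl, hi⟩ := extend_ne_zero hp
  obtain ⟨j, rfl, hj⟩ := extend_ne_zero hr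
  lift q to ℕ using by omega
  simpa using ha i q j (by omega) (by omega) hi hj

theorem parityConnected_interleave {b a : ℕ → ℕ} (hb : NoInternalZeros b)
    (ha : NoInternalZeros a) : ParityConnected (interleave b a) := by
  intro p q r hpq hqr h1 h2 hp hr
  unfold interleave at *
  rw [← h1] at h2 ⊢
  rw [← h2] at hr
  split_ifs at * with h
  · exact hb.extend (by omega) (by omega) hp hr
  · exact ha.extend (by omega) (by omega) hp hr

theorem solid_interleave {b a : ℕ → ℕ} (hb : NoInternalZeros b) (ha : NoInternalZeros a)
    (h : a ≠ 0 → b ≠ 0 → ∃ k, a k ≠ 0 ∧ (b k ≠ 0 ∨ b (k + 1) ≠ 0)) :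
    Solid (interleave b a) := by
  refine solid_of_adjacent (parityConnected_interleave hb ha) ?_
  rintro ⟨x, hx, hcx⟩ ⟨y, hy, hcy⟩
  simp only [interleave, hx, if_true] at hcx
  simp only [interleave, hy, one_ne_zero, if_false] at hcy
  obtain ⟨i, -, hi⟩ := extend_ne_zero hcx
  obtain ⟨j, -, hj⟩ := extend_ne_zero hcy
  obtain ⟨k, hk, hk' | hk'⟩ := h (fun e => hj (congrFun e j)) (fun e => hi (congrFun e i))
  · refine ⟨2 * k, ?_, ?_⟩
    · rw [interleave_two_mul]
      simpa using hk'
    · rw [interleave_two_mul_add_one]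
      simpa using hk
  · refine ⟨2 * k + 1, ?_, ?_⟩
    · rw [interleave_two_mul_add_one]
      simpa using hk
    · rw [show (2 * k + 1 + 1 : ℤ) = 2 * ((k + 1 : ℕ) : ℤ) by push_cast; ring, interleave_two_mul]
      rw [extend_natCast]; exact_mod_cast hk'

/-- The inequalities at the smallest distance are chained. For `step_one` the zero vectors are two
consecutive zeros, excluded inside the support by `hlink`; for `step_two` they lie within one
parity, where the absence of internal zeros suffices. -/
theorem ratioMonotone_of_ratioDominated {D S : ℕ → ℕ} (hD : NoInternalZeros D)
    (hS : NoInternalZeros S) (h : RatioDominated D S)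
    (hlink : D ≠ 0 → S ≠ 0 → ∃ k, D k ≠ 0 ∧ (S k ≠ 0 ∨ S (k + 1) ≠ 0)) :
    RatioMonotone (interleave S D) := by
  obtain ⟨⟨hDl, hSl, h1, -⟩, h3⟩ := h
  have hnn := interleave_nonneg S D
  have hsol := solid_interleave hS hD hlink
  have hpar := parityConnected_interleave hS hD
  have hext : ∀ {a b c d : ℕ → ℕ} (i j k l : ℕ), (∀ n, a (n + i) * b (n + j) ≤ c (n + k) * d (n + l)) →
      (∀ z : ℤ, z < 0 → extend a (z + i) = 0 ∨ extend b (z + j) = 0) →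
      ∀ z : ℤ, extend a (z + i) * extend b (z + j) ≤ extend c (z + k) * extend d (z + l) := by
    intro a b c d i j k l hn hneg z
    rcases lt_or_ge z 0 with hz | hz
    · refine le_trans (le_of_eq ?_) (mul_nonneg (extend_nonneg _ _) (extend_nonneg _ _))
      rcases hneg z hz with e | e <;> rw [e] <;> simp
    · lift z to ℕ using hz
      have := hn z
      simp only [← Nat.cast_add, extend_natCast]
      exact_mod_cast this
  have hadj : ∀ m, interleave S D m * interleave S D (m + 3) ≤
      interleave S D (m + 1) * interleave S D (m + 2) := by
    intro m
    obtain ⟨k, rfl | rfl⟩ := Int.even_or_odd' m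
    · rw [show 2 * k + 3 = 2 * (k + 1) + 1 by ring, show 2 * k + 2 = 2 * (k + 1) by ring]
      simp only [interleave_two_mul, interleave_two_mul_add_one]
      have := hext (a := S) (b := D) (c := D) (d := S) 0 1 0 1
        (fun n => by rw [mul_comm]; exact h3 n)
        (fun z hz => Or.inl (extend_of_neg _ (by simpa using hz))) k
      simpa using this
    · rw [show 2 * k + 1 + 3 = 2 * (k + 2) by ring, show 2 * k + 1 + 1 = 2 * (k + 1) by ring,
        show 2 * k + 1 + 2 = 2 * (k + 1) + 1 by ring]
      simp only [interleave_two_mul, interleave_two_mul_add_one]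
      have := hext (a := D) (b := S) (c := S) (d := D) 0 2 1 1
        (fun n => by rw [mul_comm (S (n + 1))]; exact h1 n)
        (fun z hz => Or.inl (extend_of_neg _ (by simpa using hz))) k
      simpa using this
  have hlc : ∀ m, interleave S D m * interleave S D (m + 4) ≤
      interleave S D (m + 2) * interleave S D (m + 2) := by
    intro m
    obtain ⟨k, rfl | rfl⟩ := Int.even_or_odd' m
    · rw [show 2 * k + 4 = 2 * (k + 2) by ring, show 2 * k + 2 = 2 * (k + 1) by ring]
      simp only [interleave_two_mul]
      have := hext (a := S) (b := S) (c := S) (d := S) 0 2 1 1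
        (fun n => (hSl n).trans_eq (sq _))
        (fun z hz => Or.inl (extend_of_neg _ (by simpa using hz))) k
      simpa using this
    · rw [show 2 * k + 1 + 4 = 2 * (k + 2) + 1 by ring,
        show 2 * k + 1 + 2 = 2 * (k + 1) + 1 by ring]
      simp only [interleave_two_mul_add_one]
      have := hext (a := D) (b := D) (c := D) (d := D) 0 2 1 1
        (fun n => (hDl n).trans_eq (sq _))
        (fun z hz => Or.inl (extend_of_neg _ (by simpa using hz))) k
      simpa using this
  generalize interleave S D = f at *
  refine ⟨fun m r => ?_, fun m r => ?_⟩
  · have := ratio_chain (u := fun t => f (m + 2 * t)) (w := fun t => f (m + 2 * t + 1))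
      (fun t => hnn _) (fun t => hnn _) (fun t => ?_) (fun t h0 h1 => ?_)
      (show (0 : ℤ) ≤ r by positivity)
    · simp only [mul_zero, add_zero] at this
      rwa [mul_comm (f (m + 1))]
    · have := hadj (m + 2 * t)
      rw [show m + 2 * (t + 1) + 1 = m + 2 * t + 3 by ring,
        show m + 2 * (t + 1) = m + 2 * t + 2 by ring, mul_comm (f (m + 2 * t + 2))]
      exact this
    · rcases hsol _ h0 h1 with h | h
      · exact Or.inl fun s hs => ⟨h _ (by omega), h _ (by omega)⟩
      · exact Or.inr fun s hs => ⟨h _ (by omega), h _ (by omega)⟩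
  · have := ratio_chain (u := fun t => f (m + 2 * t)) (w := fun t => f (m + 2 * t + 2))
      (fun t => hnn _) (fun t => hnn _) (fun t => ?_) (fun t h0 h1 => ?_)
      (show (0 : ℤ) ≤ r by positivity)
    · simp only [mul_zero, add_zero] at this
      rwa [mul_comm (f (m + 2))]
    · have := hlc (m + 2 * t)
      rw [show m + 2 * (t + 1) + 2 = m + 2 * t + 4 by ring,
        show m + 2 * (t + 1) = m + 2 * t + 2 by ring]
      exact this
    · by_contra! hcon
      obtain ⟨⟨s, hs, hs'⟩, ⟨s', hs₁, hs₁'⟩⟩ := hcon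
      obtain ⟨p, hp, hpp, hp0⟩ : ∃ p, p < m + 2 * t ∧ p % 2 = m % 2 ∧ f p ≠ 0 := by
        by_cases e : f (m + 2 * s) = 0
        · refine ⟨m + 2 * s + 2, ?_, by omega, hs' e⟩
          rcases hs.eq_or_lt with rfl | hlt
          · exact absurd h1 (hs' e)
          · have : s + 1 ≠ t := by
              rintro rfl
              exact hs' e (by rw [← h0]; ring_nf)
            omega
        · refine ⟨m + 2 * s, ?_, by omega, e⟩
          have : s ≠ t := by
            rintro rfl
            exact e h0
          omega
      obtain ⟨q, hq, hqq, hq0⟩ : ∃ q, m + 2 * t < q ∧ q % 2 = m % 2 ∧ f q ≠ 0 := by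
        by_cases e : f (m + 2 * s') = 0
        · refine ⟨m + 2 * s' + 2, by omega, by omega, hs₁' e⟩
        · refine ⟨m + 2 * s', ?_, by omega, e⟩
          have : s' ≠ t := by
            rintro rfl
            exact e h0
          omega
      exact hpar p (m + 2 * t) q hp hq (by omega) (by omega) hp0 hq0 h0

/-- The convolution of sequences on the integers. -/
noncomputable def zconv (g x : ℤ → ℤ) (a : ℤ) : ℤ := ∑ᶠ s, g s * x (a - s)

theorem zconv_add (g x : ℤ → ℤ) (a b : ℤ) :
    zconv g (fun z => x (z + b)) a = zconv g x (a + b) := by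
  unfold zconv
  refine finsum_congr fun s => ?_
  simp only [sub_add_eq_add_sub]

/-- Substituting `s + 2r` for the summation index puts the shift on `g`. Then Cauchy–Binet applies
to `g` and its shift against `x` and `y` read backwards. The bound `-4` leaves room for sequences
shifted by two. -/
theorem zconv_mul_le {g x y : ℤ → ℤ} (hg0 : ∀ s < 0, g s = 0) (hx0 : ∀ z < -4, x z = 0)
    (hy0 : ∀ z < -4, y z = 0)
    (hg : ∀ s t, s ≤ t → ∀ r : ℕ, g s * g (t + 2 * r) ≤ g (s + 2 * r) * g t)
    (hxy : ∀ s t, s ≤ t → x s * y t ≤ x t * y s) (a : ℤ) (r : ℕ) :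
    zconv g x a * zconv g y (a + 2 * r) ≤ zconv g y a * zconv g x (a + 2 * r) := by
  let I : Finset ℤ := Finset.Icc (-(2 * r)) (a + 4)
  have e1 : ∀ x : ℤ → ℤ, (∀ z < -4, x z = 0) → zconv g x a = ∑ s ∈ I, g s * x (a - s) := by
    intro x hx
    refine finsum_eq_sum_of_support_subset _ fun s hs => ?_
    rw [Function.mem_support] at hs
    rw [Finset.mem_coe, Finset.mem_Icc]
    have h1 : 0 ≤ s := by
      by_contra hn
      exact hs (by rw [hg0 s (by omega), zero_mul])
    have h2 : -4 ≤ a - s := by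
      by_contra hn
      exact hs (by rw [hx _ (by omega), mul_zero])
    omega
  have e2 : ∀ x : ℤ → ℤ, (∀ z < -4, x z = 0) →
      zconv g x (a + 2 * r) = ∑ s ∈ I, g (s + 2 * r) * x (a - s) := by
    intro x hx
    unfold zconv
    rw [← finsum_comp_equiv (Equiv.addRight (2 * (r : ℤ)))]
    have : ∀ s, g (Equiv.addRight (2 * (r : ℤ)) s) *
        x (a + 2 * r - Equiv.addRight (2 * (r : ℤ)) s) = g (s + 2 * r) * x (a - s) := fun s => by
      rw [Equiv.coe_addRight, add_sub_add_right_eq_sub]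
    simp only [this]
    refine finsum_eq_sum_of_support_subset _ fun s hs => ?_
    rw [Function.mem_support] at hs
    rw [Finset.mem_coe, Finset.mem_Icc]
    have h1 : 0 ≤ s + 2 * r := by
      by_contra hn
      exact hs (by rw [hg0 _ (by omega), zero_mul])
    have h2 : -4 ≤ a - s := by
      by_contra hn
      exact hs (by rw [hx _ (by omega), mul_zero])
    omega
  rw [e1 x hx0, e1 y hy0, e2 x hx0, e2 y hy0]
  refine cauchy_binet_le (fun s t hst => hg s t hst r) fun s t hst => ?_
  have := hxy (a - t) (a - s) (by omega)
  linarith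

theorem sum_range_two_mul (h : ℕ → ℤ) (n : ℕ) :
    ∑ s ∈ Finset.range (2 * n), h s = ∑ i ∈ Finset.range n, (h (2 * i) + h (2 * i + 1)) := by
  induction n with
  | zero => simp
  | succ n ih =>
    rw [Finset.sum_range_succ, ← ih, Nat.mul_succ, Finset.sum_range_succ, Finset.sum_range_succ,
      add_assoc]

theorem conv_cast (a b : ℕ → ℕ) (n : ℕ) :
    (conv a b n : ℤ) = ∑ i ∈ Finset.range (n + 1), (a i : ℤ) * b (n - i) := by
  unfold conv
  push_cast
  exact Finset.Nat.sum_antidiagonal_eq_sum_range_succ (fun i j => (a i : ℤ) * b j) n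

/-- The convolution of merged sequences in terms of the given ones. -/
theorem extend_eq_zconv {D S p q X : ℕ → ℕ}
    (hX : ∀ i, X i = 2 * conv D p i + 4 * conv D q i + 6 * conv S q i) {x : ℤ → ℤ}
    (hp : ∀ k, x (2 * k) = extend p k) (hq : ∀ k, x (2 * k + 1) = extend q k) (k : ℤ) :
    extend X k = 2 * zconv (weighted (interleave S D)) x (2 * k + 1) := by
  have hg0 : ∀ s < 0, weighted (interleave S D) s = 0 := by
    intro s hs
    unfold weighted
    split_ifs
    · rw [interleave_of_neg _ _ (by omega), interleave_of_neg _ _ hs]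
      simp
    · exact interleave_of_neg _ _ hs
  have hx0 : ∀ z < 0, x z = 0 := by
    intro z hz
    obtain ⟨k, rfl | rfl⟩ := Int.even_or_odd' z
    · rw [hp, extend_of_neg _ (by omega)]
    · rw [hq, extend_of_neg _ (by omega)]
  rcases lt_or_ge k 0 with hk | hk
  · rw [extend_of_neg _ hk, zconv, finsum_eq_zero_of_forall_eq_zero, mul_zero]
    intro s
    rcases lt_or_ge s 0 with hs | hs
    · rw [hg0 s hs, zero_mul]
    · rw [hx0 _ (by omega), mul_zero]
  · lift k to ℕ using hk
    have h1 : zconv (weighted (interleave S D)) x (2 * k + 1) =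
        ∑ s ∈ Finset.range (2 * (k + 1)), weighted (interleave S D) s * x (2 * k + 1 - s) := by
      unfold zconv
      rw [finsum_eq_sum_of_support_subset (s := (Finset.range (2 * (k + 1))).map Nat.castEmbedding)]
      · rw [Finset.sum_map]
        rfl
      · intro s hs
        rw [Function.mem_support] at hs
        have h1 : 0 ≤ s := by
          by_contra hn
          exact hs (by rw [hg0 s (by omega), zero_mul])
        have h2 : 0 ≤ 2 * (k : ℤ) + 1 - s := by
          by_contra hn
          exact hs (by rw [hx0 _ (by omega), mul_zero])
        lift s to ℕ using h1
        rw [Finset.coe_map]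
        exact ⟨s, by simp; omega, rfl⟩
    rw [h1, sum_range_two_mul, extend_natCast, hX]
    push_cast
    rw [conv_cast, conv_cast, conv_cast, Finset.mul_sum, Finset.mul_sum, Finset.mul_sum,
      Finset.mul_sum, ← Finset.sum_add_distrib, ← Finset.sum_add_distrib]
    refine Finset.sum_congr rfl fun i hi => ?_
    have hik : i ≤ k := Nat.lt_succ_iff.1 (Finset.mem_range.1 hi)
    have e1 : weighted (interleave S D) (2 * (i : ℤ)) = 2 * D i + 3 * S i := by
      unfold weighted
      rw [if_pos (by omega), interleave_two_mul_add_one, interleave_two_mul, extend_natCast,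
        extend_natCast]
    have e2 : weighted (interleave S D) (2 * (i : ℤ) + 1) = D i := by
      unfold weighted
      rw [if_neg (by omega), interleave_two_mul_add_one, extend_natCast]
    have e3 : x (2 * (k : ℤ) + 1 - 2 * i) = q (k - i) := by
      rw [show 2 * (k : ℤ) + 1 - 2 * i = 2 * ((k - i : ℕ) : ℤ) + 1 by omega, hq, extend_natCast]
    have e4 : x (2 * (k : ℤ) + 1 - (2 * i + 1)) = p (k - i) := by
      rw [show 2 * (k : ℤ) + 1 - (2 * i + 1) = 2 * ((k - i : ℕ) : ℤ) by omega, hp, extend_natCast]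
    rw [e1, e2, e3, e4]
    ring

/-! ## Amalgamation preserves ratio monotonicity -/

namespace DoublyRootedGraph

variable {H : DoublyRootedGraph.{u}}

theorem lexPair
    (hz : NoInternalZeros H.A₁ ∧ NoInternalZeros H.A₂ ∧ NoInternalZeros H.B₁ ∧ NoInternalZeros H.B₂)
    (hlex : H.Lexicographic) : LexPair (interleave H.B₁ H.A₁) (interleave H.B₂ H.A₂) := by
  simp only [Lexicographic, ratioLE_iff] at hlex
  have hn1 := interleave_nonneg H.B₁ H.A₁
  have hn2 := interleave_nonneg H.B₂ H.A₂
  have hl1 : ∀ m, interleave H.B₁ H.A₁ m * interleave H.B₂ H.A₂ (m + 1) ≤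
      interleave H.B₂ H.A₂ m * interleave H.B₁ H.A₁ (m + 1) := by
    intro m
    rcases lt_or_ge m 0 with hm | hm
    · rw [interleave_of_neg _ _ hm, zero_mul]
      exact mul_nonneg (hn2 _) (hn1 _)
    lift m to ℕ using hm
    obtain ⟨k, rfl | rfl⟩ := Nat.even_or_odd' m
    · have := (hlex k).1
      push_cast
      simp only [interleave_two_mul, interleave_two_mul_add_one, extend_natCast]
      exact_mod_cast this
    · have := (hlex (k + 1)).2.2.1
      rw [show ((2 * k + 1 : ℕ) : ℤ) + 1 = 2 * ((k + 1 : ℕ) : ℤ) by push_cast; ring,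
        show ((2 * k + 1 : ℕ) : ℤ) = 2 * (k : ℤ) + 1 by push_cast; ring]
      simp only [interleave_two_mul, interleave_two_mul_add_one, extend_natCast]
      exact_mod_cast this
  have hl2 : ∀ m, interleave H.B₂ H.A₂ m * interleave H.B₁ H.A₁ (m + 3) ≤
      interleave H.B₁ H.A₁ (m + 2) * interleave H.B₂ H.A₂ (m + 1) := by
    intro m
    rcases lt_or_ge m 0 with hm | hm
    · rw [interleave_of_neg _ _ hm, zero_mul]
      exact mul_nonneg (hn1 _) (hn2 _)
    lift m to ℕ using hm
    obtain ⟨k, rfl | rfl⟩ := Nat.even_or_odd' m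
    · have := (hlex k).2.1
      rw [show ((2 * k : ℕ) : ℤ) + 3 = 2 * ((k + 1 : ℕ) : ℤ) + 1 by push_cast; ring,
        show ((2 * k : ℕ) : ℤ) + 2 = 2 * ((k + 1 : ℕ) : ℤ) by push_cast; ring]
      push_cast
      simp only [interleave_two_mul, interleave_two_mul_add_one, extend_natCast]
      rw [← Nat.cast_succ, extend_natCast, extend_natCast]
      exact_mod_cast this
    · have := (hlex (k + 1)).2.2.2
      rw [show ((2 * k + 1 : ℕ) : ℤ) + 3 = 2 * ((k + 2 : ℕ) : ℤ) by push_cast; ring,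
        show ((2 * k + 1 : ℕ) : ℤ) + 2 = 2 * ((k + 1 : ℕ) : ℤ) + 1 by push_cast; ring,
        show ((2 * k + 1 : ℕ) : ℤ) + 1 = 2 * ((k + 1 : ℕ) : ℤ) by push_cast; ring,
        show ((2 * k + 1 : ℕ) : ℤ) = 2 * (k : ℤ) + 1 by push_cast; ring]
      simp only [interleave_two_mul, interleave_two_mul_add_one, extend_natCast]
      exact_mod_cast this
  -- The twist raises the genus by at most one and may change the type at `v`; an embedding at index
  -- `n` of the second sequence lands at `n`, `n + 1` or `n + 2` of the first.
  have hnear1 : ∀ n, interleave H.B₁ H.A₁ n = 0 → interleave H.B₁ H.A₁ (n + 1) = 0 →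
      interleave H.B₁ H.A₁ (n + 2) = 0 → interleave H.B₂ H.A₂ n = 0 := by
    intro n h0 h1 h2
    rcases lt_or_ge n 0 with hm | hm
    · exact interleave_of_neg _ _ hm
    lift n to ℕ using hm
    obtain ⟨k, rfl | rfl⟩ := Nat.even_or_odd' n
    · rw [show ((2 * k : ℕ) : ℤ) + 2 = 2 * ((k + 1 : ℕ) : ℤ) by push_cast; ring] at h2
      rw [show ((2 * k : ℕ) : ℤ) = 2 * (k : ℤ) by push_cast; ring] at *
      simp only [interleave_two_mul, interleave_two_mul_add_one, extend_natCast,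
        Nat.cast_eq_zero] at *
      simp only [A₁, B₁, B₂, SS, DS, Pi.add_apply, offset] at *
      omega
    · rw [show ((2 * k + 1 : ℕ) : ℤ) + 2 = 2 * ((k + 1 : ℕ) : ℤ) + 1 by push_cast; ring] at h2
      rw [show ((2 * k + 1 : ℕ) : ℤ) + 1 = 2 * ((k + 1 : ℕ) : ℤ) by push_cast; ring] at h1
      rw [show ((2 * k + 1 : ℕ) : ℤ) = 2 * (k : ℤ) + 1 by push_cast; ring] at *
      simp only [interleave_two_mul, interleave_two_mul_add_one, extend_natCast,
        Nat.cast_eq_zero] at *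
      simp only [A₁, B₁, A₂, SD, DD, Pi.add_apply, offset] at *
      omega
  have hnear2 : ∀ n, interleave H.B₂ H.A₂ (n - 2) = 0 → interleave H.B₂ H.A₂ (n - 1) = 0 →
      interleave H.B₂ H.A₂ n = 0 → interleave H.B₁ H.A₁ n = 0 := by
    intro n h0 h1 h2
    rcases lt_or_ge n 0 with hm | hm
    · exact interleave_of_neg _ _ hm
    lift n to ℕ using hm
    obtain ⟨k, rfl | rfl⟩ := Nat.even_or_odd' n
    · rw [show ((2 * k : ℕ) : ℤ) = 2 * (k : ℤ) by push_cast; ring] at *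
      rcases k with _ | k
      · simp only [interleave_two_mul, extend_natCast, Nat.cast_eq_zero] at h2 ⊢
        simp only [B₁, B₂, SS, DS, Pi.add_apply, offset] at *
        omega
      · rw [show 2 * ((k + 1 : ℕ) : ℤ) - 2 = 2 * (k : ℤ) by push_cast; ring] at h0
        rw [show 2 * ((k + 1 : ℕ) : ℤ) - 1 = 2 * (k : ℤ) + 1 by push_cast; ring] at h1
        simp only [interleave_two_mul, interleave_two_mul_add_one, extend_natCast,
          Nat.cast_eq_zero] at *
        simp only [A₂, B₁, B₂, SD, DD, SS, DS, Pi.add_apply, offset] at *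
        omega
    · rw [show ((2 * k + 1 : ℕ) : ℤ) = 2 * (k : ℤ) + 1 by push_cast; ring] at *
      rw [add_sub_cancel_right] at h1
      rcases k with _ | k
      · simp only [interleave_two_mul, interleave_two_mul_add_one, extend_natCast,
          Nat.cast_eq_zero] at h1 h2 ⊢
        simp only [A₁, A₂, B₂, SD, DD, SS, DS, Pi.add_apply, offset] at *
        omega
      · rw [show 2 * ((k + 1 : ℕ) : ℤ) + 1 - 2 = 2 * (k : ℤ) + 1 by push_cast; ring] at h0
        simp only [interleave_two_mul, interleave_two_mul_add_one, extend_natCast,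
          Nat.cast_eq_zero] at *
        simp only [A₁, A₂, B₂, SD, DD, SS, DS, Pi.add_apply, offset] at *
        omega
  -- `A₂` and `B₂` are the distributions of the rooted graph (`H`, `v`), so the adjacency argument
  -- applies to them.
  have hs2 : Solid (interleave H.B₂ H.A₂) := by
    refine solid_interleave hz.2.2.2 hz.2.1 fun hA hB => ?_
    have := H.rootV.exists_adjacent
    rw [rootV_D, rootV_S] at this
    exact this hA hB
  exact ⟨hn1, hn2, hl1, hl2, hnear1, hnear2,
    solid_of_solid hl1 hl2 hn1 hn2 hnear1 hnear2 (parityConnected_interleave hz.2.2.1 hz.1) hs2,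
    hs2⟩

end DoublyRootedGraph

/-- The four cases (step one or two, even or odd index) are `zconv_mul_le` for (α, β), (β, α(· +
2)), (α, α(· + 2)) and (β, β(· + 2)), with inputs `r1` to `r4`. -/
theorem RatioMonotone.amalg {G : RootedGraph.{u}} (hG : RatioMonotone (interleave G.S G.D))
    {H : DoublyRootedGraph.{u}}
    (hz : NoInternalZeros H.A₁ ∧ NoInternalZeros H.A₂ ∧ NoInternalZeros H.B₁ ∧ NoInternalZeros H.B₂)
    (hne : (H.A₁ ≠ 0 ∨ H.A₂ ≠ 0) ∧ (H.B₁ ≠ 0 ∨ H.B₂ ≠ 0)) (hlex : H.Lexicographic) :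
    RatioMonotone (interleave (amalg G H).S (amalg G H).D) := by
  have hp := DoublyRootedGraph.lexPair hz hlex
  set c₁ := interleave H.B₁ H.A₁ with hc₁
  set c₂ := interleave H.B₂ H.A₂ with hc₂
  set α := merge c₁ c₂ with hα
  set β := merge (fun n => c₁ (n + 1)) (fun n => c₂ (n + 1)) with hβ
  set g := weighted (interleave G.S G.D) with hg
  have α0 : ∀ k, α (2 * k) = extend H.B₁ k := fun k => by
    rw [hα, merge_two_mul, hc₁, interleave_two_mul]
  have α1 : ∀ k, α (2 * k + 1) = extend H.B₂ k := fun k => by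
    rw [hα, merge_two_mul_add_one, hc₂, interleave_two_mul]
  have β0 : ∀ k, β (2 * k) = extend H.A₁ k := fun k => by
    rw [hβ, merge_two_mul, hc₁, interleave_two_mul_add_one]
  have β1 : ∀ k, β (2 * k + 1) = extend H.A₂ k := fun k => by
    rw [hβ, merge_two_mul_add_one, hc₂, interleave_two_mul_add_one]
  have hS := extend_eq_zconv (amalg_S G H) α0 α1
  have hD := extend_eq_zconv (amalg_D G H) β0 β1
  have hneg : ∀ {p q : ℕ → ℕ} {x : ℤ → ℤ}, (∀ k, x (2 * k) = extend p k) →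
      (∀ k, x (2 * k + 1) = extend q k) → ∀ z < 0, x z = 0 := by
    intro p q x h0 h1 z hz
    obtain ⟨k, rfl | rfl⟩ := Int.even_or_odd' z
    · rw [h0, extend_of_neg _ (by omega)]
    · rw [h1, extend_of_neg _ (by omega)]
  have hαn := hneg α0 α1
  have hβn := hneg β0 β1
  have hg0 : ∀ s < 0, g s = 0 := by
    intro s hs
    rw [hg]
    unfold weighted
    split_ifs
    · rw [interleave_of_neg _ _ (by omega), interleave_of_neg _ _ hs]
      simp
    · exact interleave_of_neg _ _ hs
  have r1 : ∀ s t, s ≤ t → α s * β t ≤ α t * β s := fun s t hst => hp.merge_ratio hst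
  have r2 : ∀ s t, s ≤ t → β s * α (t + 2) ≤ β t * α (s + 2) := fun s t hst => by
    have := hp.shift.merge_ratio hst
    rwa [merge_shift_two, merge_shift_two] at this
  have hαp : ∀ t, 0 ≤ α t := hp.merge_nonneg
  have hβp : ∀ t, 0 ≤ β t := hp.shift.merge_nonneg
  have hex : ∀ {p q : ℕ → ℕ} {x : ℤ → ℤ}, (∀ k, x (2 * k) = extend p k) →
      (∀ k, x (2 * k + 1) = extend q k) → p ≠ 0 ∨ q ≠ 0 → ∃ n : ℕ, x n ≠ 0 := by
    intro p q x h0 h1 h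
    rcases h with h | h
    · obtain ⟨n, hn⟩ := Function.ne_iff.1 h
      refine ⟨2 * n, ?_⟩
      push_cast
      rw [h0, extend_natCast]
      exact_mod_cast hn
    · obtain ⟨n, hn⟩ := Function.ne_iff.1 h
      refine ⟨2 * n + 1, ?_⟩
      push_cast
      rw [h1, extend_natCast]
      exact_mod_cast hn
  have hβe : ∃ z, β z ≠ 0 := by
    obtain ⟨n, hn⟩ := hex β0 β1 hne.1
    exact ⟨n, hn⟩
  have hαe : ∃ z, α (z + 2) ≠ 0 := by
    obtain ⟨n, hn⟩ := hex α0 α1 hne.2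
    exact ⟨n - 2, by simpa using hn⟩
  have r3 : ∀ s t, s ≤ t → α s * α (t + 2) ≤ α t * α (s + 2) := fun s t hst =>
    log_concave_of_ratio hαp hβp r1 r2 hβe hst
  have r4 : ∀ s t, s ≤ t → β s * β (t + 2) ≤ β t * β (s + 2) := fun s t hst =>
    log_concave_of_ratio (α := β) (β := fun t => α (t + 2)) hβp (fun t => hαp _) r2
      (fun s t hst => r1 (s + 2) (t + 2) (by omega)) hαe hst
  have hgr : ∀ s t, s ≤ t → ∀ r : ℕ, g s * g (t + 2 * r) ≤ g (s + 2 * r) * g t :=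
    fun s t hst r => hG.weighted_ratio_shift hst r
  refine ⟨fun m r => ?_, fun m r => ?_⟩
  · obtain ⟨k, rfl | rfl⟩ := Int.even_or_odd' m
    · rw [show 2 * k + 2 * (r : ℤ) + 1 = 2 * (k + r) + 1 by ring,
        show 2 * k + 2 * (r : ℤ) = 2 * (k + r) by ring]
      simp only [interleave_two_mul, interleave_two_mul_add_one, hS, hD]
      have := zconv_mul_le hg0 (fun z hz => hαn z (by omega)) (fun z hz => hβn z (by omega)) hgr r1
        (2 * k + 1) r
      rw [show 2 * k + 1 + 2 * (r : ℤ) = 2 * (k + r) + 1 by ring] at this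
      linarith
    · rw [show 2 * k + 1 + 2 * (r : ℤ) + 1 = 2 * (k + r + 1) by ring,
        show 2 * k + 1 + 1 = 2 * (k + 1) by ring,
        show 2 * k + 1 + 2 * (r : ℤ) = 2 * (k + r) + 1 by ring]
      simp only [interleave_two_mul, interleave_two_mul_add_one, hS, hD]
      have := zconv_mul_le hg0 (fun z hz => hβn z (by omega)) (y := fun z => α (z + 2))
        (fun z hz => hαn _ (by omega)) hgr r2 (2 * k + 1) r
      rw [zconv_add, zconv_add, show 2 * k + 1 + 2 * (r : ℤ) + 2 = 2 * (k + r + 1) + 1 by ring,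
        show 2 * k + 1 + 2 * (r : ℤ) = 2 * (k + r) + 1 by ring,
        show 2 * k + 1 + 2 = 2 * (k + 1) + 1 by ring] at this
      linarith
  · obtain ⟨k, rfl | rfl⟩ := Int.even_or_odd' m
    · rw [show 2 * k + 2 * (r : ℤ) + 2 = 2 * (k + r + 1) by ring,
        show 2 * k + 2 = 2 * (k + 1) by ring,
        show 2 * k + 2 * (r : ℤ) = 2 * (k + r) by ring]
      simp only [interleave_two_mul, hS]
      have := zconv_mul_le hg0 (fun z hz => hαn z (by omega)) (y := fun z => α (z + 2))
        (fun z hz => hαn _ (by omega)) hgr r3 (2 * k + 1) r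
      rw [zconv_add, zconv_add, show 2 * k + 1 + 2 * (r : ℤ) + 2 = 2 * (k + r + 1) + 1 by ring,
        show 2 * k + 1 + 2 * (r : ℤ) = 2 * (k + r) + 1 by ring,
        show 2 * k + 1 + 2 = 2 * (k + 1) + 1 by ring] at this
      linarith
    · rw [show 2 * k + 1 + 2 * (r : ℤ) + 2 = 2 * (k + r + 1) + 1 by ring,
        show 2 * k + 1 + 2 = 2 * (k + 1) + 1 by ring,
        show 2 * k + 1 + 2 * (r : ℤ) = 2 * (k + r) + 1 by ring]
      simp only [interleave_two_mul_add_one, hD]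
      have := zconv_mul_le hg0 (fun z hz => hβn z (by omega)) (y := fun z => β (z + 2))
        (fun z hz => hβn _ (by omega)) hgr r4 (2 * k + 1) r
      rw [zconv_add, zconv_add, show 2 * k + 1 + 2 * (r : ℤ) + 2 = 2 * (k + r + 1) + 1 by ring,
        show 2 * k + 1 + 2 * (r : ℤ) = 2 * (k + r) + 1 by ring,
        show 2 * k + 1 + 2 = 2 * (k + 1) + 1 by ring] at this
      linarith

/-! ## Consequences of ratio monotonicity -/

namespace RatioMonotone

variable {D S : ℕ → ℕ}

theorem S_mul_D_le (h : RatioMonotone (interleave S D)) {i j k l : ℕ} (hs : i + l = k + j)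
    (hik : i ≤ k) (hij : i ≤ j) : S i * D l ≤ D j * S k := by
  have := h.inward_odd (p := 2 * i) (k := l - i) (j := 2 * (k - i)) (by omega)
  rw [show 2 * (i : ℤ) + 2 * ((l - i : ℕ) : ℤ) + 1 = 2 * (l : ℤ) + 1 by omega,
    show 2 * (i : ℤ) + ((2 * (k - i) : ℕ) : ℤ) = 2 * (k : ℤ) by omega,
    show 2 * (l : ℤ) + 1 - ((2 * (k - i) : ℕ) : ℤ) = 2 * (j : ℤ) + 1 by omega] at this
  simp only [interleave_two_mul, interleave_two_mul_add_one, extend_natCast] at this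
  rw [mul_comm (D j)]
  exact_mod_cast this

/-- The inequality `i < k` is strict because `D i` stands at `2i + 1`, to the right of `S i`. -/
theorem D_mul_S_le (h : RatioMonotone (interleave S D)) {i j k l : ℕ} (hs : i + l = k + j)
    (hij : i ≤ j) (hik : i < k) : D i * S l ≤ D j * S k := by
  have := h.inward_odd (p := 2 * i + 1) (k := l - i - 1) (j := 2 * (j - i)) (by omega)
  rw [show 2 * (i : ℤ) + 1 + 2 * ((l - i - 1 : ℕ) : ℤ) + 1 = 2 * (l : ℤ) by omega,
    show 2 * (i : ℤ) + 1 + ((2 * (j - i) : ℕ) : ℤ) = 2 * (j : ℤ) + 1 by omega,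
    show 2 * (l : ℤ) - ((2 * (j - i) : ℕ) : ℤ) = 2 * (k : ℤ) by omega] at this
  simp only [interleave_two_mul, interleave_two_mul_add_one, extend_natCast] at this
  exact_mod_cast this

theorem S_mul_S_le (h : RatioMonotone (interleave S D)) {i j k l : ℕ} (hs : i + l = k + j)
    (hij : i ≤ j) (hik : i ≤ k) : S i * S l ≤ S j * S k := by
  have := h.inward_even (p := 2 * i) (k := l - i) (j := j - i) (by omega)
  rw [show 2 * (i : ℤ) + 2 * ((l - i : ℕ) : ℤ) = 2 * (l : ℤ) by omega,
    show 2 * (i : ℤ) + 2 * ((j - i : ℕ) : ℤ) = 2 * (j : ℤ) by omega,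
    show 2 * (l : ℤ) - 2 * ((j - i : ℕ) : ℤ) = 2 * (k : ℤ) by omega] at this
  simp only [interleave_two_mul, extend_natCast] at this
  exact_mod_cast this

theorem D_mul_D_le (h : RatioMonotone (interleave S D)) {i j k l : ℕ} (hs : i + l = k + j)
    (hij : i ≤ j) (hik : i ≤ k) : D i * D l ≤ D j * D k := by
  have := h.inward_even (p := 2 * i + 1) (k := l - i) (j := j - i) (by omega)
  rw [show 2 * (i : ℤ) + 1 + 2 * ((l - i : ℕ) : ℤ) = 2 * (l : ℤ) + 1 by omega,
    show 2 * (i : ℤ) + 1 + 2 * ((j - i : ℕ) : ℤ) = 2 * (j : ℤ) + 1 by omega,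
    show 2 * (l : ℤ) + 1 - 2 * ((j - i : ℕ) : ℤ) = 2 * (k : ℤ) + 1 by omega] at this
  simp only [interleave_two_mul_add_one, extend_natCast] at this
  exact_mod_cast this

theorem ne_zero_of_mul_le {x y z w : ℕ} (h : x * y ≤ z * w) (hx : x ≠ 0) (hy : y ≠ 0) : z ≠ 0 := by
  rintro rfl
  rw [zero_mul, Nat.le_zero, mul_eq_zero] at h
  tauto

theorem logConcave_D (h : RatioMonotone (interleave S D)) : LogConcave D := fun k => by
  rw [sq]
  exact h.D_mul_D_le (by omega) (by omega) (by omega)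

theorem logConcave_S (h : RatioMonotone (interleave S D)) : LogConcave S := fun k => by
  rw [sq]
  exact h.S_mul_S_le (by omega) (by omega) (by omega)

theorem noInternalZeros_D (h : RatioMonotone (interleave S D)) : NoInternalZeros D :=
  fun i k j hik hkj hi hj => ne_zero_of_mul_le
    (h.D_mul_D_le (j := k) (k := i + j - k) (by omega) hik.le (by omega)) hi hj

theorem noInternalZeros_S (h : RatioMonotone (interleave S D)) : NoInternalZeros S :=
  fun i k j hik hkj hi hj => ne_zero_of_mul_le
    (h.S_mul_S_le (j := k) (k := i + j - k) (by omega) hik.le (by omega)) hi hj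

theorem ratioDominated (h : RatioMonotone (interleave S D)) : RatioDominated D S := by
  refine ⟨⟨h.logConcave_D, h.logConcave_S, fun k => ?_, fun k => ?_⟩, fun k => ?_⟩
  · exact h.D_mul_S_le (by omega) (by omega) (by omega)
  · rw [mul_comm]
    exact h.S_mul_D_le (by omega) (by omega) (by omega)
  · rw [mul_comm]
    exact h.S_mul_D_le (by omega) (by omega) (by omega)

/-- Synchronicity bounds each of the two cross terms by the product of the middle terms. -/
theorem logConcave_add (h : RatioMonotone (interleave S D)) : LogConcave (D + S) := by
  intro k
  have h1 := h.logConcave_D k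
  have h2 := h.logConcave_S k
  obtain ⟨⟨-, -, h3, h4⟩, -⟩ := h.ratioDominated
  have h3 := h3 k
  have h4 := h4 k
  simp only [Pi.add_apply]
  nlinarith

theorem noInternalZeros_add (h : RatioMonotone (interleave S D)) : NoInternalZeros (D + S) := by
  intro i k j hik hkj hi hj
  simp only [Pi.add_apply, ne_eq, Nat.add_eq_zero_iff, not_and_or] at *
  rcases hi with hi | hi <;> rcases hj with hj | hj
  · exact Or.inl (h.noInternalZeros_D i k j hik hkj hi hj)
  · exact Or.inl (ne_zero_of_mul_le
      (h.D_mul_S_le (j := k) (k := i + j - k) (by omega) hik.le (by omega)) hi hj)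
  · exact Or.inl (ne_zero_of_mul_le
      (h.S_mul_D_le (j := k) (k := i + j - k) (by omega) (by omega) hik.le) hi hj)
  · exact Or.inr (h.noInternalZeros_S i k j hik hkj hi hj)

end RatioMonotone

theorem ratioMonotone_chain (Hs : List DoublyRootedGraph.{u})
    (hzeros : ∀ H ∈ Hs, NoInternalZeros H.A₁ ∧ NoInternalZeros H.A₂ ∧
      NoInternalZeros H.B₁ ∧ NoInternalZeros H.B₂)
    (hne : ∀ H ∈ Hs, (H.A₁ ≠ 0 ∨ H.A₂ ≠ 0) ∧ (H.B₁ ≠ 0 ∨ H.B₂ ≠ 0))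
    (hlex : ∀ H ∈ Hs, H.Lexicographic) {G : RootedGraph.{u}}
    (hG : RatioMonotone (interleave G.S G.D)) :
    RatioMonotone (interleave (chain G Hs).S (chain G Hs).D) := by
  induction Hs generalizing G with
  | nil => exact hG
  | cons H Hs ih =>
    exact ih (fun K hK => hzeros K (List.mem_cons_of_mem _ hK))
      (fun K hK => hne K (List.mem_cons_of_mem _ hK))
      (fun K hK => hlex K (List.mem_cons_of_mem _ hK))
      (hG.amalg (hzeros H List.mem_cons_self) (hne H List.mem_cons_self)
        (hlex H List.mem_cons_self))

end GenusChain

theorem mainTheorem1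
    (G : GenusChain.RootedGraph.{u})
    (hD : GenusChain.NoInternalZeros G.D)
    (hS : GenusChain.NoInternalZeros G.S)
    (hG : GenusChain.RatioDominated G.D G.S)
    (Hs : List GenusChain.DoublyRootedGraph.{u})
    (hzeros : ∀ H ∈ Hs,
      GenusChain.NoInternalZeros H.A₁ ∧ GenusChain.NoInternalZeros H.A₂ ∧
      GenusChain.NoInternalZeros H.B₁ ∧ GenusChain.NoInternalZeros H.B₂)
    (hne : ∀ H ∈ Hs, (H.A₁ ≠ 0 ∨ H.A₂ ≠ 0) ∧ (H.B₁ ≠ 0 ∨ H.B₂ ≠ 0))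
    (hlex : ∀ H ∈ Hs, H.Lexicographic) :
    (GenusChain.LogConcave (GenusChain.chain G Hs).D ∧
      GenusChain.NoInternalZeros (GenusChain.chain G Hs).D) ∧
    (GenusChain.LogConcave (GenusChain.chain G Hs).S ∧
      GenusChain.NoInternalZeros (GenusChain.chain G Hs).S) ∧
    GenusChain.RatioDominated (GenusChain.chain G Hs).D (GenusChain.chain G Hs).S ∧
    (GenusChain.LogConcave (GenusChain.chain G Hs).genusDist ∧
      GenusChain.NoInternalZeros (GenusChain.chain G Hs).genusDist) := by
  have h := GenusChain.ratioMonotone_chain Hs hzeros hne hlex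
    (GenusChain.ratioMonotone_of_ratioDominated hD hS hG G.exists_adjacent)
  rw [GenusChain.RootedGraph.genusDist_eq]
  exact ⟨⟨h.logConcave_D, h.noInternalZeros_D⟩, ⟨h.logConcave_S, h.noInternalZeros_S⟩,
    h.ratioDominated, h.logConcave_add, h.noInternalZeros_add⟩
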